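/- **Setting.** Let $Q=(0,\infty)\times\mathbb R$, $B_\rho=(-\rho,\rho)$, $B_\rho^c=\mathbb R\setminus B_\rho$, and let $m\in\{1,2,3\}$, $\alpha,\beta>0$. Let $E\subset(0,\infty)$ be a set of parameters $\varepsilon$ with $0\in\overline E$ (e.g. $E=(0,\infty)$ or $E=\{1/n\}_{n\ge1}$); limits $\varepsilon\to0$ are taken along $E$. Let $\alpha_\varepsilon>0$ satisfy, as $\varepsilon\to0$: $\alpha_\varepsilon\to\alpha$ if $m=1$; $\alpha_\varepsilon\to\infty$ and $\varepsilon\alpha_\varepsilon\to0$ if $m=2$; $\varepsilon\alpha_\varepsilon\to\beta$ if $m=3$. **Assumptions.** $U\in C^1(\mathbb R)$ and $U'$ is Lipschitz. $V:\mathbb R\setminus\{0\}\to\mathbb R$ is even, convex on $(0,\infty)$, $V\in W^{2,1}_{\rm loc}(0,\infty)$ and $V''\in L^\infty(1,\infty)$. In addition, writing $\mathbb V_3(x)=\sup_{y>x}|V'''(y)|$ and $\mathbb V_3^1(x)=\sup_{x<y<1}|V'''(y)|$: * if $m=1$: $V''\in L^1(1,\infty)$, $V\in C^3((0,\infty))$,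 and $x\mapsto x^3\mathbb V_3^1(x)$ is in $L^1(0,1)$; * if $m=2$: $V\in C^3((0,\infty))$, $V\in W^{3,1}(1,\infty)$, $x\mapsto x^3\mathbb V_3(x)$ is in $L^1(0,\infty)$, and $x^4V'''(x)\to0$ as $x\downarrow0$; * if $m=3$: $V\in C^4((0,\infty))$, $V\in W^{3,1}(1,\infty)$, $x\mapsto x^2V''(x)$ is in $L^1(0,1)$, $x\mapsto x^3\mathbb V_3(x)$ is in $L^1(1,\infty)$, and $\sup_{x>1}x^{k+1}|V^{(k)}(x)|<\infty$ for $k=3,4$. **Hamiltonians.** Put $V_a(x)=aV(ax)$, $E_\varepsilon[\gamma]=\varepsilon(\lfloor\gamma/\varepsilon\rfloor+\tfrac12)$, with upper and lower semicontinuous envelopes $E_\varepsilon^*$, $E_{\varepsilon,*}$. For $\rho>0$ and $\phi_x(t,x)\ne0$ set $$\overline H_{\rho,\varepsilon}[\phi,u](t,x)=\Big(\mathrm{pv}\!\int_{B_\rho}\!E_\varepsilon^*[\phi(t,x+z)-\phi(t,x)]V_{\alpha_\varepsilon}''(z)\,dz+\int_{B_\rho^c}\!E_\varepsilon^*[u(t,x+z)-u(t,x)]V_{\alpha_\varepsilon}''(z)\,dz+U'(x)\Big)|\phi_x(t,x)|,$$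 and let $\underline H_{\rho,\varepsilon}$ be the same with $E_{\varepsilon,*}$ in place of $E_\varepsilon^*$. Set $$H_\rho[\phi,u](t,x)=\Big(\int_{B_\rho}\!\big(\phi(t,x+z)-\phi(t,x)-\phi_x(t,x)z\big)V_\alpha''(z)\,dz+\int_{B_\rho^c}\!\big(u(t,x+z)-u(t,x)\big)V_\alpha''(z)\,dz+U'(x)\Big)|\phi_x(t,x)|,$$ $f_2(y)=\|V\|_{L^1(\mathbb R)}|y|$, $f_3(0)=0$ and $f_3(y)=\frac{\beta^3}{y^2}\sum_{k\ge1}k^2V''(k\beta/y)$ for $y\neq0$. **Sub- and supersolutions.** Given a Hamiltonian $H$ and $k\in\{2,3\}$, a bounded upper semicontinuous $u:Q\to\mathbb R$ is a subsolution (with test functions in $C^k(Q)$) if, whenever $\phi\in C^k(Q)$ and $u-\phi$ has a global maximum over $Q$ at $(\bar t,\bar x)\in Q$: (i) $\phi_t(\bar t,\bar x)\le H[\phi,u](\bar t,\bar x)$ if $\phi_x(\bar t,\bar x)\ne0$; (ii) $\phi_t(\bar t,\bar x)\le0$ if $\phi(t,x)=\theta|x-\bar x|^4+g(t)$ on $Q$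 for some $\theta\in\mathbb R$, $g\in C^2((0,\infty))$; (iii) nothing is required otherwise. Supersolutions are bounded lower semicontinuous $v$ with the reversed inequalities at global minima of $v-\psi$. A $\rho$-subsolution (resp. $\rho$-supersolution) of $(HJ_\varepsilon)$ is one for $H=\overline H_{\rho,\varepsilon}$ (resp. $\underline H_{\rho,\varepsilon}$), $k=2$. A sub- or supersolution of $(HJ^1)$ is one for $H=H_\rho$, $k=2$, for every $\rho>0$. A sub- or supersolution of $(HJ^m)$ for $m=2,3$ is one for $H[\phi]=f_m(\phi_x)\phi_{xx}+U'|\phi_x|$, $k=m$. **Theorem.** Let $(u_\varepsilon)_{\varepsilon\in E}$ be such that each $u_\varepsilon$ is a $\rho_\varepsilon$-subsolution of $(HJ_\varepsilon)$ for some $\rho_\varepsilon>0$ and $\sup_{\varepsilon\in E}\sup_Q|u_\varepsilon|<\infty$. Then $$\overline u(t,x)=\limsup_{(s,y,\varepsilon)\to(t,x,0)}u_\varepsilon(s,y),\qquad (t,x)\in Q,$$ is a subsolution of $(HJ^m)$. Similarly, if each $v_\varepsilon$ is a $\rho_\varepsilon$-supersolution of $(HJ_\varepsilon)$ for some $\rho_\varepsilon>0$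 and $\sup_{\varepsilon\in E}\sup_Q|v_\varepsilon|<\infty$, then $\underline v(t,x)=\liminf_{(s,y,\varepsilon)\to(t,x,0)}v_\varepsilon(s,y)$ is a supersolution of $(HJ^m)$. -/

import Mathlib

open Set Filter Topology MeasureTheory
open scoped ENNReal

noncomputable section

namespace ParticleHJ

/-! ### Space-time notation

Functions on `Q = (0,∞) × ℝ` are represented by functions on `ℝ × ℝ`, points being `(t, x)`.
Only their values on `Q` are ever used. -/

/-- The space-time domain `Q = (0,∞) × ℝ`. -/
def Q : Set (ℝ × ℝ) := Ioi 0 ×ˢ univ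

/-- The time derivative `φ_t(t,x)`. -/
def dt (φ : ℝ × ℝ → ℝ) (p : ℝ × ℝ) : ℝ := deriv (fun s => φ (s, p.2)) p.1

/-- The space derivative `φ_x(t,x)`. -/
def dx (φ : ℝ × ℝ → ℝ) (p : ℝ × ℝ) : ℝ := deriv (fun y => φ (p.1, y)) p.2

/-- The second space derivative `φ_xx(t,x)`. -/
def dxx (φ : ℝ × ℝ → ℝ) (p : ℝ × ℝ) : ℝ := iteratedDeriv 2 (fun y => φ (p.1, y)) p.2

/-- `u` is bounded on `Q`. -/
def BoundedOnQ (u : ℝ × ℝ → ℝ) : Prop := ∃ M : ℝ, ∀ p ∈ Q, |u p| ≤ M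

/-! ### The potentials

`V` is defined on `ℝ \ {0}`; its value at `0` is never relevant. -/

/-- The rescaled potential `V_α(x) = α V(α x)`. -/
def rescale (α : ℝ) (V : ℝ → ℝ) (x : ℝ) : ℝ := α * V (α * x)

/-- `V_α''`, the second derivative of the rescaled potential. -/
def rescaleD2 (α : ℝ) (V : ℝ → ℝ) : ℝ → ℝ := iteratedDeriv 2 (rescale α V)

/-- `sup_{y ∈ s} |V^{(ℓ)}(y)|`, with value in `[0,∞]`. -/
def supDeriv (V : ℝ → ℝ) (l : ℕ) (s : Set ℝ) : ℝ≥0∞ := ⨆ y ∈ s, ‖iteratedDeriv l V y‖ₑ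

/-- The basic assumptions on the external potential: `U ∈ C¹(ℝ)` with `U'` Lipschitz. -/
structure BasicU (U : ℝ → ℝ) : Prop where
  contDiff : ContDiff ℝ 1 U
  lipschitz : ∃ K, LipschitzWith K (deriv U)

/-- The basic assumptions on the interaction potential. The fields `diff` and `absCont` say that
`V ∈ W^{2,1}_loc(0,∞)`: `V` is differentiable with a locally absolutely continuous derivative. -/
structure BasicV (V : ℝ → ℝ) : Prop where
  even : ∀ x, x ≠ 0 → V (-x) = V x
  convex : ConvexOn ℝ (Ioi 0) V
  diff : DifferentiableOn ℝ V (Ioi 0)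
  absCont : ∀ a b : ℝ, 0 < a → a ≤ b → AbsolutelyContinuousOnInterval (deriv V) a b
  bounded : MemLp (iteratedDeriv 2 V) ⊤ (volume.restrict (Ioi 1))

/-- Assumptions on `V` for `m = 1`. -/
structure AssumptionOne (V : ℝ → ℝ) : Prop extends BasicV V where
  /-- `V'' ∈ L¹(1,∞)`: this is what makes the nonlocal Hamiltonians (integrals of bounded
  functions against `V_α''` away from the origin) well defined; for `m = 2, 3` it is part of
  `V ∈ W^{3,1}(1,∞)`. -/
  tail : IntegrableOn (iteratedDeriv 2 V) (Ioi 1)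
  contDiffOn : ContDiffOn ℝ 3 V (Ioi 0)
  sing : ∫⁻ x in Ioo (0 : ℝ) 1, ENNReal.ofReal (x ^ 3) * supDeriv V 3 (Ioo x 1) < ⊤

/-- Assumptions on `V` for `m = 2`. As `V` is of class `C³` on `(0,∞)`, the condition
`V ∈ W^{3,1}(1,∞)` is the integrability of its classical derivatives of order at most 3. -/
structure AssumptionTwo (V : ℝ → ℝ) : Prop extends BasicV V where
  contDiffOn : ContDiffOn ℝ 3 V (Ioi 0)
  sobolev : ∀ l : ℕ, l ≤ 3 → IntegrableOn (iteratedDeriv l V) (Ioi 1)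
  weight : ∫⁻ x in Ioi (0 : ℝ), ENNReal.ofReal (x ^ 3) * supDeriv V 3 (Ioi x) < ⊤
  sing : Tendsto (fun x => x ^ 4 * iteratedDeriv 3 V x) (𝓝[>] 0) (𝓝 0)

/-- Assumptions on `V` for `m = 3`. -/
structure AssumptionThree (V : ℝ → ℝ) : Prop extends BasicV V where
  contDiffOn : ContDiffOn ℝ 4 V (Ioi 0)
  sobolev : ∀ l : ℕ, l ≤ 3 → IntegrableOn (iteratedDeriv l V) (Ioi 1)
  sing : IntegrableOn (fun x => x ^ 2 * iteratedDeriv 2 V x) (Ioo 0 1)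
  weight : ∫⁻ x in Ioi (1 : ℝ), ENNReal.ofReal (x ^ 3) * supDeriv V 3 (Ioi x) < ⊤
  sup_three : ∃ C : ℝ, ∀ x > 1, x ^ 4 * |iteratedDeriv 3 V x| ≤ C
  sup_four : ∃ C : ℝ, ∀ x > 1, x ^ 5 * |iteratedDeriv 4 V x| ≤ C

/-! ### The staircase and its semicontinuous envelopes -/

/-- `E_ε[γ] = ε (⌊γ/ε⌋ + 1/2)`. -/
def stair (ε γ : ℝ) : ℝ := ε * ((⌊γ / ε⌋ : ℝ) + 1 / 2)

/-- The upper semicontinuous envelope `E_ε^*`. -/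
def stairUpper (ε γ : ℝ) : ℝ := limsup (stair ε) (𝓝 γ)

/-- The lower semicontinuous envelope `E_{ε,*}`. -/
def stairLower (ε γ : ℝ) : ℝ := liminf (stair ε) (𝓝 γ)

/-! ### Hamiltonians -/

/-- The principal value `pv ∫_{B_ρ} f(z) dz = lim_{r ↓ 0} ∫_{r < |z| < ρ} f(z) dz`. -/
def pvBall (ρ : ℝ) (f : ℝ → ℝ) : ℝ :=
  limUnder (𝓝[>] (0 : ℝ)) (fun r => ∫ z in {z : ℝ | r < |z| ∧ |z| < ρ}, f z)

/-- The nonlocal operator at level `ε`, with a given staircase `S`, and `a = α_ε`. It is used only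
where `ψ'(x) ≠ 0`; then the truncated integrals defining the principal value are eventually
constant, because `S[ψ(x+z) - ψ(x)]` is odd in `z` near `z = 0` (up to `z = 0` itself). -/
def opEps (S : ℝ → ℝ) (V : ℝ → ℝ) (a ρ : ℝ) (ψ v : ℝ → ℝ) (x : ℝ) : ℝ :=
  pvBall ρ (fun z => S (ψ (x + z) - ψ x) * rescaleD2 a V z)
    + ∫ z in {z : ℝ | ρ ≤ |z|}, S (v (x + z) - v x) * rescaleD2 a V z

/-- The upper Hamiltonian of `(HJ_ε)` (built with `E_ε^*`), used for subsolutions. -/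
def hamUpper (V U : ℝ → ℝ) (a ρ ε : ℝ) (u φ : ℝ × ℝ → ℝ) (p : ℝ × ℝ) : ℝ :=
  (opEps (stairUpper ε) V a ρ (fun y => φ (p.1, y)) (fun y => u (p.1, y)) p.2 + deriv U p.2)
    * |dx φ p|

/-- The lower Hamiltonian of `(HJ_ε)` (built with `E_{ε,*}`), used for supersolutions. -/
def hamLower (V U : ℝ → ℝ) (a ρ ε : ℝ) (u φ : ℝ × ℝ → ℝ) (p : ℝ × ℝ) : ℝ :=
  (opEps (stairLower ε) V a ρ (fun y => φ (p.1, y)) (fun y => u (p.1, y)) p.2 + deriv U p.2)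
    * |dx φ p|

/-- The limiting nonlocal operator `I_ρ[ψ,v](x)`. -/
def opOne (V : ℝ → ℝ) (α ρ : ℝ) (ψ v : ℝ → ℝ) (x : ℝ) : ℝ :=
  (∫ z in {z : ℝ | |z| < ρ}, (ψ (x + z) - ψ x - deriv ψ x * z) * rescaleD2 α V z)
    + ∫ z in {z : ℝ | ρ ≤ |z|}, (v (x + z) - v x) * rescaleD2 α V z

/-- The Hamiltonian of `(HJ¹)`. -/
def hamOne (V U : ℝ → ℝ) (α ρ : ℝ) (u φ : ℝ × ℝ → ℝ) (p : ℝ × ℝ) : ℝ :=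
  (opOne V α ρ (fun y => φ (p.1, y)) (fun y => u (p.1, y)) p.2 + deriv U p.2) * |dx φ p|

/-- The local Hamiltonian `f(φ_x) φ_xx + U' |φ_x|`. -/
def hamLocal (f U : ℝ → ℝ) (φ : ℝ × ℝ → ℝ) (p : ℝ × ℝ) : ℝ :=
  f (dx φ p) * dxx φ p + deriv U p.2 * |dx φ p|

/-- `f₂(y) = ‖V‖_{L¹(ℝ)} |y|`. -/
def f2 (V : ℝ → ℝ) (y : ℝ) : ℝ := (∫ x, |V x|) * |y|

/-- `Ψ(x) = ∑_{k ≥ 1} k² V''(k x)`. -/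
def Psi (V : ℝ → ℝ) (x : ℝ) : ℝ :=
  ∑' k : ℕ, ((k : ℝ) + 1) ^ 2 * iteratedDeriv 2 V (((k : ℝ) + 1) * x)

/-- `f₃(y) = β³ / y² · Ψ(β / y)` for `y ≠ 0` and `f₃(0) = 0`. -/
def f3 (V : ℝ → ℝ) (β y : ℝ) : ℝ := if y = 0 then 0 else β ^ 3 / y ^ 2 * Psi V (β / y)

/-! ### Viscosity sub- and supersolutions with the restricted class of test functions -/

/-- `φ(t,x) = θ |x - x₀|⁴ + g(t)` on `Q` for some `θ ∈ ℝ` and `g ∈ C²((0,∞))`. -/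
def IsQuarticAt (x₀ : ℝ) (φ : ℝ × ℝ → ℝ) : Prop :=
  ∃ (θ : ℝ) (g : ℝ → ℝ), ContDiffOn ℝ 2 g (Ioi 0) ∧
    ∀ q ∈ Q, φ q = θ * |q.2 - x₀| ^ 4 + g q.1

/-- `u` is a bounded usc viscosity subsolution in `Q` of the equation with Hamiltonian `H`, for test
functions in `C^k(Q)`: at a global maximum of `u - φ` one requires `φ_t ≤ H[φ]` if `φ_x ≠ 0`,
`φ_t ≤ 0` if `φ` has the quartic form centred there, and nothing otherwise. -/
structure IsViscSub (k : ℕ) (H : (ℝ × ℝ → ℝ) → ℝ × ℝ → ℝ) (u : ℝ × ℝ → ℝ) : Prop where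
  usc : UpperSemicontinuousOn u Q
  bdd : BoundedOnQ u
  noncritical : ∀ φ : ℝ × ℝ → ℝ, ContDiffOn ℝ k φ Q → ∀ p ∈ Q,
    IsMaxOn (fun q => u q - φ q) Q p → dx φ p ≠ 0 → dt φ p ≤ H φ p
  critical : ∀ φ : ℝ × ℝ → ℝ, ContDiffOn ℝ k φ Q → ∀ p ∈ Q,
    IsMaxOn (fun q => u q - φ q) Q p → IsQuarticAt p.2 φ → dt φ p ≤ 0

/-- `v` is a bounded lsc viscosity supersolution in `Q` of the equation with Hamiltonian `H`. -/
structure IsViscSuper (k : ℕ) (H : (ℝ × ℝ → ℝ) → ℝ × ℝ → ℝ) (v : ℝ × ℝ → ℝ) : Prop where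
  lsc : LowerSemicontinuousOn v Q
  bdd : BoundedOnQ v
  noncritical : ∀ ψ : ℝ × ℝ → ℝ, ContDiffOn ℝ k ψ Q → ∀ p ∈ Q,
    IsMinOn (fun q => v q - ψ q) Q p → dx ψ p ≠ 0 → H ψ p ≤ dt ψ p
  critical : ∀ ψ : ℝ × ℝ → ℝ, ContDiffOn ℝ k ψ Q → ∀ p ∈ Q,
    IsMinOn (fun q => v q - ψ q) Q p → IsQuarticAt p.2 ψ → 0 ≤ dt ψ p

/-- `u` is a `ρ`-subsolution of `(HJ_ε)`, with `a = α_ε`. -/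
def IsSubEps (V U : ℝ → ℝ) (a ρ ε : ℝ) (u : ℝ × ℝ → ℝ) : Prop :=
  IsViscSub 2 (hamUpper V U a ρ ε u) u

/-- `v` is a `ρ`-supersolution of `(HJ_ε)`, with `a = α_ε`. -/
def IsSuperEps (V U : ℝ → ℝ) (a ρ ε : ℝ) (v : ℝ × ℝ → ℝ) : Prop :=
  IsViscSuper 2 (hamLower V U a ρ ε v) v

/-! ### The three regimes -/

/-- The label `m ∈ {1, 2, 3}`. -/
inductive Regime where
  | one
  | two
  | three

/-- The behaviour of `α_ε` as `ε → 0` with `ε ∈ E`: `α_ε → α` if `m = 1`, `1 ≪ α_ε ≪ 1/ε` if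
`m = 2`, and `ε α_ε → β` if `m = 3`. -/
def Scaling (m : Regime) (E : Set ℝ) (a : ℝ → ℝ) (α β : ℝ) : Prop :=
  match m with
  | .one => Tendsto a (𝓝[E] 0) (𝓝 α)
  | .two => Tendsto a (𝓝[E] 0) atTop ∧ Tendsto (fun ε => ε * a ε) (𝓝[E] 0) (𝓝 0)
  | .three => Tendsto (fun ε => ε * a ε) (𝓝[E] 0) (𝓝 β)

/-- The assumption on `V` in the regime `m`. -/
def AssumptionV (m : Regime) (V : ℝ → ℝ) : Prop :=
  match m with
  | .one => AssumptionOne V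
  | .two => AssumptionTwo V
  | .three => AssumptionThree V

/-- `u` is a subsolution of `(HJ^m)`. For `m = 1` it is required to be a `ρ`-subsolution for every
`ρ > 0`. -/
def IsSub (m : Regime) (V U : ℝ → ℝ) (α β : ℝ) (u : ℝ × ℝ → ℝ) : Prop :=
  match m with
  | .one => ∀ ρ > 0, IsViscSub 2 (hamOne V U α ρ u) u
  | .two => IsViscSub 2 (hamLocal (f2 V) U) u
  | .three => IsViscSub 3 (hamLocal (f3 V β) U) u

/-- `v` is a supersolution of `(HJ^m)`. -/
def IsSuper (m : Regime) (V U : ℝ → ℝ) (α β : ℝ) (v : ℝ × ℝ → ℝ) : Prop :=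
  match m with
  | .one => ∀ ρ > 0, IsViscSuper 2 (hamOne V U α ρ v) v
  | .two => IsViscSuper 2 (hamLocal (f2 V) U) v
  | .three => IsViscSuper 3 (hamLocal (f3 V β) U) v

/-! ### Half-relaxed limits -/

/-- `limsup^* u_ε (t,x) = limsup_{(s,y,ε) → (t,x,0)} u_ε(s,y)`, over `(s,y) ∈ Q` and `ε ∈ E`. -/
def limsupStar (E : Set ℝ) (u : ℝ → ℝ × ℝ → ℝ) (p : ℝ × ℝ) : ℝ :=
  limsup (fun q : (ℝ × ℝ) × ℝ => u q.2 q.1) (𝓝[Q] p ×ˢ 𝓝[E] 0)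

/-- `liminf_* v_ε (t,x) = liminf_{(s,y,ε) → (t,x,0)} v_ε(s,y)`, over `(s,y) ∈ Q` and `ε ∈ E`. -/
def liminfStar (E : Set ℝ) (v : ℝ → ℝ × ℝ → ℝ) (p : ℝ × ℝ) : ℝ :=
  liminf (fun q : (ℝ × ℝ) × ℝ => v q.2 q.1) (𝓝[Q] p ×ˢ 𝓝[E] 0)

end ParticleHJ

end

namespace ParticleHJ

/-! ### Interaction kernels -/

/-! The frame is the half-relaxed limit method. If `Φ` touches `limsupStar E u` strictly from above
at `p` and exceeds the common bound of the `u ε` outside a compact set, then maximum points `P n` of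
`u (e n) - Φ` converge to `p` (`exists_seq_isMaxOn`). It remains to pass to the limit in the
inequality at `P n`, that is, in the nonlocal term.

At a maximum point the increments of `u ε` lie below those of `Φ`. Since the staircase is monotone
and `V'' ≥ 0`, `Φ` may replace `u ε` everywhere, and the radius `ρ` drops out (`opEps_le`). At a
noncritical point the increment of `Φ` is, after a reflection, an increasing profile near the
origin. Pairing `z` with `-z` turns the staircase integral over `|z| < δ` into a sum over the levels
`y = (k+1)ε` of `ε ∫ V_a''` between the distances `c` and `d` at which the profile reaches `y` on
one side and `-y` on the other (`Tame.setIntegral_stair`): the force of a pair of particles. Only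
the even part of the profile separates the two distances, with `d - c ≈ Φ_xx y² / |Φ_x|³`. If `W` is
an antitone majorant of `V''` with `∫ x² W < ∞`, the sum is bounded independently of `ε`, `a` and
the number of levels (`Tame.abs_sum_le`).

The three limits follow. For `m = 3` the scaled levels stay discrete and dominated convergence of
series produces `f3`. For `m = 2` the sum is a Riemann sum for `Φ_xx ∫_0^∞ x² V''`, and this
integral is `‖V‖_{L¹}` (`AssumptionTwo.integral_sq_mul`). In both cases the far field vanishes,
being controlled by the tail of `∫ x² V''`. For `m = 1` the near part is controlled by `∫_0^{2αδ} x²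
W` and the far part converges; first `ε → 0`, then `δ → 0`. There the limit Hamiltonian contains
`limsupStar E u` itself outside `B_ρ`, so `Φ` is also made to decrease to it there by means of
regularised sup-convolutions (`exists_outer`).

At a critical point the test function is a quartic, made strict and coercive. If `P n` has the same
abscissa as `p`, the critical condition for `u (e n)` applies directly. Otherwise, with `Y` the
distance of the abscissas, the near field is estimated at scale `Y/2`, where the slopes are
comparable to `Y³` with constants independent of `Y`; after multiplication by `|Φ_x| = 4θY³`
everything tends to zero (`SubFamily.critical`).

Supersolutions reduce to subsolutions through `v ↦ -v`, `U ↦ -U`. -/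

/-- The properties of `V''` and of its rescalings that are common to all regimes. -/
structure RepKernel (w : ℝ → ℝ) : Prop where
  even : ∀ x, w (-x) = w x
  nonneg : ∀ x, x ≠ 0 → 0 ≤ w x
  cont : ContinuousOn w (Ioi 0)
  integrable : IntegrableOn (fun z => min (z ^ 2) 1 * w z) (Ioi 0)

/-- The rules for constant factors and for dilations hold for `deriv` without any differentiability,
so no regularity of `V` is needed. -/
lemma rescaleD2_eq (a : ℝ) (V : ℝ → ℝ) (z : ℝ) :
    rescaleD2 a V z = a ^ 3 * iteratedDeriv 2 V (a * z) := by
  have h1 : deriv (rescale a V) = fun z => a * (a * deriv V (a * z)) := by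
    ext z
    unfold rescale
    rw [deriv_const_mul_field, deriv_comp_mul_left, smul_eq_mul]
  have h2 : ∀ f : ℝ → ℝ, iteratedDeriv 2 f = deriv (deriv f) := by
    intro f
    rw [iteratedDeriv_succ, iteratedDeriv_one]
  unfold rescaleD2
  rw [h2, h2, h1, deriv_const_mul_field, deriv_const_mul_field, deriv_comp_mul_left, smul_eq_mul]
  ring

/-- On the open half-line `iteratedDeriv` agrees with `iteratedDerivWithin`, for which the calculus
of `ContDiffOn` is available. -/
lemma hasDerivAt_iteratedDeriv_of_contDiffOn {V : ℝ → ℝ} {n : ℕ} {N : WithTop ℕ∞}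
    (hN : ((n + 1 : ℕ) : WithTop ℕ∞) ≤ N)
    (hV : ContDiffOn ℝ N V (Ioi 0)) {x : ℝ} (hx : 0 < x) :
    HasDerivAt (iteratedDeriv n V) (iteratedDeriv (n + 1) V x) x := by
  rw [iteratedDeriv_succ]
  refine DifferentiableAt.hasDerivAt ?_
  have h1 := (hV.of_le hN).differentiableOn_iteratedDerivWithin (m := n)
    (by exact_mod_cast Nat.lt_succ_self n) isOpen_Ioi.uniqueDiffOn
  refine ((h1 x hx).differentiableAt (Ioi_mem_nhds hx)).congr_of_eventuallyEq ?_
  filter_upwards [Ioi_mem_nhds hx] with y hy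
  exact (iteratedDerivWithin_of_isOpen isOpen_Ioi hy).symm

lemma continuousOn_iteratedDeriv_of_contDiffOn {V : ℝ → ℝ} {n : ℕ} {N : WithTop ℕ∞}
    (hN : (n : WithTop ℕ∞) ≤ N)
    (hV : ContDiffOn ℝ N V (Ioi 0)) : ContinuousOn (iteratedDeriv n V) (Ioi 0) := by
  have h := hV.continuousOn_iteratedDerivWithin (m := n) hN isOpen_Ioi.uniqueDiffOn
  refine h.congr fun x hx => ?_
  exact (iteratedDerivWithin_of_isOpen isOpen_Ioi hx).symm

section Potential

variable {V : ℝ → ℝ}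

lemma BasicV.iteratedDeriv_two_even (hV : BasicV V) (x : ℝ) :
    iteratedDeriv 2 V (-x) = iteratedDeriv 2 V x := by
  rcases eq_or_ne x 0 with rfl | hx
  · simp
  have h := iteratedDeriv_comp_neg 2 V x
  have h2 : iteratedDeriv 2 (fun x => V (-x)) x = iteratedDeriv 2 V x := by
    apply Filter.EventuallyEq.iteratedDeriv_eq
    filter_upwards [isOpen_ne.mem_nhds hx] with y hy using hV.even y hy
  rw [h2] at h
  simpa using h.symm

lemma BasicV.iteratedDeriv_two_nonneg_of_pos (hV : BasicV V) {x : ℝ} (hx : 0 < x) :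
    0 ≤ iteratedDeriv 2 V x := by
  have hmono : MonotoneOn (deriv V) (Ioi 0) :=
    hV.convex.monotoneOn_deriv fun y hy => (hV.diff y hy).differentiableAt (Ioi_mem_nhds hy)
  rw [iteratedDeriv_succ, iteratedDeriv_one]
  have h2 := hmono.derivWithin_nonneg (x := x)
  rwa [derivWithin_of_mem_nhds (Ioi_mem_nhds hx)] at h2

lemma BasicV.iteratedDeriv_two_nonneg (hV : BasicV V) {x : ℝ} (hx : x ≠ 0) :
    0 ≤ iteratedDeriv 2 V x := by
  rcases lt_or_gt_of_ne hx with h | h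
  · rw [← hV.iteratedDeriv_two_even]
    exact hV.iteratedDeriv_two_nonneg_of_pos (neg_pos.2 h)
  · exact hV.iteratedDeriv_two_nonneg_of_pos h

end Potential

/-! ### Antitone majorants of `V''` with finite second moment -/

/-- An antitone majorant `W` of `v` on `s`, with finite second moment. -/
structure Majorant (v W : ℝ → ℝ) (s : Set ℝ) : Prop where
  anti : AntitoneOn W (Ioi 0)
  nonneg : ∀ x, 0 < x → 0 ≤ W x
  integrable : IntegrableOn (fun x => x ^ 2 * W x) (Ioi 0)
  le : ∀ x ∈ s, v x ≤ W x

lemma Majorant.mono {v W : ℝ → ℝ} {s t : Set ℝ} (h : Majorant v W s) (hst : t ⊆ s) :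
    Majorant v W t := ⟨h.anti, h.nonneg, h.integrable, fun x hx => h.le x (hst hx)⟩

/-- Tonelli: the left side is `∫ G(s) ∫_0^s x² dx ds`, and bounding `x²` by `s²` in the inner
integral is enough. -/
lemma lintegral_sq_mul_tail_le {G : ℝ → ℝ≥0∞} (hG : Measurable G) :
    ∫⁻ x in Ioi (0 : ℝ), ENNReal.ofReal (x ^ 2) * ∫⁻ s in Ioi x, G s
      ≤ ∫⁻ s in Ioi (0 : ℝ), ENNReal.ofReal (s ^ 3) * G s := by
  have hmeas : Measurable (Function.uncurry fun x s : ℝ =>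
      (ENNReal.ofReal (x ^ 2) * (Ioi x).indicator G s)) := by
    apply Measurable.mul
    · fun_prop
    · have : (Function.uncurry fun x s : ℝ => (Ioi x).indicator G s)
          = {p : ℝ × ℝ | p.1 < p.2}.indicator (fun p => G p.2) := by
        ext ⟨x, s⟩
        simp [indicator, Function.uncurry]
      change Measurable (Function.uncurry fun x s : ℝ => (Ioi x).indicator G s)
      rw [this]
      exact (hG.comp measurable_snd).indicator (measurableSet_lt measurable_fst measurable_snd)
  calc ∫⁻ x in Ioi (0 : ℝ), ENNReal.ofReal (x ^ 2) * ∫⁻ s in Ioi x, G s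
      = ∫⁻ x in Ioi (0 : ℝ), ∫⁻ s in Ioi (0 : ℝ),
          ENNReal.ofReal (x ^ 2) * (Ioi x).indicator G s := by
        refine setLIntegral_congr_fun measurableSet_Ioi fun x hx => ?_
        rw [lintegral_const_mul _ (hG.indicator measurableSet_Ioi),
          lintegral_indicator measurableSet_Ioi, Measure.restrict_restrict measurableSet_Ioi,
          inter_eq_left.2 (Ioi_subset_Ioi (le_of_lt hx))]
    _ = ∫⁻ s in Ioi (0 : ℝ), ∫⁻ x in Ioi (0 : ℝ),
          ENNReal.ofReal (x ^ 2) * (Ioi x).indicator G s :=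
        lintegral_lintegral_swap hmeas.aemeasurable
    _ ≤ ∫⁻ s in Ioi (0 : ℝ), ENNReal.ofReal (s ^ 3) * G s := by
        refine setLIntegral_mono' measurableSet_Ioi fun s hs => ?_
        have hs0 : (0 : ℝ) < s := hs
        calc ∫⁻ x in Ioi (0 : ℝ), ENNReal.ofReal (x ^ 2) * (Ioi x).indicator G s
            ≤ ∫⁻ x in Ioi (0 : ℝ), (Ioo 0 s).indicator (fun _ => ENNReal.ofReal (s ^ 2) * G s) x := by
              refine setLIntegral_mono' measurableSet_Ioi fun x hx => ?_
              by_cases hxs : x < s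
              · rw [indicator_of_mem (show s ∈ Ioi x from hxs),
                  indicator_of_mem (show x ∈ Ioo 0 s from ⟨hx, hxs⟩)]
                gcongr
                exact le_of_lt hx
              · rw [indicator_of_notMem (show s ∉ Ioi x from hxs)]
                simp
          _ ≤ ∫⁻ x, (Ioo 0 s).indicator (fun _ => ENNReal.ofReal (s ^ 2) * G s) x :=
              setLIntegral_le_lintegral _ _
          _ = ENNReal.ofReal (s ^ 3) * G s := by
              rw [lintegral_indicator measurableSet_Ioo, lintegral_const,
                Measure.restrict_apply_univ, Real.volume_Ioo, sub_zero, mul_right_comm,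
                ← ENNReal.ofReal_mul (by positivity)]
              congr 2

/-- A Chebyshev argument: the weight `s³` is at least `x³` on `(x,∞)`. -/
lemma lintegral_tail_lt_top {G : ℝ → ℝ≥0∞} 
    (hint : ∫⁻ s in Ioi (0 : ℝ), ENNReal.ofReal (s ^ 3) * G s < ⊤) {x : ℝ} (hx : 0 < x) :
    ∫⁻ s in Ioi x, G s < ⊤ := by
  have h : ENNReal.ofReal (x ^ 3) * ∫⁻ s in Ioi x, G s < ⊤ := by
    refine lt_of_le_of_lt ?_ hint
    rw [← lintegral_const_mul' _ _ ENNReal.ofReal_ne_top]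
    calc ∫⁻ s in Ioi x, ENNReal.ofReal (x ^ 3) * G s
        ≤ ∫⁻ s in Ioi x, ENNReal.ofReal (s ^ 3) * G s := by
          refine setLIntegral_mono' measurableSet_Ioi fun s hs => ?_
          gcongr
          exact le_of_lt hs
      _ ≤ _ := lintegral_mono_set (Ioi_subset_Ioi hx.le)
  by_contra hcon
  rw [not_lt, top_le_iff] at hcon
  rw [hcon, ENNReal.mul_top (by simpa using pow_pos hx 3)] at h
  exact lt_irrefl _ h

/-- The tail `x ↦ ∫_x^∞ G` is an antitone function with finite second moment. -/
lemma tail_majorant {G : ℝ → ℝ≥0∞} (hG : Measurable G)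
    (hint : ∫⁻ s in Ioi (0 : ℝ), ENNReal.ofReal (s ^ 3) * G s < ⊤) :
    Majorant (fun _ => 0) (fun x => (∫⁻ s in Ioi x, G s).toReal) univ := by
  have hanti : AntitoneOn (fun x => (∫⁻ s in Ioi x, G s).toReal) (Ioi 0) := by
    intro x hx y _ hxy
    exact ENNReal.toReal_mono (lintegral_tail_lt_top hint hx).ne
      (lintegral_mono_set (Ioi_subset_Ioi hxy))
  -- Only the tail itself matters here; the majorised function is zero, and the actual one is put in
  -- by the lemmas that follow.
  refine ⟨hanti, fun _ _ => ENNReal.toReal_nonneg, ?_, fun _ _ => ENNReal.toReal_nonneg⟩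
  refine ⟨(Measurable.aestronglyMeasurable (by fun_prop)).mul
    (aemeasurable_restrict_of_antitoneOn measurableSet_Ioi hanti).aestronglyMeasurable, ?_⟩
  refine lt_of_le_of_lt ?_ (lt_of_le_of_lt (lintegral_sq_mul_tail_le hG) hint)
  refine setLIntegral_mono' measurableSet_Ioi fun x hx => ?_
  rw [Real.enorm_of_nonneg (by positivity), ENNReal.ofReal_mul (by positivity),
    ENNReal.ofReal_toReal (lintegral_tail_lt_top hint hx).ne]

/-- A tail integral of `|V'''|` over a bounded range controls `V''` only up to a boundary value. The
constant absorbs it; being cut off to the right of `B`, it preserves both monotonicity and the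
second moment. -/
lemma Majorant.add_const {v W : ℝ → ℝ} {s t : Set ℝ} (h : Majorant (fun _ => 0) W s) {C B : ℝ}
    (hC : 0 ≤ C) (hle : ∀ x ∈ t, v x ≤ W x + (Iic B).indicator (fun _ => C) x) :
    Majorant v (fun x => W x + (Iic B).indicator (fun _ => C) x) t := by
  refine ⟨?_, ?_, ?_, hle⟩
  · intro x hx y hy hxy
    refine add_le_add (h.anti hx hy hxy) ?_
    by_cases hyB : y ≤ B
    · rw [indicator_of_mem (show y ∈ Iic B from hyB),
        indicator_of_mem (show x ∈ Iic B from hxy.trans hyB)]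
    · rw [indicator_of_notMem (show y ∉ Iic B from hyB)]
      exact indicator_nonneg (fun _ _ => hC) x
  · intro x hx
    exact add_nonneg (h.nonneg x hx) (indicator_nonneg (fun _ _ => hC) x)
  · have h1 : IntegrableOn (fun x : ℝ => x ^ 2 * (Iic B).indicator (fun _ => C) x) (Ioi 0) := by
      have h2 : (fun x : ℝ => x ^ 2 * (Iic B).indicator (fun _ => C) x)
          = (Iic B).indicator (fun x => x ^ 2 * C) := by
        ext x
        by_cases hx : x ≤ B <;> simp [indicator, hx]
      rw [h2, integrableOn_indicator_iff measurableSet_Iic, inter_comm, Ioi_inter_Iic]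
      exact (Continuous.integrableOn_Ioc (by fun_prop))
    refine (h.integrable.add h1).congr (ae_of_all _ fun x => ?_)
    simp [mul_add]

lemma supDeriv_anti {V : ℝ → ℝ} {l : ℕ} {s t : Set ℝ} (h : s ⊆ t) :
    supDeriv V l s ≤ supDeriv V l t := biSup_mono fun _ hi => h hi

/-- The suprema in the hypotheses run over points strictly to the right of `x`; continuity recovers
the value at `x`. -/
lemma enorm_le_supDeriv {V : ℝ → ℝ} {l : ℕ} {s : Set ℝ} {x : ℝ} (hx : 0 < x)
    (hs : s ∈ 𝓝[>] x) (hc : ContinuousOn (iteratedDeriv l V) (Ioi 0)) :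
    ‖iteratedDeriv l V x‖ₑ ≤ supDeriv V l s := by
  have hc' : Tendsto (iteratedDeriv l V) (𝓝[>] x) (𝓝 (iteratedDeriv l V x)) :=
    (hc.continuousAt (Ioi_mem_nhds hx)).tendsto.mono_left nhdsWithin_le_nhds
  refine le_of_tendsto hc'.enorm ?_
  filter_upwards [hs] with y hy
  exact le_iSup₂ (f := fun y (_ : y ∈ s) => ‖iteratedDeriv l V y‖ₑ) y hy

lemma iteratedDeriv_two_sub_le {V : ℝ → ℝ} (hV : ContDiffOn ℝ 3 V (Ioi 0)) {x y : ℝ} (hx : 0 < x)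
    (hxy : x ≤ y) :
    ENNReal.ofReal (iteratedDeriv 2 V x - iteratedDeriv 2 V y)
      ≤ ∫⁻ s in Ioc x y, ‖iteratedDeriv 3 V s‖ₑ := by
  have hc : ContinuousOn (iteratedDeriv 3 V) (Ioi 0) :=
    continuousOn_iteratedDeriv_of_contDiffOn (by norm_num) hV
  have hsub : uIcc x y ⊆ Ioi 0 := by
    rw [uIcc_of_le hxy]
    exact fun z hz => lt_of_lt_of_le hx hz.1
  have hFTC : ∫ s in x..y, iteratedDeriv 3 V s = iteratedDeriv 2 V y - iteratedDeriv 2 V x :=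
    intervalIntegral.integral_eq_sub_of_hasDerivAt
      (fun z hz => hasDerivAt_iteratedDeriv_of_contDiffOn (n := 2) (by norm_num) hV (hsub hz))
      (hc.mono hsub).intervalIntegrable
  rw [intervalIntegral.integral_of_le hxy] at hFTC
  calc ENNReal.ofReal (iteratedDeriv 2 V x - iteratedDeriv 2 V y)
      ≤ ‖∫ s in Ioc x y, iteratedDeriv 3 V s‖ₑ := by
        rw [hFTC, ← ofReal_norm, Real.norm_eq_abs]
        exact ENNReal.ofReal_le_ofReal (by rw [abs_sub_comm]; exact le_abs_self _)
    _ ≤ _ := enorm_integral_le_lintegral_enorm _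

lemma integrableOn_of_le_majorant {v W : ℝ → ℝ} {s : Set ℝ} (hs : MeasurableSet s)
    (hs0 : s ⊆ Ioi 0) (hW : Majorant v W s) (hc : ContinuousOn v (Ioi 0))
    (hv : ∀ x ∈ s, 0 ≤ v x) : IntegrableOn (fun x => x ^ 2 * v x) s := by
  refine Integrable.mono' (hW.integrable.mono_set hs0) ?_ ?_
  · exact (ContinuousOn.aestronglyMeasurable (by fun_prop) hs)|>.mul
      ((hc.mono hs0).aestronglyMeasurable hs)
  · refine (ae_restrict_iff' hs).2 (ae_of_all _ fun x hx => ?_)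
    rw [Real.norm_of_nonneg (mul_nonneg (sq_nonneg x) (hv x hx))]
    exact mul_le_mul_of_nonneg_left (hW.le x hx) (sq_nonneg x)

lemma integrableOn_min_of_sq {v : ℝ → ℝ} (hc : ContinuousOn v (Ioi 0)) (hv : ∀ x, x ≠ 0 → 0 ≤ v x)
    (h : IntegrableOn (fun x => x ^ 2 * v x) (Ioi 0)) :
    IntegrableOn (fun z => min (z ^ 2) 1 * v z) (Ioi 0) := by
  refine Integrable.mono' h ?_ ?_
  · exact (ContinuousOn.aestronglyMeasurable (by fun_prop) measurableSet_Ioi)|>.mul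
      (hc.aestronglyMeasurable measurableSet_Ioi)
  · refine (ae_restrict_iff' measurableSet_Ioi).2 (ae_of_all _ fun x hx => ?_)
    have hx0 : (0 : ℝ) < x := hx
    rw [Real.norm_of_nonneg (mul_nonneg (le_min (sq_nonneg x) zero_le_one) (hv x hx0.ne'))]
    exact mul_le_mul_of_nonneg_right (min_le_left _ _) (hv x hx0.ne')

section One

variable {V : ℝ → ℝ}

lemma AssumptionOne.cont (hV : AssumptionOne V) : ContinuousOn (iteratedDeriv 2 V) (Ioi 0) :=
  continuousOn_iteratedDeriv_of_contDiffOn (by norm_num) hV.contDiffOn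

/-- For `x < 1`, `V''(x) - V''(1) ≤ ∫_x^1 sup_{(s,1)} |V'''| ds`, a tail whose second moment is
finite by the weight `x³`. On `[1,B]` a constant suffices. -/
lemma AssumptionOne.exists_majorant (hV : AssumptionOne V) (B : ℝ) :
    ∃ W, Majorant (iteratedDeriv 2 V) W (Ioc 0 B) := by
  have hc3 : ContinuousOn (iteratedDeriv 3 V) (Ioi 0) :=
    continuousOn_iteratedDeriv_of_contDiffOn (by norm_num) hV.contDiffOn
  have hanti : Antitone fun x : ℝ => supDeriv V 3 (Ioo x 1) :=
    fun x y hxy => supDeriv_anti (Ioo_subset_Ioo_left hxy)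
  set G : ℝ → ℝ≥0∞ := (Ioo 0 1).indicator fun x => supDeriv V 3 (Ioo x 1) with hG
  have hGm : Measurable G := hanti.measurable.indicator measurableSet_Ioo
  have hint : ∫⁻ s in Ioi (0 : ℝ), ENNReal.ofReal (s ^ 3) * G s < ⊤ := by
    refine lt_of_le_of_lt ?_ hV.sing
    have : (fun s : ℝ => ENNReal.ofReal (s ^ 3) * G s)
        = (Ioo 0 1).indicator fun x => ENNReal.ofReal (x ^ 3) * supDeriv V 3 (Ioo x 1) := by
      ext x
      by_cases hx : x ∈ Ioo (0 : ℝ) 1 <;> simp [hG, hx]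
    rw [this]
    refine (setLIntegral_le_lintegral _ _).trans ?_
    rw [lintegral_indicator measurableSet_Ioo]
  -- The endpoint is `max B 1` so that `C` bounds `V''(1)` even when `B < 1`.
  obtain ⟨C, hC⟩ := (isCompact_Icc (a := (1 : ℝ)) (b := max B 1)).bddAbove_image
    (hV.cont.mono fun x hx => lt_of_lt_of_le one_pos hx.1)
  have hCle : ∀ x ∈ Icc 1 (max B 1), iteratedDeriv 2 V x ≤ C :=
    fun x hx => hC (mem_image_of_mem _ hx)
  have h1C : iteratedDeriv 2 V 1 ≤ C := hCle 1 ⟨le_rfl, le_max_right _ _⟩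
  have hC0 : 0 ≤ C := (hV.iteratedDeriv_two_nonneg one_ne_zero).trans h1C
  refine ⟨_, (tail_majorant hGm hint).add_const hC0 (B := B) fun x hx => ?_⟩
  rw [indicator_of_mem (show x ∈ Iic B from hx.2)]
  have hx0 : 0 < x := hx.1
  rcases le_or_gt 1 x with h | h
  · exact (hCle x ⟨h, hx.2.trans (le_max_left _ _)⟩).trans
      (le_add_of_nonneg_left ENNReal.toReal_nonneg)
  · have h2 : ENNReal.ofReal (iteratedDeriv 2 V x - iteratedDeriv 2 V 1) ≤ ∫⁻ s in Ioi x, G s := by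
      refine (iteratedDeriv_two_sub_le hV.contDiffOn hx0 h.le).trans ?_
      rw [← setLIntegral_congr Ioo_ae_eq_Ioc]
      calc ∫⁻ s in Ioo x 1, ‖iteratedDeriv 3 V s‖ₑ ≤ ∫⁻ s in Ioo x 1, G s := by
            refine setLIntegral_mono' measurableSet_Ioo fun s hs => ?_
            rw [hG, indicator_of_mem (show s ∈ Ioo (0 : ℝ) 1 from ⟨hx0.trans hs.1, hs.2⟩)]
            exact enorm_le_supDeriv (hx0.trans hs.1) (Ioo_mem_nhdsGT hs.2) hc3
        _ ≤ _ := lintegral_mono_set Ioo_subset_Ioi_self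
    have h3 := (ENNReal.ofReal_le_iff_le_toReal (lintegral_tail_lt_top hint hx0).ne).1 h2
    linarith

lemma AssumptionOne.repKernel (hV : AssumptionOne V) : RepKernel (iteratedDeriv 2 V) := by
  refine ⟨hV.iteratedDeriv_two_even, fun x hx => hV.iteratedDeriv_two_nonneg hx, hV.cont, ?_⟩
  rw [← Ioc_union_Ioi_eq_Ioi zero_le_one]
  refine IntegrableOn.union ?_ ?_
  · obtain ⟨W, hW⟩ := hV.exists_majorant 1
    refine (integrableOn_of_le_majorant measurableSet_Ioc Ioc_subset_Ioi_self hW hV.cont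
      fun x hx => hV.iteratedDeriv_two_nonneg hx.1.ne').congr_fun (fun x hx => ?_) measurableSet_Ioc
    rw [min_eq_left]
    exact pow_le_one₀ hx.1.le hx.2
  · refine hV.tail.congr_fun (fun x hx => ?_) measurableSet_Ioi
    rw [min_eq_right, one_mul]
    exact one_le_pow₀ (le_of_lt hx)

end One

/-- Since `V''` and `V'''` are integrable at infinity, `V''` tends to zero there; let `y → ∞` in the
estimate on `(x,y]`. -/
lemma ofReal_iteratedDeriv_two_le {V : ℝ → ℝ} (hV : ContDiffOn ℝ 3 V (Ioi 0))
    (h2 : IntegrableOn (iteratedDeriv 2 V) (Ioi 1)) (h3 : IntegrableOn (iteratedDeriv 3 V) (Ioi 1))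
    {x : ℝ} (hx : 0 < x) :
    ENNReal.ofReal (iteratedDeriv 2 V x) ≤ ∫⁻ s in Ioi x, ‖iteratedDeriv 3 V s‖ₑ := by
  have hlim : Tendsto (iteratedDeriv 2 V) atTop (𝓝 0) :=
    tendsto_zero_of_hasDerivAt_of_integrableOn_Ioi (a := 1)
      (fun y hy => hasDerivAt_iteratedDeriv_of_contDiffOn (n := 2) (by norm_num) hV
        (lt_trans one_pos hy)) h3 h2
  have hlim2 : Tendsto (fun y => ENNReal.ofReal (iteratedDeriv 2 V x - iteratedDeriv 2 V y)) atTop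
      (𝓝 (ENNReal.ofReal (iteratedDeriv 2 V x - 0))) :=
    ENNReal.tendsto_ofReal (tendsto_const_nhds.sub hlim)
  rw [sub_zero] at hlim2
  refine le_of_tendsto hlim2 ?_
  filter_upwards [eventually_ge_atTop x] with y hy
  exact (iteratedDeriv_two_sub_le hV hx hy).trans (lintegral_mono_set Ioc_subset_Ioi_self)

section Two

variable {V : ℝ → ℝ}

lemma AssumptionTwo.cont (hV : AssumptionTwo V) : ContinuousOn (iteratedDeriv 2 V) (Ioi 0) :=
  continuousOn_iteratedDeriv_of_contDiffOn (by norm_num) hV.contDiffOn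

lemma AssumptionTwo.exists_majorant (hV : AssumptionTwo V) :
    ∃ W, Majorant (iteratedDeriv 2 V) W (Ioi 0) := by
  have hc3 : ContinuousOn (iteratedDeriv 3 V) (Ioi 0) :=
    continuousOn_iteratedDeriv_of_contDiffOn (by norm_num) hV.contDiffOn
  have hanti : Antitone fun x : ℝ => supDeriv V 3 (Ioi x) :=
    fun x y hxy => supDeriv_anti (Ioi_subset_Ioi hxy)
  have h := tail_majorant hanti.measurable hV.weight
  refine ⟨_, h.anti, h.nonneg, h.integrable, fun x hx => ?_⟩
  have hx0 : 0 < x := hx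
  refine (ENNReal.ofReal_le_iff_le_toReal (lintegral_tail_lt_top hV.weight hx0).ne).1 ?_
  refine (ofReal_iteratedDeriv_two_le hV.contDiffOn (hV.sobolev 2 (by norm_num))
    (hV.sobolev 3 le_rfl) hx0).trans ?_
  exact setLIntegral_mono' measurableSet_Ioi fun s hs =>
    enorm_le_supDeriv (hx0.trans hs) self_mem_nhdsWithin hc3

lemma AssumptionTwo.integrable_sq (hV : AssumptionTwo V) :
    IntegrableOn (fun x => x ^ 2 * iteratedDeriv 2 V x) (Ioi 0) := by
  obtain ⟨W, hW⟩ := hV.exists_majorant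
  exact integrableOn_of_le_majorant measurableSet_Ioi subset_rfl hW hV.cont
    fun x hx => hV.iteratedDeriv_two_nonneg (ne_of_gt hx)

lemma AssumptionTwo.repKernel (hV : AssumptionTwo V) : RepKernel (iteratedDeriv 2 V) :=
  ⟨hV.iteratedDeriv_two_even, fun _ hx => hV.iteratedDeriv_two_nonneg hx, hV.cont,
    integrableOn_min_of_sq hV.cont (fun _ hx => hV.iteratedDeriv_two_nonneg hx) hV.integrable_sq⟩

end Two

section Three

variable {V : ℝ → ℝ}

lemma AssumptionThree.cont (hV : AssumptionThree V) : ContinuousOn (iteratedDeriv 2 V) (Ioi 0) :=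
  continuousOn_iteratedDeriv_of_contDiffOn (by norm_num) hV.contDiffOn

/-- Beyond 1 the tail of the supremum majorises `V''`, and a constant takes care of the compact
range above `c`. No majorant down to the origin is needed when `m = 3`: scaled distances between
particles stay bounded below. -/
lemma AssumptionThree.exists_majorant (hV : AssumptionThree V) {c : ℝ} (hc : 0 < c) :
    ∃ W, Majorant (iteratedDeriv 2 V) W (Ici c) := by
  have hV3 : ContDiffOn ℝ 3 V (Ioi 0) := hV.contDiffOn.of_le (by norm_num)
  have hc3 : ContinuousOn (iteratedDeriv 3 V) (Ioi 0) :=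
    continuousOn_iteratedDeriv_of_contDiffOn (by norm_num) hV.contDiffOn
  have hanti : Antitone fun x : ℝ => supDeriv V 3 (Ioi x) :=
    fun x y hxy => supDeriv_anti (Ioi_subset_Ioi hxy)
  set G : ℝ → ℝ≥0∞ := (Ioi 1).indicator fun x => supDeriv V 3 (Ioi x) with hG
  have hGm : Measurable G := hanti.measurable.indicator measurableSet_Ioi
  have hint : ∫⁻ s in Ioi (0 : ℝ), ENNReal.ofReal (s ^ 3) * G s < ⊤ := by
    refine lt_of_le_of_lt ?_ hV.weight
    have : (fun s : ℝ => ENNReal.ofReal (s ^ 3) * G s)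
        = (Ioi 1).indicator fun x => ENNReal.ofReal (x ^ 3) * supDeriv V 3 (Ioi x) := by
      ext x
      by_cases hx : x ∈ Ioi (1 : ℝ) <;> simp [hG, hx]
    rw [this]
    refine (setLIntegral_le_lintegral _ _).trans ?_
    rw [lintegral_indicator measurableSet_Ioi]
  obtain ⟨C, hC⟩ := (isCompact_Icc (a := c) (b := max c 1)).bddAbove_image
    (hV.cont.mono fun x hx => lt_of_lt_of_le hc hx.1)
  have hCle : ∀ x ∈ Icc c (max c 1), iteratedDeriv 2 V x ≤ C :=
    fun x hx => hC (mem_image_of_mem _ hx)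
  have hC0 : 0 ≤ C := (hV.iteratedDeriv_two_nonneg hc.ne').trans (hCle c ⟨le_rfl, le_max_left _ _⟩)
  refine ⟨_, (tail_majorant hGm hint).add_const hC0 (B := max c 1) fun x hx => ?_⟩
  have hx0 : 0 < x := lt_of_lt_of_le hc hx
  rcases le_or_gt x (max c 1) with h | h
  · rw [indicator_of_mem (show x ∈ Iic (max c 1) from h)]
    exact (hCle x ⟨hx, h⟩).trans (le_add_of_nonneg_left ENNReal.toReal_nonneg)
  · refine le_add_of_le_of_nonneg ?_ (indicator_nonneg (fun _ _ => hC0) x)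
    refine (ENNReal.ofReal_le_iff_le_toReal (lintegral_tail_lt_top hint hx0).ne).1 ?_
    refine (ofReal_iteratedDeriv_two_le hV3 (hV.sobolev 2 (by norm_num))
      (hV.sobolev 3 le_rfl) hx0).trans ?_
    refine setLIntegral_mono' measurableSet_Ioi fun s hs => ?_
    rw [hG, indicator_of_mem
      (show s ∈ Ioi (1 : ℝ) from (le_max_right c 1).trans_lt (h.trans hs))]
    exact enorm_le_supDeriv (hx0.trans hs) self_mem_nhdsWithin hc3

lemma AssumptionThree.integrable_sq (hV : AssumptionThree V) :
    IntegrableOn (fun x => x ^ 2 * iteratedDeriv 2 V x) (Ioi 0) := by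
  obtain ⟨W, hW⟩ := hV.exists_majorant one_pos
  rw [← Ioo_union_Ici_eq_Ioi zero_lt_one]
  refine hV.sing.union ?_
  exact integrableOn_of_le_majorant measurableSet_Ici
    (fun x hx => lt_of_lt_of_le one_pos (mem_Ici.1 hx)) hW hV.cont
    fun x hx => hV.iteratedDeriv_two_nonneg (lt_of_lt_of_le one_pos hx).ne'

lemma AssumptionThree.repKernel (hV : AssumptionThree V) : RepKernel (iteratedDeriv 2 V) :=
  ⟨hV.iteratedDeriv_two_even, fun _ hx => hV.iteratedDeriv_two_nonneg hx, hV.cont,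
    integrableOn_min_of_sq hV.cont (fun _ hx => hV.iteratedDeriv_two_nonneg hx) hV.integrable_sq⟩

end Three

/-! ### The second moment of `V''` when `m = 2` -/

section SecondMoment

variable {V : ℝ → ℝ}

lemma AssumptionTwo.hasDerivAt (hV : AssumptionTwo V) {x : ℝ} (hx : 0 < x) :
    HasDerivAt V (deriv V x) x :=
  ((hV.diff x hx).differentiableAt (Ioi_mem_nhds hx)).hasDerivAt

lemma AssumptionTwo.hasDerivAt_deriv (hV : AssumptionTwo V) {x : ℝ} (hx : 0 < x) :
    HasDerivAt (deriv V) (iteratedDeriv 2 V x) x := by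
  have := hasDerivAt_iteratedDeriv_of_contDiffOn (n := 1) (by norm_num) hV.contDiffOn hx
  rwa [iteratedDeriv_one] at this

lemma AssumptionTwo.tendsto_atTop (hV : AssumptionTwo V) : Tendsto V atTop (𝓝 0) := by
  refine tendsto_zero_of_hasDerivAt_of_integrableOn_Ioi (a := 1) (f' := deriv V)
    (fun y hy => hV.hasDerivAt (lt_trans one_pos hy)) ?_ ?_
  · simpa [iteratedDeriv_one] using hV.sobolev 1 (by norm_num)
  · simpa [iteratedDeriv_zero] using hV.sobolev 0 (by norm_num)

lemma AssumptionTwo.deriv_tendsto_atTop (hV : AssumptionTwo V) :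
    Tendsto (deriv V) atTop (𝓝 0) := by
  refine tendsto_zero_of_hasDerivAt_of_integrableOn_Ioi (a := 1) (f' := iteratedDeriv 2 V)
    (fun y hy => hV.hasDerivAt_deriv (lt_trans one_pos hy)) (hV.sobolev 2 (by norm_num)) ?_
  simpa [iteratedDeriv_one] using hV.sobolev 1 (by norm_num)

lemma AssumptionTwo.integral_tail (hV : AssumptionTwo V) {x : ℝ} (hx : 0 < x) :
    IntegrableOn (iteratedDeriv 2 V) (Ioi x) ∧
      ∫ s in Ioi x, iteratedDeriv 2 V s = - deriv V x := by
  have hd : ∀ y ∈ Ioi x, HasDerivAt (deriv V) (iteratedDeriv 2 V y) y :=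
    fun y hy => hV.hasDerivAt_deriv (hx.trans hy)
  have hcw : ContinuousWithinAt (deriv V) (Ici x) x :=
    (hV.hasDerivAt_deriv hx).continuousAt.continuousWithinAt
  have hnn : ∀ y ∈ Ioi x, 0 ≤ iteratedDeriv 2 V y :=
    fun y hy => hV.iteratedDeriv_two_nonneg (hx.trans hy).ne'
  refine ⟨integrableOn_Ioi_deriv_of_nonneg hcw hd hnn hV.deriv_tendsto_atTop, ?_⟩
  rw [integral_Ioi_of_hasDerivAt_of_nonneg hcw hd hnn hV.deriv_tendsto_atTop, zero_sub]

/-- As `-V'(w) = ∫_w^∞ V''`, the second moment `M` gives `w² |V'(w)| ≤ M`, which is one power of `w`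
better than required. -/
lemma AssumptionTwo.mul_deriv_tendsto (hV : AssumptionTwo V) :
    Tendsto (fun w => w * deriv V w) atTop (𝓝 0) := by
  set M := ∫ s in Ioi (0 : ℝ), s ^ 2 * iteratedDeriv 2 V s with hM
  have hlim : Tendsto (fun w : ℝ => M / w) atTop (𝓝 0) := tendsto_const_nhds.div_atTop tendsto_id
  refine squeeze_zero_norm' ?_ hlim
  filter_upwards [eventually_gt_atTop 0] with w hw
  obtain ⟨h1, h2⟩ := hV.integral_tail hw
  have hnn : 0 ≤ ∫ s in Ioi w, iteratedDeriv 2 V s :=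
    setIntegral_nonneg measurableSet_Ioi fun s hs =>
      hV.iteratedDeriv_two_nonneg (hw.trans hs).ne'
  have h3 : w ^ 2 * ∫ s in Ioi w, iteratedDeriv 2 V s ≤ M := by
    rw [← integral_const_mul]
    calc ∫ s in Ioi w, w ^ 2 * iteratedDeriv 2 V s
        ≤ ∫ s in Ioi w, s ^ 2 * iteratedDeriv 2 V s := by
          refine setIntegral_mono_on (h1.const_mul _)
            (hV.integrable_sq.mono_set (Ioi_subset_Ioi hw.le)) measurableSet_Ioi fun s hs => ?_
          have hs' : w < s := hs
          exact mul_le_mul_of_nonneg_right (by gcongr) (hV.iteratedDeriv_two_nonneg (hw.trans hs).ne')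
      _ ≤ M := by
          refine setIntegral_mono_set hV.integrable_sq ?_ (Ioi_subset_Ioi hw.le).eventuallyLE
          refine (ae_restrict_iff' measurableSet_Ioi).2 (ae_of_all _ fun s hs => ?_)
          exact mul_nonneg (sq_nonneg s) (hV.iteratedDeriv_two_nonneg (ne_of_gt hs))
  rw [norm_mul, Real.norm_of_nonneg hw.le, ← norm_neg (deriv V w), ← h2, Real.norm_of_nonneg hnn,
    le_div_iff₀ hw]
  nlinarith

/-- The integrand has the primitive `(w - x) V'(w) - V(w)`, which vanishes at infinity and equals
`-V(x)` at `x`. Positivity of `V` comes out on the way. -/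
lemma AssumptionTwo.lintegral_weighted_tail (hV : AssumptionTwo V) {x : ℝ} (hx : 0 < x) :
    0 ≤ V x ∧ ∫⁻ s in Ioi x, ENNReal.ofReal ((s - x) * iteratedDeriv 2 V s) = ENNReal.ofReal (V x) := by
  have hd : ∀ y ∈ Ioi x, HasDerivAt (fun w => (w - x) * deriv V w - V w)
      ((y - x) * iteratedDeriv 2 V y) y := by
    intro y hy
    have h := (((hasDerivAt_id y).sub_const x).mul (hV.hasDerivAt_deriv (hx.trans hy))).sub
      (hV.hasDerivAt (hx.trans hy))
    refine h.congr_deriv ?_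
    simp
  have hcw : ContinuousWithinAt (fun w => (w - x) * deriv V w - V w) (Ici x) x := by
    have h := (((hasDerivAt_id x).sub_const x).mul (hV.hasDerivAt_deriv hx)).sub (hV.hasDerivAt hx)
    exact h.continuousAt.continuousWithinAt
  have hnn : ∀ y ∈ Ioi x, 0 ≤ (y - x) * iteratedDeriv 2 V y := fun y hy =>
    mul_nonneg (sub_nonneg.2 (le_of_lt hy)) (hV.iteratedDeriv_two_nonneg (hx.trans hy).ne')
  have hlim : Tendsto (fun w => (w - x) * deriv V w - V w) atTop (𝓝 0) := by
    have := (hV.mul_deriv_tendsto.sub (hV.deriv_tendsto_atTop.const_mul x)).sub hV.tendsto_atTop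
    simp only [mul_zero, sub_zero] at this
    refine this.congr fun w => ?_
    ring
  have hint := integrableOn_Ioi_deriv_of_nonneg hcw hd hnn hlim
  have hval := integral_Ioi_of_hasDerivAt_of_nonneg hcw hd hnn hlim
  have hnn' : 0 ≤ᵐ[volume.restrict (Ioi x)] fun y => (y - x) * iteratedDeriv 2 V y :=
    (ae_restrict_iff' measurableSet_Ioi).2 (ae_of_all _ hnn)
  have hval' : ∫ y in Ioi x, (y - x) * iteratedDeriv 2 V y = V x := by
    rw [hval]; simp
  refine ⟨hval' ▸ integral_nonneg_of_ae hnn', ?_⟩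
  rw [← hval', ofReal_integral_eq_lintegral_ofReal hint hnn']

/-- `∫_0^∞ x² V''(x) dx = ‖V‖_{L¹(ℝ)}`. -/
lemma AssumptionTwo.integral_sq_mul (hV : AssumptionTwo V) :
    ∫ x in Ioi (0 : ℝ), x ^ 2 * iteratedDeriv 2 V x = ∫ x, |V x| := by
  have hnn : ∀ x, 0 < x → 0 ≤ iteratedDeriv 2 V x := fun x hx =>
    hV.iteratedDeriv_two_nonneg hx.ne'
  have h1 : ∫ x, |V x| = 2 * ∫ x in Ioi (0 : ℝ), V x := by
    rw [← integral_comp_abs (f := V)]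
    refine integral_congr_ae ?_
    have : ∀ᵐ x : ℝ, x ≠ 0 := by simp [ae_iff]
    filter_upwards [this] with x hx
    rcases lt_or_gt_of_ne hx with h | h
    · rw [abs_of_neg h, hV.even x hx, abs_of_nonneg]
      rw [← hV.even x hx]
      exact (hV.lintegral_weighted_tail (neg_pos.2 h)).1
    · rw [abs_of_pos h, abs_of_nonneg (hV.lintegral_weighted_tail h).1]
  have hmV : AEStronglyMeasurable V (volume.restrict (Ioi 0)) :=
    hV.diff.continuousOn.aestronglyMeasurable measurableSet_Ioi
  have h2 : ∫ x in Ioi (0 : ℝ), V x = (∫⁻ x in Ioi (0 : ℝ), ENNReal.ofReal (V x)).toReal :=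
    integral_eq_lintegral_of_nonneg_ae ((ae_restrict_iff' measurableSet_Ioi).2
      (ae_of_all _ fun x hx => (hV.lintegral_weighted_tail hx).1)) hmV
  have h3 : ∫ x in Ioi (0 : ℝ), x ^ 2 / 2 * iteratedDeriv 2 V x
      = (∫⁻ x in Ioi (0 : ℝ), ENNReal.ofReal (x ^ 2 / 2 * iteratedDeriv 2 V x)).toReal := by
    refine integral_eq_lintegral_of_nonneg_ae ((ae_restrict_iff' measurableSet_Ioi).2
      (ae_of_all _ fun x hx => mul_nonneg (by positivity) (hnn x hx))) ?_
    exact (Continuous.aestronglyMeasurable (by fun_prop)).mul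
      (hV.cont.aestronglyMeasurable measurableSet_Ioi)
  have hm2 : Measurable ((Ioi (0:ℝ)).indicator (iteratedDeriv 2 V)) := by
    have := hV.cont.measurable_piecewise (g := fun _ => (0:ℝ)) (continuousOn_const)
      measurableSet_Ioi
    rw [← Set.piecewise_eq_indicator]
    exact this
  have hmeas : Measurable (Function.uncurry fun x s : ℝ =>
      (Ioi x).indicator (fun s => ENNReal.ofReal ((s - x) * (Ioi (0:ℝ)).indicator
        (iteratedDeriv 2 V) s)) s) := by
    have : (Function.uncurry fun x s : ℝ =>
      (Ioi x).indicator (fun s => ENNReal.ofReal ((s - x) * (Ioi (0:ℝ)).indicator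
        (iteratedDeriv 2 V) s)) s) = {p : ℝ × ℝ | p.1 < p.2}.indicator
        (fun p => ENNReal.ofReal ((p.2 - p.1) * (Ioi (0:ℝ)).indicator
        (iteratedDeriv 2 V) p.2)) := by
      ext ⟨x, s⟩
      simp [indicator, Function.uncurry]
    rw [this]
    refine Measurable.indicator ?_ (measurableSet_lt measurable_fst measurable_snd)
    exact ((measurable_snd.sub measurable_fst).mul (hm2.comp measurable_snd)).ennreal_ofReal
  -- Tonelli applied to `V(x) = ∫_x^∞ (s - x) V''(s) ds`, with `∫_0^s (s - x) dx = s²/2`. The factor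
  -- `1/2` is compensated by the two half-lines. The indicators of `(0,∞)` make the integrand
  -- measurable, as `V''` is only known to be continuous there.
  have h4 : ∫⁻ x in Ioi (0 : ℝ), ENNReal.ofReal (V x)
      = ∫⁻ x in Ioi (0 : ℝ), ENNReal.ofReal (x ^ 2 / 2 * iteratedDeriv 2 V x) := by
    calc ∫⁻ x in Ioi (0 : ℝ), ENNReal.ofReal (V x)
        = ∫⁻ x in Ioi (0 : ℝ), ∫⁻ s in Ioi (0 : ℝ),
          (Ioi x).indicator (fun s => ENNReal.ofReal ((s - x) * (Ioi (0:ℝ)).indicator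
            (iteratedDeriv 2 V) s)) s := by
          refine setLIntegral_congr_fun measurableSet_Ioi fun x hx => ?_
          rw [← (hV.lintegral_weighted_tail hx).2, lintegral_indicator measurableSet_Ioi,
            Measure.restrict_restrict measurableSet_Ioi,
            inter_eq_left.2 (Ioi_subset_Ioi (le_of_lt hx))]
          refine setLIntegral_congr_fun measurableSet_Ioi fun s hs => ?_
          rw [indicator_of_mem (show s ∈ Ioi (0:ℝ) from lt_trans (mem_Ioi.1 hx) (mem_Ioi.1 hs))]
      _ = ∫⁻ s in Ioi (0 : ℝ), ∫⁻ x in Ioi (0 : ℝ),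
          (Ioi x).indicator (fun s => ENNReal.ofReal ((s - x) * (Ioi (0:ℝ)).indicator
            (iteratedDeriv 2 V) s)) s := lintegral_lintegral_swap hmeas.aemeasurable
      _ = _ := by
          refine setLIntegral_congr_fun measurableSet_Ioi fun s hs => ?_
          have hs0 : (0:ℝ) < s := hs
          have e1 : ∀ x : ℝ, (Ioi x).indicator (fun s => ENNReal.ofReal ((s - x) *
              (Ioi (0:ℝ)).indicator (iteratedDeriv 2 V) s)) s
              = (Iio s).indicator (fun x => ENNReal.ofReal ((s - x) * iteratedDeriv 2 V s)) x := by
            intro x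
            simp [indicator, hs0]
          simp_rw [e1]
          rw [lintegral_indicator measurableSet_Iio, Measure.restrict_restrict measurableSet_Iio,
            Iio_inter_Ioi]
          have hii : IntegrableOn (fun x => (s - x) * iteratedDeriv 2 V s) (Ioo 0 s) :=
            (Continuous.integrableOn_Ioc (by fun_prop)).mono_set Ioo_subset_Ioc_self
          rw [← ofReal_integral_eq_lintegral_ofReal hii ((ae_restrict_iff' measurableSet_Ioo).2
            (ae_of_all _ fun x hx => mul_nonneg (sub_nonneg.2 hx.2.le) (hnn s hs0)))]
          congr 1
          rw [← integral_Ioc_eq_integral_Ioo, ← intervalIntegral.integral_of_le hs0.le,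
            intervalIntegral.integral_mul_const]
          congr 1
          rw [intervalIntegral.integral_sub (by simp) (by simp)]
          simp
          ring
  rw [h1, h2, h4, ← h3, ← integral_const_mul]
  refine integral_congr_ae (ae_of_all _ fun x => ?_)
  simp only
  ring

end SecondMoment

/-! ### The staircase -/

lemma stair_mono {ε : ℝ} (hε : 0 < ε) : Monotone (stair ε) := by
  intro x y hxy
  unfold stair
  have : ⌊x / ε⌋ ≤ ⌊y / ε⌋ := Int.floor_le_floor (by gcongr)
  have : (⌊x / ε⌋ : ℝ) ≤ ⌊y / ε⌋ := by exact_mod_cast this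
  gcongr

lemma measurable_stair {ε : ℝ} (hε : 0 < ε) : Measurable (stair ε) := (stair_mono hε).measurable

lemma abs_stair_sub_le {ε : ℝ} (hε : 0 < ε) (γ : ℝ) : |stair ε γ - γ| ≤ ε / 2 := by
  have h1 := Int.floor_le (γ / ε)
  have h2 := Int.lt_floor_add_one (γ / ε)
  have h3 : γ = ε * (γ / ε) := by field_simp
  have h4 : stair ε γ - γ = ε * (⌊γ / ε⌋ + 1 / 2 - γ / ε) := by
    unfold stair
    rw [mul_sub, ← h3]
  rw [h4, abs_mul, abs_of_pos hε, mul_comm, ← le_div_iff₀ hε]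
  have : ε / 2 / ε = 1 / 2 := by field_simp
  rw [this, abs_le]
  constructor <;> linarith

lemma abs_stair_le {ε : ℝ} (hε : 0 < ε) (γ : ℝ) : |stair ε γ| ≤ |γ| + ε / 2 := by
  have h := abs_stair_sub_le hε γ
  have := abs_sub_abs_le_abs_sub (stair ε γ) γ
  linarith

lemma eventually_stair_le {ε : ℝ} (hε : 0 < ε) (γ : ℝ) : ∀ᶠ y in 𝓝 γ, stair ε y ≤ stair ε γ := by
  have h : γ < ε * (⌊γ / ε⌋ + 1) := by
    have := Int.lt_floor_add_one (γ / ε)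
    rwa [div_lt_iff₀' hε] at this
  filter_upwards [eventually_lt_nhds h] with y hy
  unfold stair
  have : ⌊y / ε⌋ < ⌊γ / ε⌋ + 1 := by
    rw [Int.floor_lt]
    push_cast
    rwa [div_lt_iff₀' hε]
  have : (⌊y / ε⌋ : ℝ) ≤ ⌊γ / ε⌋ := by exact_mod_cast Int.lt_add_one_iff.1 this
  gcongr

/-- The floor function takes the upper value at its jumps, so the staircase is already upper
semicontinuous. The limsup is over the full neighbourhood filter, which sees the value at `γ`. -/
lemma stairUpper_eq {ε : ℝ} (hε : 0 < ε) (γ : ℝ) : stairUpper ε γ = stair ε γ := by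
  have hlow : ∀ᶠ y in 𝓝 γ, stair ε (γ - 1) ≤ stair ε y := by
    filter_upwards [eventually_ge_nhds (show γ - 1 < γ by linarith)] with y hy
    exact stair_mono hε hy
  refine le_antisymm ?_ ?_
  · exact limsup_le_of_le ⟨stair ε (γ - 1), fun b hb => by
      obtain ⟨y, h1, h2⟩ := ((eventually_map.1 hb).and hlow).exists
      exact h2.trans h1⟩ (eventually_stair_le hε γ)
  · refine le_limsup_of_frequently_le ?_ ⟨stair ε γ, eventually_stair_le hε γ⟩
    exact Filter.Frequently.filter_mono (f := pure γ) (by simp) (pure_le_nhds γ)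

/-- Both sides are `ε (⌈γ/ε⌉ - 1/2)`, the value reached from the left. That the two envelopes are
reflections of each other is the source of the duality between sub- and supersolutions. -/
lemma stairLower_eq {ε : ℝ} (hε : 0 < ε) (γ : ℝ) : stairLower ε γ = - stair ε (-γ) := by
  have hval : - stair ε (-γ) = ε * (⌈γ / ε⌉ - 1 / 2) := by
    unfold stair
    rw [neg_div, Int.floor_neg]
    push_cast
    ring
  have hhigh : ∀ᶠ y in 𝓝 γ, stair ε y ≤ stair ε γ := eventually_stair_le hε γ
  have hlow : ∀ᶠ y in 𝓝 γ, - stair ε (-γ) ≤ stair ε y := by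
    have h : ε * (⌈γ / ε⌉ - 1) < γ := by
      have := Int.ceil_lt_add_one (γ / ε)
      rw [← lt_div_iff₀' hε]
      linarith
    filter_upwards [eventually_ge_nhds h] with y hy
    rw [hval]
    unfold stair
    have : ⌈γ / ε⌉ - 1 ≤ ⌊y / ε⌋ := by
      rw [Int.le_floor]
      push_cast
      rwa [le_div_iff₀' hε]
    have : (⌈γ / ε⌉ - 1 : ℝ) ≤ ⌊y / ε⌋ := by exact_mod_cast this
    exact mul_le_mul_of_nonneg_left (by linarith) hε.le
  refine le_antisymm ?_ ?_
  · refine liminf_le_of_frequently_le ?_ ⟨- stair ε (-γ), hlow⟩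
    have h1 : ∀ᶠ y in 𝓝[<] γ, stair ε y ≤ - stair ε (-γ) := by
      filter_upwards [self_mem_nhdsWithin] with y hy
      have hyγ : y < γ := hy
      rw [hval]
      unfold stair
      have : ⌊y / ε⌋ < ⌈γ / ε⌉ := by
        rw [Int.floor_lt]
        exact lt_of_lt_of_le (by gcongr) (Int.le_ceil _)
      have : (⌊y / ε⌋ + 1 : ℝ) ≤ ⌈γ / ε⌉ := by exact_mod_cast this
      exact mul_le_mul_of_nonneg_left (by linarith) hε.le
    exact h1.frequently.filter_mono nhdsWithin_le_nhds
  · exact le_liminf_of_le ⟨stair ε γ, fun b hb => by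
      obtain ⟨y, h1, h2⟩ := ((eventually_map.1 hb).and hhigh).exists
      exact h1.trans h2⟩ hlow

lemma sum_indicator_le_eq_floor {K : ℕ} {t : ℝ} (h0 : 0 ≤ t) (hK : t < K + 1) :
    ∑ k ∈ Finset.range K, (if ((k : ℝ) + 1) ≤ t then (1 : ℝ) else 0) = ⌊t⌋ := by
  have hn : ⌊t⌋₊ ≤ K := by
    have : ⌊t⌋₊ < K + 1 := (Nat.floor_lt h0).2 (by exact_mod_cast hK)
    omega
  have h1 : ∀ k : ℕ, ((k : ℝ) + 1 ≤ t) ↔ k < ⌊t⌋₊ := by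
    intro k
    rw [← Nat.succ_le_iff, Nat.le_floor_iff h0]
    push_cast
    rfl
  have h2 : (Finset.range K).filter (fun k => k < ⌊t⌋₊) = Finset.range ⌊t⌋₊ := by
    ext k
    simp only [Finset.mem_filter, Finset.mem_range]
    omega
  simp_rw [h1]
  rw [← Finset.sum_filter, h2]
  simp only [Finset.sum_const, Finset.card_range, nsmul_eq_mul, mul_one]
  rw [← Int.natCast_floor_eq_floor h0]
  rfl

lemma sum_indicator_lt_eq_ceil {K : ℕ} {t : ℝ} (h0 : 0 < t) (hK : t ≤ K + 1) :
    ∑ k ∈ Finset.range K, (if ((k : ℝ) + 1) < t then (1 : ℝ) else 0) = ⌈t⌉ - 1 := by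
  have hn : ⌈t⌉₊ ≤ K + 1 := Nat.ceil_le.2 (by exact_mod_cast hK)
  have hn1 : 0 < ⌈t⌉₊ := Nat.ceil_pos.2 h0
  have h1 : ∀ k : ℕ, ((k : ℝ) + 1 < t) ↔ k < ⌈t⌉₊ - 1 := by
    intro k
    have : k + 1 < ⌈t⌉₊ ↔ ((k + 1 : ℕ) : ℝ) < t := Nat.lt_ceil
    push_cast at this
    rw [← this]
    omega
  have h2 : (Finset.range K).filter (fun k => k < ⌈t⌉₊ - 1) = Finset.range (⌈t⌉₊ - 1) := by
    ext k
    simp only [Finset.mem_filter, Finset.mem_range]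
    omega
  simp_rw [h1]
  rw [← Finset.sum_filter, h2]
  simp only [Finset.sum_const, Finset.card_range, nsmul_eq_mul, mul_one]
  rw [← Int.natCast_ceil_eq_ceil h0.le, Nat.cast_sub hn1]
  simp

/-- The staircase at a positive and at a negative height, in terms of the jumps crossed. -/
lemma stair_add_stair_neg {ε f g : ℝ} {K : ℕ} (hε : 0 < ε) (hf : 0 ≤ f) (hg : 0 < g)
    (hfK : f < (K + 1) * ε) (hgK : g ≤ (K + 1) * ε) :
    stair ε f + stair ε (-g) = ε * ∑ k ∈ Finset.range K,
      ((if ((k : ℝ) + 1) * ε ≤ f then (1 : ℝ) else 0)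
        - (if ((k : ℝ) + 1) * ε < g then (1 : ℝ) else 0)) := by
  have h1 := sum_indicator_le_eq_floor (K := K) (t := f / ε) (by positivity)
    (by rwa [div_lt_iff₀ hε])
  have h2 := sum_indicator_lt_eq_ceil (K := K) (t := g / ε) (by positivity)
    (by rwa [div_le_iff₀ hε])
  simp_rw [le_div_iff₀ hε] at h1
  simp_rw [lt_div_iff₀ hε] at h2
  rw [Finset.sum_sub_distrib, h1, h2]
  -- The two halves add up to one, which accounts for the strict count being `⌈g/ε⌉ - 1`.
  unfold stair
  rw [neg_div, Int.floor_neg]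
  push_cast
  ring

/-! ### Crossing points of an increasing profile -/

/-- `f` vanishes at `0` and has difference quotients between `m` and `P` on `[0,δ]`. -/
structure BiLip (f : ℝ → ℝ) (δ m P : ℝ) : Prop where
  pos : 0 < δ
  mpos : 0 < m
  zero : f 0 = 0
  lower : ∀ x ∈ Icc 0 δ, ∀ y ∈ Icc 0 δ, x ≤ y → m * (y - x) ≤ f y - f x
  upper : ∀ x ∈ Icc 0 δ, ∀ y ∈ Icc 0 δ, x ≤ y → f y - f x ≤ P * (y - x)

/-- The point of `[0,δ]` where the increasing function `f` crosses the level `y`, or `δ` if there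
is none. -/
noncomputable def cross (f : ℝ → ℝ) (δ y : ℝ) : ℝ := sSup {z | z ∈ Icc 0 δ ∧ f z ≤ y}

namespace BiLip

variable {f : ℝ → ℝ} {δ m P : ℝ}

lemma Ppos (h : BiLip f δ m P) : 0 < P := by
  have h0 : (0 : ℝ) ∈ Icc 0 δ := ⟨le_rfl, h.pos.le⟩
  have h1 : δ ∈ Icc 0 δ := ⟨h.pos.le, le_rfl⟩
  have := (h.lower 0 h0 δ h1 h.pos.le).trans (h.upper 0 h0 δ h1 h.pos.le)
  have h3 := h.mpos
  have h4 := le_of_mul_le_mul_right this (by linarith [h.pos])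
  linarith

lemma lower' (h : BiLip f δ m P) {x : ℝ} (hx : x ∈ Icc 0 δ) : m * x ≤ f x := by
  simpa [h.zero] using h.lower 0 ⟨le_rfl, h.pos.le⟩ x hx hx.1

lemma upper' (h : BiLip f δ m P) {x : ℝ} (hx : x ∈ Icc 0 δ) : f x ≤ P * x := by
  simpa [h.zero] using h.upper 0 ⟨le_rfl, h.pos.le⟩ x hx hx.1

lemma continuousOn (h : BiLip f δ m P) : ContinuousOn f (Icc 0 δ) := by
  refine LipschitzOnWith.continuousOn (K := P.toNNReal) (LipschitzOnWith.of_dist_le_mul ?_)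
  intro x hx y hy
  rw [Real.coe_toNNReal _ h.Ppos.le, Real.dist_eq, Real.dist_eq]
  rcases le_total x y with hxy | hxy
  · have h1 := h.upper x hx y hy hxy
    have h2 := h.lower x hx y hy hxy
    have h3 := mul_nonneg h.mpos.le (sub_nonneg.2 hxy)
    rw [abs_sub_comm, abs_sub_comm x, abs_of_nonneg (sub_nonneg.2 hxy), abs_of_nonneg (h3.trans h2)]
    exact h1
  · have h1 := h.upper y hy x hx hxy
    have h2 := h.lower y hy x hx hxy
    have h3 := mul_nonneg h.mpos.le (sub_nonneg.2 hxy)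
    rw [abs_of_nonneg (sub_nonneg.2 hxy), abs_of_nonneg (h3.trans h2)]
    exact h1

/-- The supremum is attained by compactness; `0 ≤ y` puts the origin in the set. -/
lemma cross_mem (h : BiLip f δ m P) {y : ℝ} (hy : 0 ≤ y) :
    cross f δ y ∈ Icc 0 δ ∧ f (cross f δ y) ≤ y := by
  have hcl : IsClosed {z | z ∈ Icc 0 δ ∧ f z ≤ y} := by
    exact h.continuousOn.preimage_isClosed_of_isClosed isClosed_Icc isClosed_Iic
  have hcomp : IsCompact {z | z ∈ Icc 0 δ ∧ f z ≤ y} :=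
    isCompact_Icc.of_isClosed_subset hcl fun z hz => hz.1
  exact hcomp.sSup_mem ⟨0, ⟨le_rfl, h.pos.le⟩, by rwa [h.zero]⟩

lemma le_cross {z y : ℝ} (hz : z ∈ Icc 0 δ) (hzy : f z ≤ y) : z ≤ cross f δ y :=
  le_csSup ⟨δ, fun _ hw => hw.1.2⟩ ⟨hz, hzy⟩

lemma lt_of_lt_cross (h : BiLip f δ m P) {z y : ℝ} (hy : 0 ≤ y) (hz : z ∈ Icc 0 δ)
    (hzc : z < cross f δ y) : f z < y := by
  obtain ⟨h1, h2⟩ := h.cross_mem hy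
  have h3 := h.lower z hz _ h1 hzc.le
  have h4 := mul_pos h.mpos (sub_pos.2 hzc)
  linarith

lemma lt_of_cross_lt {z y : ℝ} (hz : z ∈ Icc 0 δ) (hzc : cross f δ y < z) : y < f z := by
  by_contra hcon
  exact absurd (le_cross hz (not_lt.1 hcon)) (not_le.2 hzc)

/-- If `f` were still below `y` at the crossing point, the slope bound `P` would allow a further
step of length `(y - f c)/P`. -/
lemma cross_eq (h : BiLip f δ m P) {y : ℝ} (hy : 0 ≤ y) (hc : cross f δ y < δ) :
    f (cross f δ y) = y := by
  obtain ⟨h1, h2⟩ := h.cross_mem hy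
  by_contra hne
  have hlt : f (cross f δ y) < y := lt_of_le_of_ne h2 hne
  set c := cross f δ y with hcdef
  set s := min δ (c + (y - f c) / P) with hs
  have hpos : 0 < (y - f c) / P := div_pos (sub_pos.2 hlt) h.Ppos
  have hcs : c < s := lt_min hc (by linarith)
  have hsmem : s ∈ Icc 0 δ := ⟨h1.1.trans hcs.le, min_le_left _ _⟩
  have h3 := h.upper c h1 s hsmem hcs.le
  have h4 : s - c ≤ (y - f c) / P := by
    have := min_le_right δ (c + (y - f c) / P)
    linarith
  have h5 : P * (s - c) ≤ y - f c := by
    rwa [le_div_iff₀' h.Ppos] at h4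
  exact absurd (le_cross hsmem (by linarith : f s ≤ y)) (not_le.2 hcs)

lemma min_le_cross (h : BiLip f δ m P) {y : ℝ} (hy : 0 ≤ y) : min δ (y / P) ≤ cross f δ y := by
  have hP := h.Ppos
  have hmem : min δ (y / P) ∈ Icc 0 δ := ⟨le_min h.pos.le (by positivity), min_le_left _ _⟩
  refine le_cross hmem ((h.upper' hmem).trans ?_)
  calc P * min δ (y / P) ≤ P * (y / P) := by gcongr; exact min_le_right _ _
    _ = y := by field_simp

/-- At the smaller crossing point `c` one has `f c = y`, while `g ≤ y` at the larger one. Hence `m`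
times the gap is at most `f c - g c ≤ L c²`, and `c ≤ y/m`. The gap is thus quadratic in the level.
-/
lemma cross_sub_cross_le {g : ℝ → ℝ} {L : ℝ} (hf : BiLip f δ m P) (hg : BiLip g δ m P)
    (hL : ∀ z ∈ Icc 0 δ, |f z - g z| ≤ L * z ^ 2) {y : ℝ} (hy : 0 ≤ y)
    (hlt : cross f δ y < cross g δ y) :
    y / P ≤ cross f δ y ∧ cross g δ y - cross f δ y ≤ L * y ^ 2 / m ^ 3 := by
  obtain ⟨h1, h2⟩ := hf.cross_mem hy
  obtain ⟨h3, h4⟩ := hg.cross_mem hy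
  have hm := hf.mpos
  have h5 : f (cross f δ y) = y := hf.cross_eq hy (hlt.trans_le h3.2)
  have h6 := hf.upper' h1
  have h7 := hf.lower' h1
  have h8 := hg.lower _ h1 _ h3 hlt.le
  have h9 := hL _ h1
  refine ⟨by rw [div_le_iff₀' hf.Ppos]; linarith, ?_⟩
  set c := cross f δ y
  have hL0 : 0 ≤ L := by
    have := (abs_nonneg _).trans (hL δ ⟨hf.pos.le, le_rfl⟩)
    exact nonneg_of_mul_nonneg_left this (pow_pos hf.pos 2)
  have hcy : c ≤ y / m := by rw [le_div_iff₀' hm]; linarith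
  have h10 : m * (cross g δ y - c) ≤ L * (y / m) ^ 2 := by
    calc m * (cross g δ y - c) ≤ f c - g c := by linarith
      _ ≤ L * c ^ 2 := (le_abs_self _).trans h9
      _ ≤ L * (y / m) ^ 2 := by
          have := h1.1
          gcongr
  rw [le_div_iff₀ (by positivity)]
  have h11 : L * (y / m) ^ 2 * m ^ 2 = L * y ^ 2 := by field_simp
  nlinarith [pow_pos hm 2]

/-- Strict and weak conditions differ at a single point, by strict monotonicity. The predicate `p`
is squeezed between them because the right half of the profile is counted with `≤` (floor) and the
left half with `<` (ceiling). -/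
lemma setIntegral_crossed (h : BiLip f δ m P) {y r : ℝ} (hy : 0 ≤ y) (hr : 0 ≤ r)
    (hrc : r < cross f δ y) (w : ℝ → ℝ) (p : ℝ → Prop) [DecidablePred p]
    (hp1 : ∀ z, y < f z → p z) (hp2 : ∀ z, p z → y ≤ f z) :
    ∫ z in Ioo r δ, (if p z then (1 : ℝ) else 0) * w z = ∫ z in cross f δ y..δ, w z := by
  obtain ⟨h1, -⟩ := h.cross_mem hy
  rw [intervalIntegral.integral_of_le h1.2, ← integral_indicator measurableSet_Ioo,
    integral_Ioc_eq_integral_Ioo, ← integral_indicator measurableSet_Ioo]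
  refine integral_congr_ae ?_
  have : ∀ᵐ x : ℝ, x ≠ cross f δ y := by simp [ae_iff]
  filter_upwards [this] with z hz
  by_cases hzc : z < cross f δ y
  · rw [indicator_of_notMem (show z ∉ Ioo (cross f δ y) δ from fun hz' => absurd hz'.1 hzc.not_gt)]
    by_cases hzr : z ∈ Ioo r δ
    · rw [indicator_of_mem hzr, if_neg, zero_mul]
      intro hpz
      exact absurd (hp2 z hpz) (not_le.2 (h.lt_of_lt_cross hy ⟨hr.trans hzr.1.le, hzr.2.le⟩ hzc))
    · rw [indicator_of_notMem hzr]
  · have hcz : cross f δ y < z := lt_of_le_of_ne (not_lt.1 hzc) (Ne.symm hz)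
    by_cases hzδ : z < δ
    · rw [indicator_of_mem (show z ∈ Ioo r δ from ⟨hrc.trans hcz, hzδ⟩),
        indicator_of_mem (show z ∈ Ioo (cross f δ y) δ from ⟨hcz, hzδ⟩), if_pos, one_mul]
      exact hp1 z (lt_of_cross_lt ⟨h1.1.trans hcz.le, hzδ.le⟩ hcz)
    · rw [indicator_of_notMem (fun hz' => hzδ hz'.2), indicator_of_notMem (fun hz' => hzδ hz'.2)]

end BiLip

/-! ### The nonlocal operator near the origin -/

/-- An increasing profile on `[-δ,δ]` with slopes in `[m,P]`, odd up to a quadratic error. -/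
structure Tame (ψ : ℝ → ℝ) (δ m P L : ℝ) : Prop where
  pos : 0 < δ
  mpos : 0 < m
  cont : Continuous ψ
  zero : ψ 0 = 0
  lower : ∀ x ∈ Icc (-δ) δ, ∀ y ∈ Icc (-δ) δ, x ≤ y → m * (y - x) ≤ ψ y - ψ x
  upper : ∀ x ∈ Icc (-δ) δ, ∀ y ∈ Icc (-δ) δ, x ≤ y → ψ y - ψ x ≤ P * (y - x)
  sym : ∀ z ∈ Icc 0 δ, |ψ z + ψ (-z)| ≤ L * z ^ 2

/-- The contribution to the nonlocal operator of the pair of particles at heights `±y`. -/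
noncomputable def pairForce (w ψ : ℝ → ℝ) (δ y : ℝ) : ℝ :=
  ∫ z in cross ψ δ y..cross (fun z => -ψ (-z)) δ y, w z

namespace Tame

variable {ψ : ℝ → ℝ} {δ m P L : ℝ}

lemma biLip_right (h : Tame ψ δ m P L) : BiLip ψ δ m P where
  pos := h.pos
  mpos := h.mpos
  zero := h.zero
  lower x hx y hy := h.lower x ⟨by linarith [hx.1, h.pos], hx.2⟩ y ⟨by linarith [hy.1, h.pos], hy.2⟩
  upper x hx y hy := h.upper x ⟨by linarith [hx.1, h.pos], hx.2⟩ y ⟨by linarith [hy.1, h.pos], hy.2⟩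

lemma biLip_left (h : Tame ψ δ m P L) : BiLip (fun z => -ψ (-z)) δ m P where
  pos := h.pos
  mpos := h.mpos
  zero := by simp [h.zero]
  lower x hx y hy hxy := by
    have := h.lower (-y) ⟨by linarith [hy.2], by linarith [hy.1, h.pos]⟩
      (-x) ⟨by linarith [hx.2], by linarith [hx.1, h.pos]⟩ (by linarith)
    linarith
  upper x hx y hy hxy := by
    have := h.upper (-y) ⟨by linarith [hy.2], by linarith [hy.1, h.pos]⟩
      (-x) ⟨by linarith [hx.2], by linarith [hx.1, h.pos]⟩ (by linarith)
    linarith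

lemma integrableOn (h : Tame ψ δ m P L) {ε : ℝ} (hε : 0 < ε) {w : ℝ → ℝ}
    (hw : ContinuousOn w (Ioi 0)) {r : ℝ} (hr : 0 < r) (σ : ℝ) :
    IntegrableOn (fun z => stair ε (ψ (σ * z)) * w z) (Ioo r δ) := by
  have hwi : IntegrableOn w (Ioo r δ) :=
    ((hw.mono fun x hx => hr.trans_le hx.1).integrableOn_compact isCompact_Icc).mono_set
      (Ioo_subset_Icc_self (a := r) (b := δ))
  have hc : Continuous fun z => ψ (σ * z) := h.cont.comp (by fun_prop)
  obtain ⟨C, hC⟩ := (isCompact_Icc (a := r) (b := δ)).exists_bound_of_continuousOn hc.continuousOn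
  refine Integrable.bdd_mul (c := C + ε / 2) hwi
    ((measurable_stair hε).comp hc.measurable).aestronglyMeasurable ?_
  refine (ae_restrict_iff' measurableSet_Ioo).2 (ae_of_all _ fun z hz => ?_)
  have h1 := abs_stair_le hε (ψ (σ * z))
  have h2 := hC z (Ioo_subset_Icc_self hz)
  rw [Real.norm_eq_abs] at h2 ⊢
  linarith

lemma setIntegral_annulus {F : ℝ → ℝ} {r δ : ℝ} (hr : 0 ≤ r) (hrδ : r < δ)
    (h1 : IntegrableOn F (Ioo r δ)) (h2 : IntegrableOn (fun z => F (-z)) (Ioo r δ)) :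
    IntegrableOn F {z | r < |z| ∧ |z| < δ} ∧
    ∫ z in {z | r < |z| ∧ |z| < δ}, F z = ∫ z in Ioo r δ, (F z + F (-z)) := by
  have hset : {z : ℝ | r < |z| ∧ |z| < δ} = Ioo r δ ∪ Ioo (-δ) (-r) := by
    ext z
    simp only [mem_ofPred_eq, mem_union, mem_Ioo]
    constructor
    · rintro ⟨h3, h4⟩
      rw [abs_lt] at h4
      rcases lt_abs.1 h3 with h5 | h5
      · exact Or.inl ⟨h5, h4.2⟩
      · exact Or.inr ⟨h4.1, by linarith⟩
    · rintro (⟨h3, h4⟩ | ⟨h3, h4⟩)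
      · rw [abs_of_pos (by linarith)]
        exact ⟨h3, h4⟩
      · rw [abs_of_neg (by linarith)]
        constructor <;> linarith
  have hdisj : Disjoint (Ioo r δ) (Ioo (-δ) (-r)) := by
    rw [Set.disjoint_left]
    intro z hz hz'
    linarith [hz.1, hz'.2]
  have h3 : IntegrableOn F (Ioo (-δ) (-r)) := by
    rw [← integrableOn_Ioc_iff_integrableOn_Ioo,
      ← intervalIntegrable_iff_integrableOn_Ioc_of_le (by linarith)]
    rw [← integrableOn_Ioc_iff_integrableOn_Ioo,
      ← intervalIntegrable_iff_integrableOn_Ioc_of_le hrδ.le] at h2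
    have := h2.comp_mul_left (c := -1)
    simp only [neg_mul, one_mul, neg_neg] at this
    have e : ∀ x : ℝ, x / -1 = -x := fun x => by rw [div_neg, div_one]
    simp only [e] at this
    exact this.symm
  have h4 : ∫ z in Ioo (-δ) (-r), F z = ∫ z in Ioo r δ, F (-z) := by
    rw [← integral_Ioc_eq_integral_Ioo, ← integral_Ioc_eq_integral_Ioo,
      ← intervalIntegral.integral_of_le hrδ.le, ← intervalIntegral.integral_of_le (by linarith),
      intervalIntegral.integral_comp_neg]
  rw [hset]
  refine ⟨h1.union h3, ?_⟩
  rw [setIntegral_union hdisj measurableSet_Ioo h1 h3, h4, integral_add h1 h2]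

/-- The truncated principal value of the staircase operator over `B_δ`, as a sum of forces. -/
lemma setIntegral_stair (h : Tame ψ δ m P L) {ε : ℝ} (hε : 0 < ε) {w : ℝ → ℝ}
    (heven : ∀ x, w (-x) = w x) (hw : ContinuousOn w (Ioi 0)) {K : ℕ} (hK : P * δ ≤ K * ε)
    {r : ℝ} (hr : 0 < r) (hrδ : r < min δ (ε / P)) :
    ∫ z in {z | r < |z| ∧ |z| < δ}, stair ε (ψ z) * w z
      = ∑ k ∈ Finset.range K, ε * pairForce w ψ δ ((k + 1) * ε) := by
  have hf := h.biLip_right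
  have hg := h.biLip_left
  have hPp := hf.Ppos
  have hrδ' : r < δ := hrδ.trans_le (min_le_left _ _)
  -- No level is reached before `ε / P`, so the truncation radius lies below all crossing points;
  -- this is why the result does not depend on `r`.
  have hcross : ∀ k : ℕ, ∀ f : ℝ → ℝ, BiLip f δ m P → r < cross f δ ((k + 1) * ε) := by
    intro k f hf
    refine hrδ.trans_le (le_trans ?_ (hf.min_le_cross (by positivity)))
    refine min_le_min_left _ ?_
    gcongr
    nlinarith [(Nat.cast_nonneg k : (0 : ℝ) ≤ k)]
  have h1 := h.integrableOn hε hw hr 1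
  have h2 := h.integrableOn hε hw hr (-1)
  simp only [one_mul, neg_mul] at h1 h2
  have h2' : IntegrableOn (fun z => stair ε (ψ (-z)) * w (-z)) (Ioo r δ) := by
    simpa only [heven] using h2
  rw [(setIntegral_annulus hr.le hrδ' h1 h2').2]
  have hwi : IntegrableOn w (Ioc r δ) :=
    ((hw.mono fun x hx => hr.trans_le hx.1).integrableOn_compact isCompact_Icc).mono_set
      (Ioc_subset_Icc_self (a := r) (b := δ))
  have hwi' : IntegrableOn w (Ioo r δ) := hwi.mono_set Ioo_subset_Ioc_self
  have hwint : ∀ a b, r ≤ a → a ≤ δ → r ≤ b → b ≤ δ → IntervalIntegrable w volume a b := by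
    intro a b ha ha' hb hb'
    refine ContinuousOn.intervalIntegrable (hw.mono fun x hx => ?_)
    exact lt_of_lt_of_le hr ((le_min ha hb).trans hx.1)
  have hmeas : ∀ f : ℝ → ℝ, Continuous f → ∀ y, MeasurableSet {z | y ≤ f z} ∧
      MeasurableSet {z | y < f z} := fun f hf y =>
    ⟨measurableSet_le measurable_const hf.measurable,
      measurableSet_lt measurable_const hf.measurable⟩
  have hgc : Continuous fun z => -ψ (-z) := (h.cont.comp continuous_neg).neg
  have hii1 : ∀ y, IntegrableOn (fun z => (if y ≤ ψ z then (1:ℝ) else 0) * w z) (Ioo r δ) := by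
    intro y
    refine Integrable.bdd_mul (c := 1) hwi' ?_ ?_
    · exact (Measurable.ite (hmeas ψ h.cont y).1 measurable_const
        measurable_const).aestronglyMeasurable
    · refine ae_of_all _ fun z => ?_
      split_ifs <;> simp
  have hii2 : ∀ y, IntegrableOn (fun z => (if y < -ψ (-z) then (1:ℝ) else 0) * w z)
      (Ioo r δ) := by
    intro y
    refine Integrable.bdd_mul (c := 1) hwi' ?_ ?_
    · exact (Measurable.ite (hmeas _ hgc y).2 measurable_const
        measurable_const).aestronglyMeasurable
    · refine ae_of_all _ fun z => ?_
      split_ifs <;> simp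
  calc ∫ z in Ioo r δ, (stair ε (ψ z) * w z + stair ε (ψ (-z)) * w (-z))
      = ∫ z in Ioo r δ, ∑ k ∈ Finset.range K, ε *
          ((if ((k : ℝ) + 1) * ε ≤ ψ z then (1 : ℝ) else 0) * w z
          - (if ((k : ℝ) + 1) * ε < -ψ (-z) then (1 : ℝ) else 0) * w z) := by
        refine setIntegral_congr_fun measurableSet_Ioo fun z hz => ?_
        have hz' : z ∈ Icc 0 δ := ⟨hr.le.trans hz.1.le, hz.2.le⟩
        have hz0 : 0 < z := hr.trans hz.1
        have hmz := mul_pos h.mpos hz0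
        have hPz : P * z < P * δ := by have := hz.2; gcongr
        have h3 := stair_add_stair_neg (K := K) hε (hmz.le.trans (hf.lower' hz'))
          (hmz.trans_le (hg.lower' hz'))
          (by nlinarith [hf.upper' hz']) (by nlinarith [hg.upper' hz'])
        simp only [neg_neg] at h3
        simp only [heven]
        rw [← add_mul, h3, mul_assoc, Finset.sum_mul, Finset.mul_sum]
        refine Finset.sum_congr rfl fun k _ => ?_
        ring
    _ = ∑ k ∈ Finset.range K, ε * pairForce w ψ δ ((k + 1) * ε) := by
        rw [integral_finsetSum]
        swap
        · exact fun k _ => ((hii1 (((k : ℝ) + 1) * ε)).sub (hii2 (((k : ℝ) + 1) * ε))).const_mul ε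
        refine Finset.sum_congr rfl fun k _ => ?_
        have hy : (0 : ℝ) ≤ ((k : ℝ) + 1) * ε := by positivity
        rw [integral_const_mul, integral_sub (hii1 _) (hii2 _),
          hf.setIntegral_crossed hy hr.le (hcross k _ hf) w
            (fun z => ((k : ℝ) + 1) * ε ≤ ψ z) (fun z hz => hz.le) (fun z hz => hz),
          hg.setIntegral_crossed hy hr.le (hcross k _ hg) w
            (fun z => ((k : ℝ) + 1) * ε < -ψ (-z)) (fun z hz => hz) (fun z hz => hz.le)]
        congr 1
        unfold pairForce
        rw [sub_eq_iff_eq_add, intervalIntegral.integral_add_adjacent_intervals]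
        · exact hwint _ _ (hcross k _ hf).le (hf.cross_mem hy).1.2 (hcross k _ hg).le
            (hg.cross_mem hy).1.2
        · exact hwint _ _ (hcross k _ hg).le (hg.cross_mem hy).1.2 hrδ'.le le_rfl

lemma sub_left_le (h : Tame ψ δ m P L) : ∀ z ∈ Icc 0 δ, |ψ z - -ψ (-z)| ≤ L * z ^ 2 := by
  intro z hz
  rw [sub_neg_eq_add]
  exact h.sym z hz

lemma Lnonneg (h : Tame ψ δ m P L) : 0 ≤ L := by
  have := (abs_nonneg _).trans (h.sym δ ⟨h.pos.le, le_rfl⟩)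
  exact nonneg_of_mul_nonneg_left this (pow_pos h.pos 2)

/-- If the two points differ, the smaller one is below `δ`, so its level is really attained. If
neither half reaches the level, both points are `δ` and the lower bound `y / P` can fail, but such a
pair exerts no force. -/
lemma cross_dichotomy (h : Tame ψ δ m P L) {y : ℝ} (hy : 0 ≤ y) :
    cross ψ δ y = cross (fun z => -ψ (-z)) δ y ∨
    (y / P ≤ cross ψ δ y ∧ y / P ≤ cross (fun z => -ψ (-z)) δ y ∧
      |cross (fun z => -ψ (-z)) δ y - cross ψ δ y| ≤ L * y ^ 2 / m ^ 3) := by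
  rcases lt_trichotomy (cross ψ δ y) (cross (fun z => -ψ (-z)) δ y) with hlt | heq | hlt
  · have h1 := h.biLip_right.cross_sub_cross_le h.biLip_left h.sub_left_le hy hlt
    refine Or.inr ⟨h1.1, h1.1.trans hlt.le, ?_⟩
    rw [abs_of_pos (sub_pos.2 hlt)]
    exact h1.2
  · exact Or.inl heq
  · have h1 := h.biLip_left.cross_sub_cross_le h.biLip_right (L := L)
      (fun z hz => by rw [abs_sub_comm]; exact h.sub_left_le z hz) hy hlt
    refine Or.inr ⟨h1.1.trans hlt.le, h1.1, ?_⟩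
    rw [abs_sub_comm, abs_of_pos (sub_pos.2 hlt)]
    exact h1.2

/-- The interval of integration has length at most `L y²/m³` and starts beyond `y/P`, where the
rescaled kernel is at most `a³ W(ay/P)`. -/
lemma abs_pairForce_le (h : Tame ψ δ m P L) {v W : ℝ → ℝ} (hv : ∀ x, x ≠ 0 → 0 ≤ v x)
    {a y : ℝ} (ha : 0 < a) (hy : 0 < y) (hW : Majorant v W (Icc (a * y / P) (a * δ))) :
    |pairForce (fun z => a ^ 3 * v (a * z)) ψ δ y|
      ≤ a ^ 3 * W (a * y / P) * (L * y ^ 2 / m ^ 3) := by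
  have hP := h.biLip_right.Ppos
  have hm := h.mpos
  have hL := h.Lnonneg
  have hWn : 0 ≤ W (a * y / P) := hW.nonneg _ (by positivity)
  have hc1 := (h.biLip_right.cross_mem hy.le).1
  have hc2 := (h.biLip_left.cross_mem hy.le).1
  unfold pairForce
  rcases h.cross_dichotomy hy.le with heq | ⟨h1, h2, h3⟩
  · rw [heq, intervalIntegral.integral_same, abs_zero]
    positivity
  · have hb : ∀ z ∈ uIoc (cross ψ δ y) (cross (fun z => -ψ (-z)) δ y),
        ‖a ^ 3 * v (a * z)‖ ≤ a ^ 3 * W (a * y / P) := by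
      intro z hz
      have hz1 : y / P ≤ z := by
        have := hz.1.le
        exact (le_min h1 h2).trans this
      have hz2 : z ≤ δ := hz.2.trans (max_le hc1.2 hc2.2)
      have hz0 : 0 < z := lt_of_lt_of_le (by positivity) hz1
      have hle : a * y / P ≤ a * z := by rw [mul_div_assoc]; gcongr
      have hmem : a * z ∈ Icc (a * y / P) (a * δ) := ⟨hle, by gcongr⟩
      rw [Real.norm_of_nonneg (mul_nonneg (by positivity) (hv _ (by positivity)))]
      refine mul_le_mul_of_nonneg_left ((hW.le _ hmem).trans ?_) (by positivity)
      exact hW.anti (show 0 < a * y / P by positivity) (show 0 < a * z by positivity) hle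
    refine (intervalIntegral.norm_integral_le_of_norm_le_const hb).trans ?_
    gcongr

end Tame

/-- On the `k`-th cell `W` is at least its value at the right end, and `∫ x²` over the cell is
`h³((k+1)³ - k³)/3`, where `(k+1)³ - k³ ≥ (k+1)²`. -/
lemma Majorant.term_le {v W : ℝ → ℝ} {s : Set ℝ} (hW : Majorant v W s) {h : ℝ} (hh : 0 < h) (k : ℕ) :
    h ^ 3 * ((k : ℝ) + 1) ^ 2 * W ((k + 1) * h)
      ≤ 3 * ∫ x in (k * h)..((k + 1 : ℕ) * h), x ^ 2 * W x := by
  have hk : (0 : ℝ) ≤ k := Nat.cast_nonneg k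
  have hle : (k * h : ℝ) ≤ (k + 1 : ℕ) * h := by push_cast; nlinarith
  have hWn : 0 ≤ W ((k + 1) * h) := hW.nonneg _ (by positivity)
  have hsub : Ioc (k * h : ℝ) ((k + 1 : ℕ) * h) ⊆ Ioi 0 := fun x hx =>
    lt_of_le_of_lt (by positivity) hx.1
  have hint : ∫ x in (k * h)..((k + 1 : ℕ) * h), x ^ 2 * W ((k + 1) * h)
      = (h ^ 3 * ((k + 1) ^ 3 - k ^ 3) / 3) * W ((k + 1) * h) := by
    rw [intervalIntegral.integral_mul_const, integral_pow]
    push_cast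
    ring
  have h1 : ∫ x in (k * h)..((k + 1 : ℕ) * h), x ^ 2 * W ((k + 1) * h)
      ≤ ∫ x in (k * h)..((k + 1 : ℕ) * h), x ^ 2 * W x := by
    rw [intervalIntegral.integral_of_le hle, intervalIntegral.integral_of_le hle]
    refine setIntegral_mono_on (Continuous.integrableOn_Ioc (by fun_prop))
      (hW.integrable.mono_set hsub) measurableSet_Ioc fun x hx => ?_
    refine mul_le_mul_of_nonneg_left ?_ (sq_nonneg x)
    refine hW.anti (hsub hx) (show (0:ℝ) < (k + 1) * h by positivity) ?_
    simpa using hx.2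
  rw [hint] at h1
  refine le_trans ?_ (mul_le_mul_of_nonneg_left h1 (by norm_num))
  have h2 : h ^ 3 * ((k : ℝ) + 1) ^ 2 ≤ h ^ 3 * ((k + 1) ^ 3 - k ^ 3) := by
    gcongr
    nlinarith
  nlinarith [mul_le_mul_of_nonneg_right h2 hWn]

lemma Majorant.sum_le {v W : ℝ → ℝ} {s : Set ℝ} (hW : Majorant v W s) {h : ℝ} (hh : 0 < h) (K : ℕ) :
    ∑ k ∈ Finset.range K, h ^ 3 * ((k : ℝ) + 1) ^ 2 * W ((k + 1) * h)
      ≤ 3 * ∫ x in Ioi (0 : ℝ), x ^ 2 * W x := by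
  have hii : ∀ k < K, IntervalIntegrable (fun x => x ^ 2 * W x) volume ((k : ℕ) * h)
      ((k + 1 : ℕ) * h) := by
    intro k _
    have hle : (k * h : ℝ) ≤ (k + 1 : ℕ) * h := by push_cast; nlinarith
    rw [intervalIntegrable_iff_integrableOn_Ioc_of_le hle]
    exact hW.integrable.mono_set fun x hx => lt_of_le_of_lt (by positivity) hx.1
  calc ∑ k ∈ Finset.range K, h ^ 3 * ((k : ℝ) + 1) ^ 2 * W ((k + 1) * h)
      ≤ ∑ k ∈ Finset.range K, 3 * ∫ x in (k * h)..((k + 1 : ℕ) * h), x ^ 2 * W x :=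
        Finset.sum_le_sum fun k _ => hW.term_le hh k
    _ = 3 * ∫ x in (0 : ℝ)..(K * h), x ^ 2 * W x := by
        rw [← Finset.mul_sum,
          intervalIntegral.sum_integral_adjacent_intervals (a := fun k : ℕ => (k : ℝ) * h) hii]
        simp
    _ ≤ _ := by
        rw [intervalIntegral.integral_of_le (by positivity)]
        refine mul_le_mul_of_nonneg_left ?_ (by norm_num)
        refine setIntegral_mono_set hW.integrable ?_ Ioc_subset_Ioi_self.eventuallyLE
        exact (ae_restrict_iff' measurableSet_Ioi).2
          (ae_of_all _ fun x hx => mul_nonneg (sq_nonneg x) (hW.nonneg x hx))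

namespace Tame

variable {ψ : ℝ → ℝ} {δ m P L : ℝ}

/-- The scales balance: `a³` from the kernel, `ε` from the jump and `ε²` from the squared level make
`(aε)³ = P³ h³` with `h = aε/P`, which is the form of the Riemann-type sum in `Majorant.sum_le`. -/
lemma abs_term_le (h : Tame ψ δ m P L) {v W : ℝ → ℝ} (hv : ∀ x, x ≠ 0 → 0 ≤ v x)
    {a ε : ℝ} (ha : 0 < a) (hε : 0 < ε) (hW : Majorant v W (Icc (a * ε / P) (a * δ))) (k : ℕ) :
    |ε * pairForce (fun z => a ^ 3 * v (a * z)) ψ δ ((k + 1) * ε)|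
      ≤ L * P ^ 3 / m ^ 3 * ((a * ε / P) ^ 3 * ((k : ℝ) + 1) ^ 2 * W ((k + 1) * (a * ε / P))) := by
  have hP := h.biLip_right.Ppos
  have hm := h.mpos
  have hk : (0 : ℝ) ≤ k := Nat.cast_nonneg k
  have hy : (0 : ℝ) < ((k : ℝ) + 1) * ε := by positivity
  have hle : a * ε / P ≤ a * (((k : ℝ) + 1) * ε) / P := by
    gcongr
    nlinarith
  have h1 := h.abs_pairForce_le hv ha hy (hW.mono (Icc_subset_Icc_left hle))
  rw [abs_mul, abs_of_pos hε]
  refine (mul_le_mul_of_nonneg_left h1 hε.le).trans (le_of_eq ?_)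
  have e : a * (((k : ℝ) + 1) * ε) / P = (k + 1) * (a * ε / P) := by ring
  rw [e]
  field_simp

/-- Uniform in `a`, `ε` and `K`, and depending on the profile only through `L P³/m³`. This makes the
near field small when `m = 1` and controls it at critical points. -/
lemma abs_sum_le (h : Tame ψ δ m P L) {v W : ℝ → ℝ} (hv : ∀ x, x ≠ 0 → 0 ≤ v x)
    {a ε : ℝ} (ha : 0 < a) (hε : 0 < ε) (hW : Majorant v W (Icc (a * ε / P) (a * δ))) (K : ℕ) :
    |∑ k ∈ Finset.range K, ε * pairForce (fun z => a ^ 3 * v (a * z)) ψ δ ((k + 1) * ε)|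
      ≤ L * P ^ 3 / m ^ 3 * (3 * ∫ x in Ioi (0 : ℝ), x ^ 2 * W x) := by
  have hP := h.biLip_right.Ppos
  have hm := h.mpos
  have hL := h.Lnonneg
  refine (Finset.abs_sum_le_sum_abs _ _).trans ?_
  refine (Finset.sum_le_sum fun k _ => h.abs_term_le hv ha hε hW k).trans ?_
  rw [← Finset.mul_sum]
  exact mul_le_mul_of_nonneg_left (hW.sum_le (by positivity) K) (by positivity)

end Tame

/-! ### Convergence of the sum of the pair forces -/

lemma pairForce_eq_zero {ψ : ℝ → ℝ} {δ m P L : ℝ} (h : Tame ψ δ m P L) {w : ℝ → ℝ} {y : ℝ}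
    (hy : P * δ ≤ y) : pairForce w ψ δ y = 0 := by
  have hP := h.biLip_right.Ppos
  have hδ := h.pos
  have hy0 : 0 ≤ y := (mul_pos hP hδ).le.trans hy
  have hmin : min δ (y / P) = δ := min_eq_left (by rwa [le_div_iff₀' hP])
  have e : ∀ f, BiLip f δ m P → cross f δ y = δ := fun f hf =>
    le_antisymm (hf.cross_mem hy0).1.2 (hmin.symm.le.trans (hf.min_le_cross hy0))
  unfold pairForce
  rw [e _ h.biLip_right, e _ h.biLip_left, intervalIntegral.integral_same]

/-- A sequence of increasing profiles with a common second order expansion at the origin. -/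
structure Profiles (ψ : ℕ → ℝ → ℝ) (p : ℕ → ℝ) (p₀ q δ m P L : ℝ) : Prop where
  tame : ∀ᶠ n in atTop, Tame (ψ n) δ m P L
  taylor : ∀ ω > 0, ∃ δ' > 0, ∀ᶠ n in atTop, ∀ z, |z| ≤ δ' →
    |ψ n z - p n * z - q / 2 * z ^ 2| ≤ ω * z ^ 2
  slope : Tendsto p atTop (𝓝 p₀)
  slope_pos : 0 < p₀

namespace Profiles

variable {ψ : ℕ → ℝ → ℝ} {p : ℕ → ℝ} {p₀ q δ m P L : ℝ}

/-- Reflection preserves the slope and reverses the sign of the curvature. -/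
lemma neg (h : Profiles ψ p p₀ q δ m P L) :
    ∀ ω > 0, ∃ δ' > 0, ∀ᶠ n in atTop, ∀ z, |z| ≤ δ' →
    |-ψ n (-z) - p n * z - (-q) / 2 * z ^ 2| ≤ ω * z ^ 2 := by
  intro ω hω
  obtain ⟨δ', hδ', hn⟩ := h.taylor ω hω
  refine ⟨δ', hδ', ?_⟩
  filter_upwards [hn] with n hn z hz
  have := hn (-z) (by rwa [abs_neg])
  rw [neg_sq, ← abs_neg] at this
  convert this using 2
  ring

/-- First order asymptotics of a crossing point. -/
lemma tendsto_cross_aux {f : ℕ → ℝ → ℝ} {q : ℝ} (hf : ∀ᶠ n in atTop, BiLip (f n) δ m P)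
    (htaylor : ∀ ω > 0, ∃ δ' > 0, ∀ᶠ n in atTop, ∀ z, |z| ≤ δ' →
      |f n z - p n * z - q / 2 * z ^ 2| ≤ ω * z ^ 2)
    (hp : Tendsto p atTop (𝓝 p₀)) (hp₀ : 0 < p₀) {a y : ℕ → ℝ} {s : ℝ}
    (ha : Tendsto a atTop atTop) (hy : ∀ᶠ n in atTop, 0 < y n)
    (hs : Tendsto (fun n => a n * y n) atTop (𝓝 s)) :
    Tendsto (fun n => a n * cross (f n) δ (y n)) atTop (𝓝 (s / p₀)) ∧
    (∀ᶠ n in atTop, f n (cross (f n) δ (y n)) = y n) ∧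
    (Tendsto (fun n => cross (f n) δ (y n)) atTop (𝓝 0)) := by
  have hy0 : Tendsto y atTop (𝓝 0) := by
    refine (hs.div_atTop ha).congr' ?_
    filter_upwards [ha.eventually_gt_atTop 0] with n hn
    field_simp
  obtain ⟨n0, hn0⟩ := hf.exists
  have hm := hn0.mpos
  have hδ := hn0.pos
  have hcle : ∀ᶠ n in atTop, 0 ≤ cross (f n) δ (y n) ∧ cross (f n) δ (y n) ≤ y n / m := by
    filter_upwards [hf, hy] with n hfn hyn
    obtain ⟨h1, h2⟩ := hfn.cross_mem hyn.le
    refine ⟨h1.1, ?_⟩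
    rw [le_div_iff₀' hm]
    exact (hfn.lower' h1).trans h2
  have hym : Tendsto (fun n => y n / m) atTop (𝓝 0) := by simpa using hy0.div_const m
  have hc0 : Tendsto (fun n => cross (f n) δ (y n)) atTop (𝓝 0) := by
    refine squeeze_zero' ?_ ?_ hym
    · filter_upwards [hcle] with n hn using hn.1
    · filter_upwards [hcle] with n hn using hn.2
  have heq : ∀ᶠ n in atTop, f n (cross (f n) δ (y n)) = y n := by
    filter_upwards [hf, hy, hc0.eventually_lt_const hδ] with n hfn hyn hc
    exact hfn.cross_eq hyn.le hc
  refine ⟨?_, heq, hc0⟩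
  obtain ⟨δ', hδ', hT⟩ := htaylor 1 one_pos
  -- The quadratic remainder at the crossing point is `O(y²)`; multiplied by `a` it becomes `(a y)
  -- y`, and `a y` converges while `y → 0`.
  have herr : Tendsto (fun n => p n * (a n * cross (f n) δ (y n)) - a n * y n) atTop (𝓝 0) := by
    have hlim : Tendsto (fun n => (|q| / 2 + 1) / m ^ 2 * ((a n * y n) * y n)) atTop (𝓝 0) := by
      simpa using (hs.mul hy0).const_mul ((|q| / 2 + 1) / m ^ 2)
    refine squeeze_zero_norm' ?_ hlim
    filter_upwards [hcle, heq, hT, hc0.eventually_le_const hδ', ha.eventually_gt_atTop 0, hy]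
      with n hc he hTn hcδ han hyn
    set c := cross (f n) δ (y n)
    have h1 := hTn c (by rwa [abs_of_nonneg hc.1])
    rw [he, one_mul] at h1
    have h2 : |p n * c - y n| ≤ (|q| / 2 + 1) * c ^ 2 := by
      have : p n * c - y n = -(y n - p n * c - q / 2 * c ^ 2) - q / 2 * c ^ 2 := by ring
      rw [this]
      refine (abs_sub _ _).trans ?_
      rw [abs_neg, abs_mul, abs_div, abs_two, abs_of_nonneg (sq_nonneg c)]
      linarith
    have h3 : c ^ 2 ≤ (y n / m) ^ 2 := by
      have := hc.1
      gcongr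
      exact hc.2
    have e : p n * (a n * c) - a n * y n = a n * (p n * c - y n) := by ring
    rw [e, norm_mul, Real.norm_of_nonneg han.le, Real.norm_eq_abs]
    calc a n * |p n * c - y n| ≤ a n * ((|q| / 2 + 1) * (y n / m) ^ 2) := by
          refine mul_le_mul_of_nonneg_left (h2.trans ?_) han.le
          gcongr
      _ = _ := by field_simp
  have h4 : Tendsto (fun n => p n * (a n * cross (f n) δ (y n))) atTop (𝓝 s) := by
    have := herr.add hs
    simpa using this
  refine (h4.div hp hp₀.ne').congr' ?_
  filter_upwards [hp.eventually_const_lt hp₀] with n hn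
  simp only [Pi.div_apply]
  field_simp

/-- Asymptotics of the force of a pair of particles at a macroscopic (scaled) distance. -/
lemma tendsto_pairForce (h : Profiles ψ p p₀ q δ m P L) {v : ℝ → ℝ}
    (hv : ContinuousOn v (Ioi 0)) {a y : ℕ → ℝ} {s : ℝ} (hs0 : 0 < s)
    (ha : Tendsto a atTop atTop) (hy : ∀ᶠ n in atTop, 0 < y n)
    (hs : Tendsto (fun n => a n * y n) atTop (𝓝 s)) :
    Tendsto (fun n => pairForce (fun z => a n ^ 3 * v (a n * z)) (ψ n) δ (y n) / a n) atTop
      (𝓝 (q * s ^ 2 / p₀ ^ 3 * v (s / p₀))) := by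
  have hp₀ := h.slope_pos
  obtain ⟨hf1, hf2, hf3⟩ := tendsto_cross_aux (h.tame.mono fun n hn => hn.biLip_right) h.taylor
    h.slope h.slope_pos ha hy hs
  obtain ⟨hg1, hg2, hg3⟩ := tendsto_cross_aux (f := fun n z => -ψ n (-z))
    (h.tame.mono fun n hn => hn.biLip_left) h.neg h.slope h.slope_pos ha hy hs
  set c : ℕ → ℝ := fun n => cross (ψ n) δ (y n) with hc
  set d : ℕ → ℝ := fun n => cross (fun z => -ψ n (-z)) δ (y n) with hd
  have hc_nonneg : ∀ᶠ n in atTop, 0 ≤ c n := by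
    filter_upwards [h.tame, hy] with n hn hyn using (hn.biLip_right.cross_mem hyn.le).1.1
  have hd_nonneg : ∀ᶠ n in atTop, 0 ≤ d n := by
    filter_upwards [h.tame, hy] with n hn hyn using (hn.biLip_left.cross_mem hyn.le).1.1
  have hsq : Tendsto (fun n => (a n * c n) ^ 2 + (a n * d n) ^ 2) atTop
      (𝓝 ((s / p₀) ^ 2 + (s / p₀) ^ 2)) := (hf1.pow 2).add (hg1.pow 2)
  -- Both halves of the profile equal `y` at their crossing points. Subtracting the two expansions
  -- cancels `y` and leaves `p (d - c) = (q/2)(c² + d²)` up to a small multiple of `c² + d²`.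
  have hD : Tendsto (fun n => a n ^ 2 * (p n * (d n - c n) - q / 2 * (c n ^ 2 + d n ^ 2))) atTop
      (𝓝 0) := by
    rw [Metric.tendsto_nhds]
    intro η hη
    set B := (s / p₀) ^ 2 + (s / p₀) ^ 2 + 1 with hB
    have hBpos : 0 < B := by positivity
    obtain ⟨δ₁, hδ₁, hT1⟩ := h.taylor (η / (2 * B)) (by positivity)
    obtain ⟨δ₂, hδ₂, hT2⟩ := h.neg (η / (2 * B)) (by positivity)
    filter_upwards [hT1, hT2, hf2, hg2, hc_nonneg, hd_nonneg, hf3.eventually_le_const hδ₁,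
      hg3.eventually_le_const hδ₂, hsq.eventually_le_const (show _ < B by rw [hB]; linarith)]
      with n h1 h2 h3 h4 h5 h6 h7 h8 h9
    have h1' := h1 (c n) (by rwa [abs_of_nonneg h5])
    have h2' := h2 (d n) (by rwa [abs_of_nonneg h6])
    rw [h3] at h1'
    rw [h4] at h2'
    rw [dist_zero_right, norm_mul, Real.norm_of_nonneg (sq_nonneg _), Real.norm_eq_abs]
    have e : p n * (d n - c n) - q / 2 * (c n ^ 2 + d n ^ 2)
        = (y n - p n * c n - q / 2 * c n ^ 2) - (y n - p n * d n - (-q) / 2 * d n ^ 2) := by ring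
    have h10 : |p n * (d n - c n) - q / 2 * (c n ^ 2 + d n ^ 2)|
        ≤ η / (2 * B) * (c n ^ 2 + d n ^ 2) := by
      rw [e]
      refine (abs_sub _ _).trans ?_
      linarith
    calc a n ^ 2 * |p n * (d n - c n) - q / 2 * (c n ^ 2 + d n ^ 2)|
        ≤ a n ^ 2 * (η / (2 * B) * (c n ^ 2 + d n ^ 2)) := by gcongr
      _ = η / (2 * B) * ((a n * c n) ^ 2 + (a n * d n) ^ 2) := by ring
      _ ≤ η / (2 * B) * B := by gcongr
      _ = η / 2 := by field_simp
      _ < η := by linarith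
  have hgap : Tendsto (fun n => a n ^ 2 * (d n - c n)) atTop (𝓝 (q * s ^ 2 / p₀ ^ 3)) := by
    have h1 : Tendsto (fun n => p n * (a n ^ 2 * (d n - c n))) atTop (𝓝 (q * s ^ 2 / p₀ ^ 2)) := by
      have h2 := hD.add (hsq.const_mul (q / 2))
      have e : 0 + q / 2 * ((s / p₀) ^ 2 + (s / p₀) ^ 2) = q * s ^ 2 / p₀ ^ 2 := by
        field_simp
        ring
      rw [e] at h2
      refine h2.congr fun n => ?_
      ring
    have h2 := h1.div h.slope hp₀.ne'
    have e : q * s ^ 2 / p₀ ^ 2 / p₀ = q * s ^ 2 / p₀ ^ 3 := by field_simp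
    rw [e] at h2
    refine h2.congr' ?_
    filter_upwards [h.slope.eventually_const_lt hp₀] with n hn
    simp only [Pi.div_apply]
    field_simp
  have hσ : 0 < s / p₀ := by positivity
  have hvc : ContinuousAt v (s / p₀) := hv.continuousAt (Ioi_mem_nhds hσ)
  have herr : Tendsto (fun n => pairForce (fun z => a n ^ 3 * v (a n * z)) (ψ n) δ (y n) / a n
      - a n ^ 2 * (d n - c n) * v (s / p₀)) atTop (𝓝 0) := by
    rw [Metric.tendsto_nhds]
    intro η hη
    set B := |q * s ^ 2 / p₀ ^ 3| + 1 with hB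
    have hBpos : 0 < B := by positivity
    obtain ⟨r, hr, hball⟩ := Metric.continuousAt_iff.1 hvc (η / (2 * B)) (by positivity)
    -- The second bound keeps `a z` positive, that is, inside the domain where `v` is continuous.
    set r' := min r (s / p₀) with hr'
    have hr'pos : 0 < r' := lt_min hr hσ
    filter_upwards [ha.eventually_gt_atTop 0, Metric.tendsto_nhds.1 hf1 r' hr'pos,
      Metric.tendsto_nhds.1 hg1 r' hr'pos,
      (hgap.abs).eventually_le_const (show _ < B by rw [hB]; linarith)] with n han h1 h2 h3
    have hbtw : ∀ z ∈ uIcc (c n) (d n), |a n * z - s / p₀| < r' := by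
      intro z hz
      rw [Real.dist_eq, abs_lt] at h1 h2
      rcases le_total (c n) (d n) with hcd | hcd
      · rw [uIcc_of_le hcd] at hz
        have := mul_le_mul_of_nonneg_left hz.1 han.le
        have := mul_le_mul_of_nonneg_left hz.2 han.le
        rw [abs_lt]; constructor <;> linarith
      · rw [uIcc_of_ge hcd] at hz
        have := mul_le_mul_of_nonneg_left hz.1 han.le
        have := mul_le_mul_of_nonneg_left hz.2 han.le
        rw [abs_lt]; constructor <;> linarith
    have hpos : ∀ z ∈ uIcc (c n) (d n), 0 < a n * z := by
      intro z hz
      have := (abs_lt.1 (hbtw z hz)).1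
      have := min_le_right r (s / p₀)
      linarith
    have hii : IntervalIntegrable (fun z => v (a n * z)) volume (c n) (d n) :=
      ContinuousOn.intervalIntegrable (hv.comp (by fun_prop) fun z hz => hpos z hz)
    have e : pairForce (fun z => a n ^ 3 * v (a n * z)) (ψ n) δ (y n) / a n
        - a n ^ 2 * (d n - c n) * v (s / p₀)
        = a n ^ 2 * ∫ z in (c n)..(d n), (v (a n * z) - v (s / p₀)) := by
      rw [intervalIntegral.integral_sub hii (by simp), intervalIntegral.integral_const]
      unfold pairForce
      rw [intervalIntegral.integral_const_mul]
      simp only [smul_eq_mul]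
      field_simp
      rfl
    have hle : ‖∫ z in (c n)..(d n), (v (a n * z) - v (s / p₀))‖ ≤ η / (2 * B) * |d n - c n| := by
      refine intervalIntegral.norm_integral_le_of_norm_le_const fun z hz => ?_
      have := hball (x := a n * z) (by
        rw [Real.dist_eq]
        exact (hbtw z (uIoc_subset_uIcc hz)).trans_le (min_le_left _ _))
      rw [Real.dist_eq] at this
      exact this.le
    rw [dist_zero_right, e, norm_mul, Real.norm_of_nonneg (sq_nonneg (a n))]
    rw [abs_mul, abs_of_nonneg (sq_nonneg (a n))] at h3
    calc a n ^ 2 * ‖∫ z in (c n)..(d n), (v (a n * z) - v (s / p₀))‖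
        ≤ a n ^ 2 * (η / (2 * B) * |d n - c n|) := by gcongr
      _ = η / (2 * B) * (a n ^ 2 * |d n - c n|) := by ring
      _ ≤ η / (2 * B) * B := by gcongr
      _ = η / 2 := by field_simp
      _ < η := by linarith
  have := herr.add (hgap.mul_const (v (s / p₀)))
  simpa using this

/-- Since `aε → β > 0`, each level contributes in the limit, at scaled distance `(k+1)β/p₀`, and the
terms are dominated through `W` evaluated on a fixed grid. -/
lemma tendsto_sum_three (h : Profiles ψ p p₀ q δ m P L) {v : ℝ → ℝ}
    (hv : ContinuousOn v (Ioi 0)) (hv0 : ∀ x, x ≠ 0 → 0 ≤ v x)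
    (hmaj : ∀ c > 0, ∃ W, Majorant v W (Ici c)) {a ε : ℕ → ℝ} {β : ℝ} (hβ : 0 < β)
    (ha : Tendsto a atTop atTop) (hε : ∀ᶠ n in atTop, 0 < ε n)
    (hη : Tendsto (fun n => ε n * a n) atTop (𝓝 β)) {K : ℕ → ℕ}
    (hK : ∀ᶠ n in atTop, P * δ ≤ K n * ε n) :
    Tendsto (fun n => ∑ k ∈ Finset.range (K n),
      ε n * pairForce (fun z => a n ^ 3 * v (a n * z)) (ψ n) δ ((k + 1) * ε n)) atTop
      (𝓝 (q * β ^ 3 / p₀ ^ 3 * ∑' k : ℕ, ((k : ℝ) + 1) ^ 2 * v (((k : ℝ) + 1) * (β / p₀)))) := by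
  obtain ⟨n0, hn0⟩ := h.tame.exists
  have hP := hn0.biLip_right.Ppos
  have hm := hn0.mpos
  have hL := hn0.Lnonneg
  have hp₀ := h.slope_pos
  -- Eventually `aε ≥ β/2`, so all scaled distances exceed multiples of this mesh, on which `W` is
  -- summable against `(k+1)²`.
  set c := β / 2 / P with hc
  have hcpos : 0 < c := by positivity
  obtain ⟨W, hW⟩ := hmaj c hcpos
  have hlim : Tendsto (fun n => ∑' k : ℕ,
      ε n * pairForce (fun z => a n ^ 3 * v (a n * z)) (ψ n) δ ((k + 1) * ε n)) atTop
      (𝓝 (∑' k : ℕ, β * (q * (((k : ℝ) + 1) * β) ^ 2 / p₀ ^ 3 * v ((((k : ℝ) + 1) * β) / p₀)))) := by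
    refine tendsto_tsum_of_dominated_convergence
      (bound := fun k : ℕ => L * P ^ 3 / m ^ 3 * ((2 * β / P) ^ 3 / c ^ 3)
        * (c ^ 3 * ((k : ℝ) + 1) ^ 2 * W ((k + 1) * c))) ?_ ?_ ?_
    · refine Summable.mul_left _ ?_
      refine summable_of_sum_range_le (c := 3 * ∫ x in Ioi (0 : ℝ), x ^ 2 * W x) (fun k => ?_)
        (fun n => hW.sum_le hcpos n)
      exact mul_nonneg (by positivity) (hW.nonneg _ (by positivity))
    · intro k
      have h1 : Tendsto (fun n => a n * (((k : ℝ) + 1) * ε n)) atTop (𝓝 (((k : ℝ) + 1) * β)) := by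
        refine (hη.const_mul ((k : ℝ) + 1)).congr fun n => ?_
        ring
      have h2 := h.tendsto_pairForce hv (s := ((k : ℝ) + 1) * β) (by positivity) ha
        (hε.mono fun n hn => by positivity) h1
      refine (hη.mul h2).congr' ?_
      filter_upwards [ha.eventually_gt_atTop 0] with n hn
      field_simp
    · filter_upwards [h.tame, hε, ha.eventually_gt_atTop 0,
        hη.eventually_const_le (show β / 2 < β by linarith),
        hη.eventually_le_const (show β < 2 * β by linarith)] with n hT hεn han h1 h2 k
      have hcle : c ≤ a n * ε n / P := by rw [hc, mul_comm (a n)]; gcongr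
      have hle2 : a n * ε n / P ≤ 2 * β / P := by rw [mul_comm (a n)]; gcongr
      have h3 := hT.abs_term_le hv0 han hεn
        (hW.mono fun x hx => hcle.trans hx.1) k
      rw [Real.norm_eq_abs]
      refine h3.trans ?_
      have hWle : W ((k + 1) * (a n * ε n / P)) ≤ W ((k + 1) * c) := by
        refine hW.anti (show (0:ℝ) < (k + 1) * c by positivity)
          (show (0:ℝ) < (k + 1) * (a n * ε n / P) by positivity) ?_
        gcongr
      have hWn : 0 ≤ W ((k + 1) * (a n * ε n / P)) := hW.nonneg _ (by positivity)
      calc L * P ^ 3 / m ^ 3 * ((a n * ε n / P) ^ 3 * ((k : ℝ) + 1) ^ 2 * W ((k + 1) * (a n * ε n / P)))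
          ≤ L * P ^ 3 / m ^ 3 * ((2 * β / P) ^ 3 * ((k : ℝ) + 1) ^ 2 * W ((k + 1) * c)) := by gcongr
        _ = _ := by field_simp
  have e : (∑' k : ℕ, β * (q * (((k : ℝ) + 1) * β) ^ 2 / p₀ ^ 3 * v ((((k : ℝ) + 1) * β) / p₀)))
      = q * β ^ 3 / p₀ ^ 3 * ∑' k : ℕ, ((k : ℝ) + 1) ^ 2 * v (((k : ℝ) + 1) * (β / p₀)) := by
    rw [← tsum_mul_left]
    refine tsum_congr fun k => ?_
    rw [mul_div_assoc ((k : ℝ) + 1)]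
    ring
  rw [e] at hlim
  -- The finite sum is the whole series: levels above `P δ` are not reached and exert no force.
  refine hlim.congr' ?_
  filter_upwards [h.tame, hK, hε] with n hT hKn hεn
  refine tsum_eq_sum fun k hk => ?_
  rw [pairForce_eq_zero hT, mul_zero]
  have : (K n : ℝ) ≤ k := by
    rw [Finset.mem_range, not_lt] at hk
    exact_mod_cast hk
  nlinarith

/-- The weight has integral one over each cell. A piecewise constant weight `1/η` would also
represent the sum, but the factor `s²` is what gives a bound by a multiple of `s² W(s/P)` down to `s
= 0`, including on the first cell. -/
lemma integral_step {c : ℕ → ℝ} {η : ℝ} (hη : 0 < η) {K : ℕ} (hc : ∀ k, K ≤ k → c k = 0) :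
    ∫ s in Ioi (0 : ℝ), c (⌈s / η⌉₊ - 1) * (3 * s ^ 2 / (η ^ 3 *
        (((⌈s / η⌉₊ - 1 : ℕ) + 1 : ℝ) ^ 3 - ((⌈s / η⌉₊ - 1 : ℕ) : ℝ) ^ 3)))
      = ∑ k ∈ Finset.range K, c k := by
  set F : ℝ → ℝ := fun s => c (⌈s / η⌉₊ - 1) * (3 * s ^ 2 / (η ^ 3 *
        (((⌈s / η⌉₊ - 1 : ℕ) + 1 : ℝ) ^ 3 - ((⌈s / η⌉₊ - 1 : ℕ) : ℝ) ^ 3))) with hF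
  have hceil : ∀ k : ℕ, ∀ s ∈ Ioc (k * η : ℝ) ((k + 1 : ℕ) * η), ⌈s / η⌉₊ - 1 = k := by
    intro k s hs
    have : ⌈s / η⌉₊ = k + 1 := by
      rw [Nat.ceil_eq_iff (by omega)]
      simp only [Nat.add_sub_cancel]
      exact ⟨by rw [lt_div_iff₀ hη]; exact hs.1, by rw [div_le_iff₀ hη]; exact hs.2⟩
    omega
  have hval : ∀ k : ℕ, ∀ s ∈ Ioc (k * η : ℝ) ((k + 1 : ℕ) * η),
      F s = c k * (3 / (η ^ 3 * (((k : ℝ) + 1) ^ 3 - (k : ℝ) ^ 3))) * s ^ 2 := by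
    intro k s hs
    simp only [hF, hceil k s hs]
    ring
  have hle : ∀ k : ℕ, (k * η : ℝ) ≤ (k + 1 : ℕ) * η := fun k => by push_cast; nlinarith
  have hii : ∀ k < K, IntervalIntegrable F volume ((k : ℕ) * η) ((k + 1 : ℕ) * η) := by
    intro k _
    rw [intervalIntegrable_iff_integrableOn_Ioc_of_le (hle k)]
    refine IntegrableOn.congr_fun ?_ (fun s hs => (hval k s hs).symm) measurableSet_Ioc
    exact Continuous.integrableOn_Ioc (by fun_prop)
  have hpiece : ∀ k : ℕ, ∫ s in (k * η : ℝ)..((k + 1 : ℕ) * η), F s = c k := by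
    intro k
    have h3 : (0 : ℝ) < (k + 1) ^ 3 - k ^ 3 := by
      have : (0 : ℝ) ≤ k := Nat.cast_nonneg k
      nlinarith
    rw [intervalIntegral.integral_of_le (hle k), setIntegral_congr_fun measurableSet_Ioc (hval k),
      ← intervalIntegral.integral_of_le (hle k), intervalIntegral.integral_const_mul, integral_pow]
    push_cast
    have e : ((k + 1 : ℝ) * η) ^ (2 + 1) - (k * η : ℝ) ^ (2 + 1)
        = η ^ 3 * ((k + 1) ^ 3 - k ^ 3) := by ring
    rw [e]
    field_simp
    norm_num
  have h1 : ∫ s in Ioi (0 : ℝ), F s = ∫ s in Ioc (0 : ℝ) (K * η), F s := by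
    refine setIntegral_eq_of_subset_of_forall_sdiff_eq_zero measurableSet_Ioi
      Ioc_subset_Ioi_self fun s hs => ?_
    have hs1 : K * η < s := by
      by_contra hcon
      exact hs.2 ⟨hs.1, not_lt.1 hcon⟩
    have : K < ⌈s / η⌉₊ := by
      rw [Nat.lt_ceil, lt_div_iff₀ hη]
      exact hs1
    simp only [hF]
    rw [hc _ (by omega), zero_mul]
  rw [h1, ← intervalIntegral.integral_of_le (by positivity)]
  have h2 := intervalIntegral.sum_integral_adjacent_intervals (μ := volume)
    (a := fun k : ℕ => (k : ℝ) * η) hii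
  simp only [Nat.cast_zero, zero_mul] at h2
  rw [← h2]
  exact Finset.sum_congr rfl fun k _ => hpiece k

/-- Since `aε → 0`, the scaled levels `s = (k+1)εa` fill the half-line. Written as an integral by
`integral_step`, the sum converges by dominated convergence; every pointwise limit comes from
`tendsto_pairForce`. -/
lemma tendsto_sum_two (h : Profiles ψ p p₀ q δ m P L) {v W : ℝ → ℝ}
    (hv : ContinuousOn v (Ioi 0)) (hv0 : ∀ x, x ≠ 0 → 0 ≤ v x)
    (hW : Majorant v W (Ioi 0)) {a ε : ℕ → ℝ}
    (ha : Tendsto a atTop atTop) (hε : ∀ᶠ n in atTop, 0 < ε n)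
    (hη : Tendsto (fun n => ε n * a n) atTop (𝓝 0)) {K : ℕ → ℕ}
    (hK : ∀ᶠ n in atTop, P * δ ≤ K n * ε n) :
    Tendsto (fun n => ∑ k ∈ Finset.range (K n),
      ε n * pairForce (fun z => a n ^ 3 * v (a n * z)) (ψ n) δ ((k + 1) * ε n)) atTop
      (𝓝 (q * ∫ x in Ioi (0 : ℝ), x ^ 2 * v x)) := by
  obtain ⟨n0, hn0⟩ := h.tame.exists
  have hP := hn0.biLip_right.Ppos
  have hm := hn0.mpos
  have hL := hn0.Lnonneg
  have hp₀ := h.slope_pos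
  set c : ℕ → ℕ → ℝ := fun n k =>
    ε n * pairForce (fun z => a n ^ 3 * v (a n * z)) (ψ n) δ ((k + 1) * ε n) with hc
  set η : ℕ → ℝ := fun n => ε n * a n with hηdef
  set kk : ℕ → ℝ → ℕ := fun n s => ⌈s / η n⌉₊ - 1 with hkk
  set G : ℕ → ℝ → ℝ := fun n s => c n (kk n s) * (3 * s ^ 2 / (η n ^ 3 *
        (((kk n s : ℕ) + 1 : ℝ) ^ 3 - ((kk n s : ℕ) : ℝ) ^ 3))) with hG
  have hηpos : ∀ᶠ n in atTop, 0 < η n := by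
    filter_upwards [hε, ha.eventually_gt_atTop 0] with n h1 h2 using mul_pos h1 h2
  have hkk1 : ∀ n s, 0 < η n → 0 < s → s ≤ ((kk n s : ℕ) + 1 : ℝ) * η n ∧
      ((kk n s : ℕ) : ℝ) * η n < s := by
    intro n s hn hs
    have h1 : 0 < ⌈s / η n⌉₊ := Nat.ceil_pos.2 (by positivity)
    have h2 : ((kk n s : ℕ) + 1 : ℝ) = (⌈s / η n⌉₊ : ℝ) := by
      simp only [hkk]
      rw [Nat.cast_sub h1]
      simp
    have h3 := Nat.le_ceil (s / η n)
    have h4 := Nat.ceil_lt_add_one (show 0 ≤ s / η n by positivity)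
    rw [← h2] at h3 h4
    rw [div_le_iff₀ hn] at h3
    have h5 : ((kk n s : ℕ) : ℝ) < s / η n := by linarith
    rw [lt_div_iff₀ hn] at h5
    exact ⟨h3, h5⟩
  have hlim : Tendsto (fun n => ∫ s in Ioi (0 : ℝ), G n s) atTop
      (𝓝 (∫ s in Ioi (0 : ℝ), q * s ^ 2 / p₀ ^ 3 * v (s / p₀))) := by
    refine tendsto_integral_filter_of_dominated_convergence
      (fun s => 3 * L / m ^ 3 * P ^ 2 * ((P⁻¹ * s) ^ 2 * W (P⁻¹ * s))) ?_ ?_ ?_ ?_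
    · refine Eventually.of_forall fun n => ?_
      refine Measurable.aestronglyMeasurable ?_
      have hkm : Measurable (kk n) := by
        have h1 : Measurable fun s : ℝ => ⌈s / η n⌉₊ :=
          Nat.measurable_ceil.comp (measurable_id.div_const _)
        exact (measurable_from_top (f := fun k : ℕ => k - 1)).comp h1
      have h2 : Measurable fun s => c n (kk n s) := (measurable_from_top (f := c n)).comp hkm
      have h3 : Measurable fun s => ((kk n s : ℕ) : ℝ) := measurable_from_top.comp hkm
      exact h2.mul (((measurable_id.pow_const 2).const_mul 3).div
        ((((h3.add_const 1).pow_const 3).sub (h3.pow_const 3)).const_mul _))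
    · filter_upwards [h.tame, hε, ha.eventually_gt_atTop 0, hηpos] with n hT hεn han hηn
      refine (ae_restrict_iff' measurableSet_Ioi).2 (ae_of_all _ fun s hs => ?_)
      have hs0 : 0 < s := hs
      obtain ⟨h1, h2⟩ := hkk1 n s hηn hs0
      set k := kk n s
      have hk0 : (0 : ℝ) ≤ k := Nat.cast_nonneg k
      have h3 := hT.abs_term_le hv0 han hεn (hW.mono fun x hx =>
        show 0 < x from lt_of_lt_of_le (by positivity) hx.1) k
      have hη' : a n * ε n / P = η n / P := by rw [hηdef]; ring
      rw [hη'] at h3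
      have hWle : W ((k + 1) * (η n / P)) ≤ W (P⁻¹ * s) := by
        refine hW.anti (show 0 < P⁻¹ * s by positivity)
          (show (0:ℝ) < (k + 1) * (η n / P) by positivity) ?_
        rw [← mul_div_assoc, div_eq_inv_mul]
        gcongr
      have hWn : 0 ≤ W ((k + 1) * (η n / P)) := hW.nonneg _ (by positivity)
      have hden : ((k : ℝ) + 1) ^ 2 ≤ ((k : ℝ) + 1) ^ 3 - (k : ℝ) ^ 3 := by nlinarith
      have hden0 : (0 : ℝ) < ((k : ℝ) + 1) ^ 2 := by positivity
      have hden1 := hden0.trans_le hden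
      simp only [hG]
      rw [norm_mul, Real.norm_eq_abs, Real.norm_eq_abs,
        abs_of_nonneg (show 0 ≤ 3 * s ^ 2 / (η n ^ 3 * (((k : ℝ) + 1) ^ 3 - (k : ℝ) ^ 3)) by
          positivity)]
      calc |c n k| * (3 * s ^ 2 / (η n ^ 3 * (((k : ℝ) + 1) ^ 3 - (k : ℝ) ^ 3)))
          ≤ (L * P ^ 3 / m ^ 3 * ((η n / P) ^ 3 * ((k : ℝ) + 1) ^ 2 * W (P⁻¹ * s)))
            * (3 * s ^ 2 / (η n ^ 3 * ((k : ℝ) + 1) ^ 2)) := by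
            refine mul_le_mul (h3.trans ?_) ?_ (by positivity) ?_
            · gcongr
            · gcongr
            · have := hWn.trans hWle
              positivity
        _ = _ := by field_simp
    · refine Integrable.const_mul ?_ _
      have := (integrableOn_Ioi_comp_mul_left_iff (fun s => s ^ 2 * W s) 0
        (show 0 < P⁻¹ by positivity)).2
      simp only [mul_zero] at this
      exact this hW.integrable
    · refine (ae_restrict_iff' measurableSet_Ioi).2 (ae_of_all _ fun s hs => ?_)
      have hs0 : 0 < s := hs
      have hup : Tendsto (fun n => ((kk n s : ℕ) + 1 : ℝ) * η n) atTop (𝓝 s) := by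
        have h0 : Tendsto (fun n => s + η n) atTop (𝓝 s) := by
          simpa using hη.const_add s
        refine tendsto_of_tendsto_of_tendsto_of_le_of_le' tendsto_const_nhds h0 ?_ ?_
        · filter_upwards [hηpos] with n hn using (hkk1 n s hn hs0).1
        · filter_upwards [hηpos] with n hn
          have := (hkk1 n s hn hs0).2
          nlinarith
      have hlow : Tendsto (fun n => ((kk n s : ℕ) : ℝ) * η n) atTop (𝓝 s) := by
        have := hup.sub hη
        simp only [sub_zero] at this
        refine this.congr fun n => ?_
        simp only [hηdef]
        ring
      have h1 : Tendsto (fun n => a n * (((kk n s : ℕ) + 1 : ℝ) * ε n)) atTop (𝓝 s) := by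
        refine hup.congr fun n => ?_
        simp only [hηdef]
        ring
      have h2 := h.tendsto_pairForce hv hs0 ha (hε.mono fun n hn => by positivity) h1
      -- Both ends of the cell containing `s` converge to `s`, so `η³((k+1)³ - k³)/η` tends to `3s²`
      -- and the weight, multiplied by `η`, to one.
      have h3 : Tendsto (fun n => (((kk n s : ℕ) + 1 : ℝ) * η n) ^ 2
          + (((kk n s : ℕ) + 1 : ℝ) * η n) * (((kk n s : ℕ) : ℝ) * η n)
          + (((kk n s : ℕ) : ℝ) * η n) ^ 2) atTop (𝓝 (s ^ 2 + s * s + s ^ 2)) :=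
        ((hup.pow 2).add (hup.mul hlow)).add (hlow.pow 2)
      have h4 := h2.mul ((tendsto_const_nhds (x := 3 * s ^ 2)).div h3 (by positivity))
      have e : q * s ^ 2 / p₀ ^ 3 * v (s / p₀) * (3 * s ^ 2 / (s ^ 2 + s * s + s ^ 2))
          = q * s ^ 2 / p₀ ^ 3 * v (s / p₀) := by
        have : 3 * s ^ 2 / (s ^ 2 + s * s + s ^ 2) = 1 := by
          rw [div_eq_one_iff_eq (by positivity)]
          ring
        rw [this, mul_one]
      rw [e] at h4
      refine h4.congr' ?_
      filter_upwards [hηpos, ha.eventually_gt_atTop 0, hε] with n hn han hεn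
      have e1 : ((kk n s : ℕ) + 1 : ℝ) ^ 3 - ((kk n s : ℕ) : ℝ) ^ 3
          = ((kk n s : ℕ) + 1 : ℝ) ^ 2 + ((kk n s : ℕ) + 1 : ℝ) * ((kk n s : ℕ) : ℝ)
            + ((kk n s : ℕ) : ℝ) ^ 2 := by ring
      have e2 : (0:ℝ) < ((kk n s : ℕ) + 1 : ℝ) ^ 2 + ((kk n s : ℕ) + 1 : ℝ) * ((kk n s : ℕ) : ℝ)
            + ((kk n s : ℕ) : ℝ) ^ 2 := by positivity
      have e3 : (((kk n s : ℕ) + 1 : ℝ) * η n) ^ 2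
          + (((kk n s : ℕ) + 1 : ℝ) * η n) * (((kk n s : ℕ) : ℝ) * η n)
          + (((kk n s : ℕ) : ℝ) * η n) ^ 2 = η n ^ 2 * (((kk n s : ℕ) + 1 : ℝ) ^ 2
            + ((kk n s : ℕ) + 1 : ℝ) * ((kk n s : ℕ) : ℝ) + ((kk n s : ℕ) : ℝ) ^ 2) := by ring
      simp only [hG, Pi.div_apply, e1, e3, hc]
      have e4 : η n = ε n * a n := rfl
      have han' := han.ne'
      have hεn' := hεn.ne'
      rw [e4]
      field_simp
  -- After the substitution `x = s / p₀` the slope disappears; this is why `f₂` is linear in `|y|`.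
  have e : ∫ s in Ioi (0 : ℝ), q * s ^ 2 / p₀ ^ 3 * v (s / p₀)
      = q * ∫ x in Ioi (0 : ℝ), x ^ 2 * v x := by
    have h1 := integral_comp_mul_left_Ioi (fun x => x ^ 2 * v x) 0 (inv_pos.2 hp₀)
    simp only [mul_zero, inv_inv, smul_eq_mul] at h1
    have h2 : ∀ s : ℝ, q * s ^ 2 / p₀ ^ 3 * v (s / p₀)
        = q / p₀ * ((p₀⁻¹ * s) ^ 2 * v (p₀⁻¹ * s)) := by
      intro s
      rw [div_eq_inv_mul s]
      field_simp
    simp_rw [h2]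
    rw [integral_const_mul, h1]
    field_simp
  rw [e] at hlim
  refine hlim.congr' ?_
  filter_upwards [h.tame, hK, hηpos, hε] with n hT hKn hn hεn
  refine integral_step (c := c n) hn fun k hk => ?_
  simp only [hc]
  rw [pairForce_eq_zero hT, mul_zero]
  have : (K n : ℝ) ≤ k := by exact_mod_cast hk
  nlinarith

end Profiles

/-! ### Integrability with respect to an interaction kernel -/

namespace RepKernel

variable {w : ℝ → ℝ}

lemma comp_abs (hw : RepKernel w) (z : ℝ) : w |z| = w z := by
  rcases abs_choice z with h | h <;> rw [h]
  exact hw.even z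

lemma integrable_min (hw : RepKernel w) : Integrable (fun z => min (z ^ 2) 1 * w z) := by
  have h1 : IntegrableOn (fun z => min (z ^ 2) 1 * w z) (Iic 0) := by
    have h2 := (integrableOn_Ici_iff_integrableOn_Ioi
      (f := fun z => min (z ^ 2) 1 * w z) (b := (0 : ℝ))).2 hw.integrable
    have h3 := (Measure.measurePreserving_neg (volume : Measure ℝ)).integrableOn_comp_preimage
      (Homeomorph.neg ℝ).measurableEmbedding (f := fun z => min (z ^ 2) 1 * w z) (s := Ici 0)
    have h4 := h3.2 h2
    simpa [Function.comp_def, hw.even] using h4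
  rw [← integrableOn_univ, ← Iic_union_Ioi (a := (0 : ℝ))]
  exact h1.union hw.integrable

lemma integral_min (hw : RepKernel w) :
    ∫ z, min (z ^ 2) 1 * w z = 2 * ∫ z in Ioi 0, min (z ^ 2) 1 * w z := by
  rw [← integral_comp_abs (f := fun z => min (z ^ 2) 1 * w z)]
  simp only [sq_abs, hw.comp_abs]

lemma min_mul_nonneg (hw : RepKernel w) (z : ℝ) : 0 ≤ min (z ^ 2) 1 * w z := by
  rcases eq_or_ne z 0 with rfl | hz
  · simp
  · exact mul_nonneg (by positivity) (hw.nonneg z hz)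

lemma measurableSet_far (r : ℝ) : MeasurableSet {z : ℝ | r ≤ |z|} :=
  measurableSet_le measurable_const measurable_abs

lemma integrableOn_far (hw : RepKernel w) {r : ℝ} (hr : 0 < r) :
    IntegrableOn w {z | r ≤ |z|} := by
  have h1 : IntegrableOn (fun z => (min (z ^ 2) 1)⁻¹ * (min (z ^ 2) 1 * w z)) {z | r ≤ |z|} := by
    refine Integrable.bdd_mul (c := (min (r ^ 2) 1)⁻¹) hw.integrable_min.integrableOn
      (Measurable.aestronglyMeasurable (by fun_prop)) ?_
    refine (ae_restrict_iff' (measurableSet_far r)).2 (ae_of_all _ fun z hz => ?_)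
    have hz' : r ≤ |z| := hz
    have h2 : r ^ 2 ≤ z ^ 2 := by
      rw [← sq_abs z]
      gcongr
    have h3 : 0 < min (r ^ 2) 1 := lt_min (by positivity) one_pos
    have h4 : min (r ^ 2) 1 ≤ min (z ^ 2) 1 := min_le_min_right _ h2
    rw [Real.norm_of_nonneg (inv_nonneg.2 (h3.le.trans h4))]
    gcongr
  refine h1.congr_fun (fun z hz => ?_) (measurableSet_far r)
  have hz' : r ≤ |z| := hz
  have hz0 : z ≠ 0 := abs_pos.1 (hr.trans_le hz')
  have : 0 < min (z ^ 2) 1 := lt_min (by positivity) one_pos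
  simp only
  field_simp

lemma integrableOn_far_mul (hw : RepKernel w) {r : ℝ} (hr : 0 < r) {F : ℝ → ℝ}
    (hF : Measurable F) {C : ℝ} (hC : ∀ z, |F z| ≤ C) :
    IntegrableOn (fun z => F z * w z) {z | r ≤ |z|} :=
  Integrable.bdd_mul (c := C) (hw.integrableOn_far hr) hF.aestronglyMeasurable (ae_of_all _ hC)

/-- Substitution `x = a z`: the weight becomes `min (x²) (a²)`, at most `x²` for every `a`, which
gives bounds uniform in `a` when the second moment is finite. -/
lemma scale {v : ℝ → ℝ} (hv : RepKernel v) {a : ℝ} (ha : 0 < a) :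
    RepKernel (fun z => a ^ 3 * v (a * z)) ∧
      ∫ z in Ioi (0 : ℝ), min (z ^ 2) 1 * (a ^ 3 * v (a * z))
        = ∫ z in Ioi (0 : ℝ), min (z ^ 2) (a ^ 2) * v z := by
  have hpt : ∀ z : ℝ, min (z ^ 2) 1 * (a ^ 3 * v (a * z))
      = a * (min ((a * z) ^ 2) (a ^ 2) * v (a * z)) := by
    intro z
    have : min ((a * z) ^ 2) (a ^ 2) = a ^ 2 * min (z ^ 2) 1 := by
      rw [mul_min_of_nonneg _ _ (sq_nonneg a)]
      ring_nf
    rw [this]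
    ring
  have hint : IntegrableOn (fun z => min (z ^ 2) (a ^ 2) * v z) (Ioi 0) := by
    refine Integrable.mono' (hv.integrable.const_mul (max 1 (a ^ 2))) ?_ ?_
    · exact (Continuous.aestronglyMeasurable (by fun_prop)).mul
        (hv.cont.aestronglyMeasurable measurableSet_Ioi)
    · refine (ae_restrict_iff' measurableSet_Ioi).2 (ae_of_all _ fun z hz => ?_)
      have hz0 : (0 : ℝ) < z := hz
      have hvz := hv.nonneg z hz0.ne'
      rw [Real.norm_of_nonneg (mul_nonneg (by positivity) hvz), ← mul_assoc]
      refine mul_le_mul_of_nonneg_right ?_ hvz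
      rcases le_total (z ^ 2) 1 with h | h
      · rw [min_eq_left h]
        calc min (z ^ 2) (a ^ 2) ≤ 1 * z ^ 2 := by rw [one_mul]; exact min_le_left _ _
          _ ≤ _ := by gcongr; exact le_max_left _ _
      · rw [min_eq_right h, mul_one]
        exact (min_le_right _ _).trans (le_max_right _ _)
  refine ⟨⟨fun x => by rw [mul_neg, hv.even], fun x hx => ?_, ?_, ?_⟩, ?_⟩
  · exact mul_nonneg (by positivity) (hv.nonneg _ (mul_ne_zero ha.ne' hx))
  · exact continuousOn_const.mul (hv.cont.comp (by fun_prop) fun x hx => mul_pos ha hx)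
  · simp_rw [hpt]
    refine Integrable.const_mul ?_ _
    have := (integrableOn_Ioi_comp_mul_left_iff (fun z => min (z ^ 2) (a ^ 2) * v z) 0 ha).2
    simp only [mul_zero] at this
    exact this hint
  · simp_rw [hpt]
    have := integral_comp_mul_left_Ioi (fun z => min (z ^ 2) (a ^ 2) * v z) 0 ha
    simp only [mul_zero, smul_eq_mul] at this
    rw [integral_const_mul, this]
    field_simp

end RepKernel

lemma setIntegral_comp_neg_of_symm {F : ℝ → ℝ} {s : Set ℝ} (hs : MeasurableSet s)
    (hsymm : ∀ z, -z ∈ s ↔ z ∈ s) : ∫ z in s, F (-z) = ∫ z in s, F z := by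
  rw [← integral_indicator hs, ← integral_indicator hs, ← integral_neg_eq_self (s.indicator F)]
  refine integral_congr_ae (ae_of_all _ fun z => ?_)
  by_cases hz : z ∈ s
  · simp [hz, (hsymm z).2 hz]
  · have hz' : -z ∉ s := fun h => hz ((hsymm z).1 h)
    simp only [indicator_of_notMem hz, indicator_of_notMem hz']

/-! ### Comparison of the nonlocal operator with the one of the test function -/

lemma measurableSet_annulus (r ρ : ℝ) : MeasurableSet {z : ℝ | r < |z| ∧ |z| < ρ} :=
  (measurableSet_lt measurable_const measurable_abs).inter
    (measurableSet_lt measurable_abs measurable_const)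

/-- Outside `B_ρ`, monotonicity of the staircase and positivity of the kernel replace `u` by `ψ`.
One function is then integrated over the whole line, and the splitting radius can be moved from `ρ`
to `δ`. The principal value exists because the truncated integrals over `B_δ` are constant for small
`r`. -/
lemma opEps_le {V : ℝ → ℝ} {a ρ ε δ x C I r₀ : ℝ} {ψ u : ℝ → ℝ} (hε : 0 < ε) (hρ : 0 < ρ)
    (hδ : 0 < δ) (hw : RepKernel (rescaleD2 a V)) (hψ : Measurable ψ)
    (hψC : ∀ z, |ψ (x + z) - ψ x| ≤ C) (hu : Measurable u) (huC : ∀ z, |u (x + z) - u x| ≤ C)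
    (hle : ∀ z, u (x + z) - u x ≤ ψ (x + z) - ψ x) (hr₀ : 0 < r₀)
    (hI : ∀ r, 0 < r → r < r₀ → ∫ z in {z : ℝ | r < |z| ∧ |z| < δ},
      stair ε (ψ (x + z) - ψ x) * rescaleD2 a V z = I) :
    opEps (stairUpper ε) V a ρ ψ u x
      ≤ I + ∫ z in {z : ℝ | δ ≤ |z|}, stair ε (ψ (x + z) - ψ x) * rescaleD2 a V z := by
  set w := rescaleD2 a V with hwdef
  set F : ℝ → ℝ := fun z => stair ε (ψ (x + z) - ψ x) with hF
  have hFm : Measurable F := (measurable_stair hε).comp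
    ((hψ.comp (measurable_const_add x)).sub_const _)
  have hFC : ∀ z, |F z| ≤ C + ε / 2 := fun z =>
    (abs_stair_le hε _).trans (by linarith [hψC z])
  have hGm : Measurable fun z => stair ε (u (x + z) - u x) := (measurable_stair hε).comp
    ((hu.comp (measurable_const_add x)).sub_const _)
  have hGC : ∀ z, |stair ε (u (x + z) - u x)| ≤ C + ε / 2 := fun z =>
    (abs_stair_le hε _).trans (by linarith [huC z])
  have hFi : ∀ r, 0 < r → IntegrableOn (fun z => F z * w z) {z | r ≤ |z|} :=
    fun r hr => hw.integrableOn_far_mul hr hFm hFC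
  have hsplit : ∀ r d, 0 < r → r < d → ∫ z in {z : ℝ | r < |z|}, F z * w z
      = (∫ z in {z : ℝ | r < |z| ∧ |z| < d}, F z * w z) + ∫ z in {z : ℝ | d ≤ |z|}, F z * w z := by
    intro r d hr hrd
    have hset : {z : ℝ | r < |z|} = {z : ℝ | r < |z| ∧ |z| < d} ∪ {z : ℝ | d ≤ |z|} := by
      ext z
      simp only [mem_ofPred_eq, mem_union]
      constructor
      · intro h
        rcases lt_or_ge |z| d with h' | h'
        · exact Or.inl ⟨h, h'⟩
        · exact Or.inr h'
      · rintro (h | h)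
        · exact h.1
        · exact hrd.trans_le h
    rw [hset]
    refine setIntegral_union ?_ (RepKernel.measurableSet_far d) ?_ ?_
    · rw [Set.disjoint_left]
      intro z h1 h2
      exact absurd h1.2 (not_lt.2 h2)
    · exact (hFi r hr).mono_set fun z hz => hz.1.le
    · exact hFi d (hr.trans hrd)
  have hpv : pvBall ρ (fun z => stairUpper ε (ψ (x + z) - ψ x) * w z)
      = I + (∫ z in {z : ℝ | δ ≤ |z|}, F z * w z) - ∫ z in {z : ℝ | ρ ≤ |z|}, F z * w z := by
    unfold pvBall
    simp_rw [stairUpper_eq hε]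
    refine Tendsto.limUnder_eq (tendsto_const_nhds.congr' ?_)
    filter_upwards [Ioo_mem_nhdsGT (lt_min (lt_min hr₀ hδ) hρ)] with r hr
    have h1 := hsplit r δ hr.1 (hr.2.trans_le ((min_le_left _ _).trans (min_le_right _ _)))
    have h2 := hsplit r ρ hr.1 (hr.2.trans_le (min_le_right _ _))
    rw [hI r hr.1 (hr.2.trans_le ((min_le_left _ _).trans (min_le_left _ _)))] at h1
    change _ = ∫ z in {z : ℝ | r < |z| ∧ |z| < ρ}, F z * w z
    linarith
  have hfar : ∫ z in {z : ℝ | ρ ≤ |z|}, stairUpper ε (u (x + z) - u x) * w z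
      ≤ ∫ z in {z : ℝ | ρ ≤ |z|}, F z * w z := by
    simp_rw [stairUpper_eq hε]
    refine setIntegral_mono_on (hw.integrableOn_far_mul hρ hGm hGC) (hFi ρ hρ)
      (RepKernel.measurableSet_far ρ) fun z hz => ?_
    have hz' : ρ ≤ |z| := hz
    exact mul_le_mul_of_nonneg_right (stair_mono hε (hle z))
      (hw.nonneg z (abs_pos.1 (hρ.trans_le hz')))
  unfold opEps
  rw [hpv]
  linarith

/-- The profile of `ψ` at `x`, read in the direction `σ = ±1`. -/
def profile (ψ : ℝ → ℝ) (x σ z : ℝ) : ℝ := ψ (x + σ * z) - ψ x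

/-- The kernel and the domains are symmetric, so the profile may be read in the direction in which
it increases. -/
lemma opEps_le_sum {V : ℝ → ℝ} {a ρ ε δ m P L x C σ : ℝ} {ψ u : ℝ → ℝ} (hε : 0 < ε) (hρ : 0 < ρ)
    (hw : RepKernel (rescaleD2 a V)) (hσ : σ = 1 ∨ σ = -1)
    (hT : Tame (profile ψ x σ) δ m P L) (hψ : Continuous ψ)
    (hψC : ∀ z, |ψ (x + z) - ψ x| ≤ C) (hu : Measurable u) (huC : ∀ z, |u (x + z) - u x| ≤ C)
    (hle : ∀ z, u (x + z) - u x ≤ ψ (x + z) - ψ x) {K : ℕ} (hK : P * δ ≤ K * ε) :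
    opEps (stairUpper ε) V a ρ ψ u x
      ≤ (∑ k ∈ Finset.range K, ε * pairForce (fun z => a ^ 3 * iteratedDeriv 2 V (a * z))
          (profile ψ x σ) δ ((k + 1) * ε))
        + ∫ z in {z : ℝ | δ ≤ |z|}, stair ε (profile ψ x σ z) * rescaleD2 a V z := by
  have hP := hT.biLip_right.Ppos
  have hwe : rescaleD2 a V = fun z => a ^ 3 * iteratedDeriv 2 V (a * z) :=
    funext fun z => rescaleD2_eq a V z
  have hflip : ∀ s : Set ℝ, MeasurableSet s → (∀ z, -z ∈ s ↔ z ∈ s) →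
      ∫ z in s, stair ε (ψ (x + z) - ψ x) * rescaleD2 a V z
        = ∫ z in s, stair ε (profile ψ x σ z) * rescaleD2 a V z := by
    intro s hs hsymm
    rcases hσ with rfl | rfl
    · simp [profile]
    · rw [← setIntegral_comp_neg_of_symm hs hsymm]
      simp [profile, hw.even]
  have hmain := opEps_le (δ := δ) (r₀ := min δ (ε / P)) (I := ∑ k ∈ Finset.range K,
    ε * pairForce (fun z => a ^ 3 * iteratedDeriv 2 V (a * z)) (profile ψ x σ) δ ((k + 1) * ε))
    hε hρ hT.pos hw hψ.measurable hψC hu huC hle (lt_min hT.pos (by positivity)) ?_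
  · refine hmain.trans (le_of_eq ?_)
    rw [hflip _ (RepKernel.measurableSet_far δ) fun z => by simp]
  · intro r hr hr'
    rw [hflip _ (measurableSet_annulus r δ) fun z => by simp, hwe]
    have hw' := hw
    rw [hwe] at hw'
    exact hT.setIntegral_stair hε hw'.even hw'.cont hK hr hr'

/-! ### The far field -/

/-- The rounding error `ε/2` of the staircase does not decay at the origin; for `|z| ≥ X` it is paid
for by `min (z²) 1 ≥ X²`. -/
lemma abs_far_le {w Ψ : ℝ → ℝ} {ε X C : ℝ} (hw : RepKernel w) (hε : 0 < ε) (hX : 0 < X)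
    (hX1 : X ≤ 1) (hC0 : 0 ≤ C) (hC : ∀ z, X ≤ |z| → |Ψ z| ≤ C * min (z ^ 2) 1) :
    |∫ z in {z : ℝ | X ≤ |z|}, stair ε (Ψ z) * w z|
      ≤ (C + ε / (2 * X ^ 2)) * ∫ z, min (z ^ 2) 1 * w z := by
  have h0 : ∀ z : ℝ, X ≤ |z| → ‖stair ε (Ψ z) * w z‖
      ≤ (C + ε / (2 * X ^ 2)) * (min (z ^ 2) 1 * w z) := by
    intro z hz
    have hz0 : z ≠ 0 := abs_pos.1 (hX.trans_le hz)
    have hXz : X ^ 2 ≤ z ^ 2 := by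
      rw [← sq_abs z]
      gcongr
    have h1 : X ^ 2 ≤ min (z ^ 2) 1 := le_min hXz (pow_le_one₀ hX.le hX1)
    rw [norm_mul, Real.norm_of_nonneg (hw.nonneg z hz0), ← mul_assoc]
    refine mul_le_mul_of_nonneg_right ?_ (hw.nonneg z hz0)
    rw [Real.norm_eq_abs]
    have h2 : ε / 2 ≤ ε / (2 * X ^ 2) * min (z ^ 2) 1 := by
      calc ε / 2 = ε / (2 * X ^ 2) * X ^ 2 := by field_simp
        _ ≤ _ := by gcongr
    have := abs_stair_le hε (Ψ z)
    have := hC z hz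
    linarith
  have hi : Integrable (fun z => (C + ε / (2 * X ^ 2)) * (min (z ^ 2) 1 * w z)) :=
    hw.integrable_min.const_mul _
  calc |∫ z in {z : ℝ | X ≤ |z|}, stair ε (Ψ z) * w z|
      ≤ ∫ z in {z : ℝ | X ≤ |z|}, (C + ε / (2 * X ^ 2)) * (min (z ^ 2) 1 * w z) :=
        norm_integral_le_of_norm_le hi.integrableOn
          ((ae_restrict_iff' (RepKernel.measurableSet_far X)).2 (ae_of_all _ h0))
    _ ≤ ∫ z, (C + ε / (2 * X ^ 2)) * (min (z ^ 2) 1 * w z) := by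
        refine setIntegral_le_integral hi (ae_of_all _ fun z => ?_)
        exact mul_nonneg (by positivity) (hw.min_mul_nonneg z)
    _ = _ := integral_const_mul _ _

/-- With an infinite scaling parameter the far field vanishes. -/
lemma tendsto_far_zero {v : ℝ → ℝ} (hv : RepKernel v)
    (hv2 : IntegrableOn (fun x => x ^ 2 * v x) (Ioi 0)) {Ψ : ℕ → ℝ → ℝ} {a ε : ℕ → ℝ} {δ C : ℝ}
    (hδ : 0 < δ) (ha : Tendsto a atTop atTop) (hε : ∀ᶠ n in atTop, 0 < ε n)
    (hε1 : ∀ᶠ n in atTop, ε n ≤ 1) (hC : ∀ᶠ n in atTop, ∀ z, |Ψ n z| ≤ C) :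
    Tendsto (fun n => ∫ z in {z : ℝ | δ ≤ |z|}, stair (ε n) (Ψ n z) * (a n ^ 3 * v (a n * z)))
      atTop (𝓝 0) := by
  have htail : Tendsto (fun n => ∫ x in Ioi (0 : ℝ), (Ici (a n * δ)).indicator
      (fun x => x ^ 2 * v x) x) atTop (𝓝 (∫ x in Ioi (0 : ℝ), (0 : ℝ))) := by
    refine tendsto_integral_filter_of_dominated_convergence (fun x => x ^ 2 * v x) ?_ ?_ hv2 ?_
    · exact Eventually.of_forall fun n => hv2.1.indicator measurableSet_Ici
    · refine Eventually.of_forall fun n => (ae_restrict_iff' measurableSet_Ioi).2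
        (ae_of_all _ fun x hx => ?_)
      have hx0 : (0 : ℝ) < x := hx
      have h0 := mul_nonneg (sq_nonneg x) (hv.nonneg x hx0.ne')
      refine (norm_indicator_le_norm_self _ _).trans (le_of_eq ?_)
      rw [Real.norm_of_nonneg h0]
    · refine ae_of_all _ fun x => ?_
      refine tendsto_const_nhds.congr' ?_
      filter_upwards [(ha.atTop_mul_const hδ).eventually_gt_atTop x] with n hn
      rw [indicator_of_notMem]
      simpa using hn
  rw [integral_zero] at htail
  -- Insert `z²/δ² ≥ 1` and rescale: the mass of the kernel outside `B_δ` is at most `2/δ²` times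
  -- the part of the second moment beyond `a δ`.
  have hfar : ∀ᶠ n in atTop, ∫ z in {z : ℝ | δ ≤ |z|}, a n ^ 3 * v (a n * z)
      ≤ 2 / δ ^ 2 * ∫ x in Ioi (0 : ℝ), (Ici (a n * δ)).indicator (fun x => x ^ 2 * v x) x := by
    filter_upwards [ha.eventually_gt_atTop 0] with n han
    have hsc := hv.scale han
    have h1 : ∫ z in {z : ℝ | δ ≤ |z|}, a n ^ 3 * v (a n * z)
        = 2 * ∫ z in Ioi (0:ℝ), (Ici δ).indicator (fun z => a n ^ 3 * v (a n * z)) z := by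
      rw [← integral_comp_abs (f := (Ici δ).indicator (fun z => a n ^ 3 * v (a n * z))),
        ← integral_indicator (RepKernel.measurableSet_far δ)]
      refine integral_congr_ae (ae_of_all _ fun z => ?_)
      have := hsc.1.comp_abs z
      simp only [indicator, mem_ofPred_eq, mem_Ici]
      split_ifs
      · exact this.symm
      · rfl
    have h2 := integral_comp_mul_left_Ioi
      (fun x => (Ici (a n * δ)).indicator (fun x => x ^ 2 * v x) x) 0 han
    simp only [mul_zero, smul_eq_mul] at h2
    have h3 : ∫ x in Ioi (0 : ℝ), (Ici (a n * δ)).indicator (fun x => x ^ 2 * v x) x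
        = a n * ∫ z in Ioi (0:ℝ), (Ici (a n * δ)).indicator (fun x => x ^ 2 * v x) (a n * z) := by
      rw [h2]
      field_simp
    rw [h1, h3, div_eq_mul_inv, mul_assoc, ← integral_const_mul (a n), ← integral_const_mul (δ ^ 2)⁻¹]
    have hind : IntegrableOn (fun z => (Ici (a n * δ)).indicator (fun x => x ^ 2 * v x) (a n * z))
        (Ioi 0) := by
      have := (integrableOn_Ioi_comp_mul_left_iff
        (fun x => (Ici (a n * δ)).indicator (fun x => x ^ 2 * v x) x) 0 han).2
      simp only [mul_zero] at this
      exact this (hv2.indicator measurableSet_Ici)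
    refine mul_le_mul_of_nonneg_left ?_ (by norm_num : (0 : ℝ) ≤ 2)
    refine setIntegral_mono_on ?_ ((hind.const_mul _).const_mul _) measurableSet_Ioi
      fun z hz => ?_
    · refine IntegrableOn.mono_set ?_ (subset_univ _)
      rw [integrableOn_univ, integrable_indicator_iff measurableSet_Ici]
      exact (hsc.1.integrableOn_far hδ).mono_set fun z hz => le_trans hz (le_abs_self z)
    · by_cases hzδ : δ ≤ z
      · have hmem : a n * δ ≤ a n * z := by gcongr
        rw [indicator_of_mem (show z ∈ Ici δ from hzδ),
          indicator_of_mem (show a n * z ∈ Ici (a n * δ) from hmem)]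
        have hvz := hv.nonneg (a n * z) (mul_pos han hz).ne'
        have e : (δ ^ 2)⁻¹ * (a n * ((a n * z) ^ 2 * v (a n * z)))
            = (a n ^ 3 * v (a n * z)) * (z ^ 2 / δ ^ 2) := by
          field_simp
        rw [e]
        refine le_mul_of_one_le_right (by positivity) ?_
        rw [one_le_div (by positivity)]
        gcongr
      · have hmem : ¬ a n * δ ≤ a n * z := by
          rw [not_le]
          exact mul_lt_mul_of_pos_left (not_le.1 hzδ) han
        rw [indicator_of_notMem (show z ∉ Ici δ from hzδ),
          indicator_of_notMem (show a n * z ∉ Ici (a n * δ) from hmem)]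
        simp
  have hlim : Tendsto (fun n => (C + 1 / 2) * (2 / δ ^ 2 * ∫ x in Ioi (0 : ℝ),
      (Ici (a n * δ)).indicator (fun x => x ^ 2 * v x) x)) atTop (𝓝 0) := by
    simpa using (htail.const_mul (2 / δ ^ 2)).const_mul (C + 1 / 2)
  refine squeeze_zero_norm' ?_ hlim
  filter_upwards [hfar, hε, hε1, hC, ha.eventually_gt_atTop 0] with n h1 hεn hεn1 hCn han
  have hC0 : 0 ≤ C := (abs_nonneg _).trans (hCn 0)
  have hsc := (hv.scale han).1
  calc ‖∫ z in {z : ℝ | δ ≤ |z|}, stair (ε n) (Ψ n z) * (a n ^ 3 * v (a n * z))‖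
      ≤ ∫ z in {z : ℝ | δ ≤ |z|}, (C + 1 / 2) * (a n ^ 3 * v (a n * z)) := by
        refine norm_integral_le_of_norm_le ((hsc.integrableOn_far hδ).const_mul _)
          ((ae_restrict_iff' (RepKernel.measurableSet_far δ)).2 (ae_of_all _ fun z hz => ?_))
        have hz' : δ ≤ |z| := hz
        have hwz := hsc.nonneg z (abs_pos.1 (hδ.trans_le hz'))
        rw [norm_mul, Real.norm_of_nonneg hwz]
        refine mul_le_mul_of_nonneg_right ?_ hwz
        rw [Real.norm_eq_abs]
        have := abs_stair_le hεn (Ψ n z)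
        linarith [hCn z]
    _ = (C + 1 / 2) * ∫ z in {z : ℝ | δ ≤ |z|}, a n ^ 3 * v (a n * z) := integral_const_mul _ _
    _ ≤ _ := by gcongr

/-- With a convergent scaling parameter the far field converges. -/
lemma tendsto_far {v : ℝ → ℝ} (hv : RepKernel v) {Ψ : ℕ → ℝ → ℝ} {Ψ₀ : ℝ → ℝ} {a ε : ℕ → ℝ}
    {δ C α : ℝ} (hδ : 0 < δ) (hα : 0 < α) (ha : Tendsto a atTop (𝓝 α))
    (hε : ∀ᶠ n in atTop, 0 < ε n) (hε0 : Tendsto ε atTop (𝓝 0))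
    (hm : ∀ᶠ n in atTop, Measurable (Ψ n))
    (hC : ∀ᶠ n in atTop, ∀ z, |Ψ n z| ≤ C)
    (hlim : ∀ (z : ℕ → ℝ) (z₀ : ℝ), Tendsto z atTop (𝓝 z₀) →
      Tendsto (fun n => Ψ n (z n)) atTop (𝓝 (Ψ₀ z₀))) :
    Tendsto (fun n => ∫ z in {z : ℝ | δ ≤ |z|}, stair (ε n) (Ψ n z) * (a n ^ 3 * v (a n * z)))
      atTop (𝓝 (∫ z in {z : ℝ | δ ≤ |z|}, Ψ₀ z * (α ^ 3 * v (α * z)))) := by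
  -- After `y = b z` the kernel is fixed and the parameter only enters the argument of `F` and the
  -- domain, so one dominating function serves for all `n`. Hence also the assumption of convergence
  -- along moving points.
  have hscale : ∀ (b : ℝ) (F : ℝ → ℝ), 0 < b →
      ∫ z in {z : ℝ | δ ≤ |z|}, F z * (b ^ 3 * v (b * z))
        = b ^ 2 * ∫ y, {y : ℝ | b * δ ≤ |y|}.indicator (fun y => F (y / b) * v y) y := by
    intro b F hb
    have h1 := Measure.integral_comp_mul_left
      (fun y => {y : ℝ | b * δ ≤ |y|}.indicator (fun y => F (y / b) * v y) y) b
    rw [abs_of_pos (inv_pos.2 hb), smul_eq_mul] at h1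
    have h2 : ∫ y, {y : ℝ | b * δ ≤ |y|}.indicator (fun y => F (y / b) * v y) y
        = b * ∫ z, {y : ℝ | b * δ ≤ |y|}.indicator (fun y => F (y / b) * v y) (b * z) := by
      rw [h1]
      field_simp
    rw [h2, ← integral_indicator (RepKernel.measurableSet_far δ), ← mul_assoc, ← integral_const_mul]
    refine integral_congr_ae (ae_of_all _ fun z => ?_)
    have hiff : b * δ ≤ |b * z| ↔ δ ≤ |z| := by
      rw [abs_mul, abs_of_pos hb, mul_le_mul_iff_right₀ hb]
    have hdiv : b * z / b = z := by field_simp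
    simp only [indicator, mem_ofPred_eq, hiff, hdiv]
    split_ifs <;> ring
  rw [hscale α Ψ₀ hα]
  have hcore : Tendsto (fun n => ∫ y, {y : ℝ | a n * δ ≤ |y|}.indicator
      (fun y => stair (ε n) (Ψ n (y / a n)) * v y) y) atTop
      (𝓝 (∫ y, {y : ℝ | α * δ ≤ |y|}.indicator (fun y => Ψ₀ (y / α) * v y) y)) := by
    have hfar := hv.integrableOn_far (show 0 < α / 2 * δ by positivity)
    have hvm : AEStronglyMeasurable v volume := by
      have h1 := hv.integrable_min.1
      have h2 : AEStronglyMeasurable (fun z : ℝ => (min (z ^ 2) 1)⁻¹ * (min (z ^ 2) 1 * v z))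
          volume := (Measurable.aestronglyMeasurable (by fun_prop)).mul h1
      refine h2.congr ?_
      have : ∀ᵐ x : ℝ, x ≠ 0 := by simp [ae_iff]
      filter_upwards [this] with z hz
      have : 0 < min (z ^ 2) 1 := lt_min (by positivity) one_pos
      field_simp
    refine tendsto_integral_filter_of_dominated_convergence
      ({y : ℝ | α / 2 * δ ≤ |y|}.indicator fun y => (C + 1) * v y) ?_ ?_ ?_ ?_
    · filter_upwards [hm, hε] with n hmn hεn
      refine AEStronglyMeasurable.indicator ?_ (RepKernel.measurableSet_far _)
      exact ((measurable_stair hεn).comp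
        (hmn.comp (measurable_id.div_const _))).aestronglyMeasurable.mul hvm
    · filter_upwards [hC, hε, hε0.eventually_le_const one_pos,
        ha.eventually_const_le (show α / 2 < α by linarith)] with n hCn hεn hεn1 han
      refine ae_of_all _ fun y => ?_
      by_cases hy : a n * δ ≤ |y|
      · have hy' : α / 2 * δ ≤ |y| := le_trans (by gcongr) hy
        rw [indicator_of_mem (show y ∈ {y : ℝ | a n * δ ≤ |y|} from hy),
          indicator_of_mem (show y ∈ {y : ℝ | α / 2 * δ ≤ |y|} from hy')]
        have hvy := hv.nonneg y (abs_pos.1 (lt_of_lt_of_le (by positivity) hy'))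
        rw [norm_mul, Real.norm_of_nonneg hvy]
        refine mul_le_mul_of_nonneg_right ?_ hvy
        rw [Real.norm_eq_abs]
        have := abs_stair_le hεn (Ψ n (y / a n))
        linarith [hCn (y / a n)]
      · rw [indicator_of_notMem (show y ∉ {y : ℝ | a n * δ ≤ |y|} from hy), norm_zero]
        refine indicator_apply_nonneg fun hy' => ?_
        have hvy := hv.nonneg y (abs_pos.1 (lt_of_lt_of_le (by positivity) hy'))
        have : 0 ≤ C := (abs_nonneg _).trans (hCn 0)
        positivity
    · rw [integrable_indicator_iff (RepKernel.measurableSet_far _)]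
      exact hfar.const_mul _
    · have hae : ∀ᵐ y : ℝ, |y| ≠ α * δ := by
        have h0 : (({y : ℝ | |y| ≠ α * δ})ᶜ : Set ℝ) ⊆ {α * δ, -(α * δ)} := by
          intro y hy
          simp only [mem_compl_iff, mem_ofPred_eq, not_not] at hy
          rcases abs_choice y with h | h
          · exact Or.inl (by rw [← hy, h])
          · right
            rw [mem_singleton_iff, ← hy, h, neg_neg]
        exact measure_mono_null h0 (Set.Finite.measure_zero (by simp) _)
      filter_upwards [hae] with y hy
      have hstair : Tendsto (fun n => stair (ε n) (Ψ n (y / a n)) * v y) atTop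
          (𝓝 (Ψ₀ (y / α) * v y)) := by
        have h1 : Tendsto (fun n => Ψ n (y / a n)) atTop (𝓝 (Ψ₀ (y / α))) :=
          hlim _ _ (tendsto_const_nhds.div ha hα.ne')
        have h2 : Tendsto (fun n => stair (ε n) (Ψ n (y / a n)) - Ψ n (y / a n)) atTop (𝓝 0) := by
          have h3 : Tendsto (fun n => ε n / 2) atTop (𝓝 0) := by simpa using hε0.div_const 2
          refine squeeze_zero_norm' ?_ h3
          filter_upwards [hε] with n hn using abs_stair_sub_le hn _
        have h4 := (h2.add h1).mul_const (v y)
        simpa using h4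
      have haδ : Tendsto (fun n => a n * δ) atTop (𝓝 (α * δ)) := ha.mul_const δ
      rcases lt_or_gt_of_ne hy with h | h
      · rw [indicator_of_notMem (show y ∉ {y : ℝ | α * δ ≤ |y|} from not_le.2 h)]
        refine tendsto_const_nhds.congr' ?_
        filter_upwards [haδ.eventually_const_lt h] with n hn
        rw [indicator_of_notMem (show y ∉ {y : ℝ | a n * δ ≤ |y|} from not_le.2 hn)]
      · rw [indicator_of_mem (show y ∈ {y : ℝ | α * δ ≤ |y|} from h.le)]
        refine hstair.congr' ?_
        filter_upwards [haδ.eventually_le_const h] with n hn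
        rw [indicator_of_mem (show y ∈ {y : ℝ | a n * δ ≤ |y|} from hn)]
  refine ((ha.pow 2).mul hcore).congr' ?_
  filter_upwards [ha.eventually_const_lt hα] with n han
  exact (hscale (a n) (fun z => stair (ε n) (Ψ n z)) han).symm

/-! ### Half-relaxed limits -/

lemma isOpen_Q : IsOpen Q := isOpen_Ioi.prod isOpen_univ

lemma mem_Q {p : ℝ × ℝ} : p ∈ Q ↔ 0 < p.1 := by simp [Q]

section HalfRelaxed

variable {E : Set ℝ} {u : ℝ → ℝ × ℝ → ℝ} {M : ℝ}

lemma neBot_halfRelaxed (hE0 : (0 : ℝ) ∈ closure E) {p : ℝ × ℝ} (hp : p ∈ Q) :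
    (𝓝[Q] p ×ˢ 𝓝[E] (0 : ℝ)).NeBot := by
  have h1 : (𝓝[Q] p).NeBot := mem_closure_iff_nhdsWithin_neBot.1 (subset_closure hp)
  have h2 : (𝓝[E] (0 : ℝ)).NeBot := mem_closure_iff_nhdsWithin_neBot.1 hE0
  exact Filter.prod.instNeBot

lemma eventually_abs_le (hM : ∀ ε ∈ E, ∀ p ∈ Q, |u ε p| ≤ M) (p : ℝ × ℝ) :
    ∀ᶠ q : (ℝ × ℝ) × ℝ in 𝓝[Q] p ×ˢ 𝓝[E] (0 : ℝ), |u q.2 q.1| ≤ M := by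
  have := prod_mem_prod (self_mem_nhdsWithin : Q ∈ 𝓝[Q] p) (self_mem_nhdsWithin : E ∈ 𝓝[E] (0 : ℝ))
  filter_upwards [this] with q hq using hM _ hq.2 _ hq.1

lemma isBoundedUnder_le (hM : ∀ ε ∈ E, ∀ p ∈ Q, |u ε p| ≤ M) (p : ℝ × ℝ) :
    IsBoundedUnder (· ≤ ·) (𝓝[Q] p ×ˢ 𝓝[E] (0 : ℝ)) fun q : (ℝ × ℝ) × ℝ => u q.2 q.1 :=
  ⟨M, eventually_map.2 ((eventually_abs_le hM p).mono fun _ hq => (abs_le.1 hq).2)⟩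

lemma isCoboundedUnder_le (hE0 : (0 : ℝ) ∈ closure E) (hM : ∀ ε ∈ E, ∀ p ∈ Q, |u ε p| ≤ M)
    {p : ℝ × ℝ} (hp : p ∈ Q) :
    IsCoboundedUnder (· ≤ ·) (𝓝[Q] p ×ˢ 𝓝[E] (0 : ℝ)) fun q : (ℝ × ℝ) × ℝ => u q.2 q.1 := by
  have := neBot_halfRelaxed hE0 hp
  refine IsBoundedUnder.isCoboundedUnder_le ?_
  exact ⟨-M, eventually_map.2 ((eventually_abs_le hM p).mono fun _ hq => (abs_le.1 hq).1)⟩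

lemma abs_limsupStar_le (hE0 : (0 : ℝ) ∈ closure E) (hM : ∀ ε ∈ E, ∀ p ∈ Q, |u ε p| ≤ M)
    {p : ℝ × ℝ} (hp : p ∈ Q) : |limsupStar E u p| ≤ M := by
  have := neBot_halfRelaxed hE0 hp
  rw [abs_le]
  constructor
  · refine le_limsup_of_frequently_le ?_ (isBoundedUnder_le hM p)
    exact ((eventually_abs_le hM p).mono fun _ hq => (abs_le.1 hq).1).frequently
  · exact limsup_le_of_le (isCoboundedUnder_le hE0 hM hp)
      ((eventually_abs_le hM p).mono fun _ hq => (abs_le.1 hq).2)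

lemma eventually_lt_of_limsupStar_lt (hM : ∀ ε ∈ E, ∀ p ∈ Q, |u ε p| ≤ M) {p : ℝ × ℝ} {c : ℝ}
    (hc : limsupStar E u p < c) :
    ∀ᶠ q : (ℝ × ℝ) × ℝ in 𝓝[Q] p ×ˢ 𝓝[E] (0 : ℝ), u q.2 q.1 < c :=
  eventually_lt_of_limsup_lt hc (isBoundedUnder_le hM p)

lemma frequently_lt_of_lt_limsupStar (hE0 : (0 : ℝ) ∈ closure E)
    (hM : ∀ ε ∈ E, ∀ p ∈ Q, |u ε p| ≤ M) {p : ℝ × ℝ} (hp : p ∈ Q) {c : ℝ}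
    (hc : c < limsupStar E u p) :
    ∃ᶠ q : (ℝ × ℝ) × ℝ in 𝓝[Q] p ×ˢ 𝓝[E] (0 : ℝ), c < u q.2 q.1 :=
  frequently_lt_of_lt_limsup (isCoboundedUnder_le hE0 hM hp) hc

/-- The neighbourhood that witnesses a strict bound at `p` is also a neighbourhood of every nearby
point. -/
lemma upperSemicontinuousOn_limsupStar (hE0 : (0 : ℝ) ∈ closure E)
    (hM : ∀ ε ∈ E, ∀ p ∈ Q, |u ε p| ≤ M) : UpperSemicontinuousOn (limsupStar E u) Q := by
  intro p hp c hc
  obtain ⟨c', h1, h2⟩ := exists_between hc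
  obtain ⟨pa, ha, pb, hb, hab⟩ := eventually_prod_iff.1 (eventually_lt_of_limsupStar_lt hM h1)
  filter_upwards [eventually_eventually_nhdsWithin.2 ha, self_mem_nhdsWithin] with q hq hqQ
  refine lt_of_le_of_lt ?_ h2
  refine limsup_le_of_le (isCoboundedUnder_le hE0 hM hqQ) ?_
  exact eventually_prod_iff.2 ⟨pa, hq, pb, hb, fun hx _ hy => (hab hx hy).le⟩

/-- Convergence of maximum points: a strict maximum point of `limsup^* u_ε - Φ` is a limit of
global maximum points of `u_ε - Φ`. -/
lemma exists_seq_isMaxOn (hE0 : (0 : ℝ) ∈ closure E) (hM : ∀ ε ∈ E, ∀ p ∈ Q, |u ε p| ≤ M)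
    (hu : ∀ ε ∈ E, UpperSemicontinuousOn (u ε) Q) {p : ℝ × ℝ} (hp : p ∈ Q) {Φ : ℝ × ℝ → ℝ}
    (hΦ : ContinuousOn Φ Q) (hΦp : Φ p = limsupStar E u p)
    (hlt : ∀ q ∈ Q, q ≠ p → limsupStar E u q < Φ q) {K : Set (ℝ × ℝ)} (hK : IsCompact K)
    (hKQ : K ⊆ Q) (hout : ∀ q ∈ Q, q ∉ K → M + 1 ≤ Φ q) :
    ∃ (e : ℕ → ℝ) (P : ℕ → ℝ × ℝ), (∀ n, e n ∈ E) ∧ Tendsto e atTop (𝓝[E] 0) ∧ (∀ n, P n ∈ Q) ∧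
      Tendsto P atTop (𝓝 p) ∧ (∀ᶠ n in atTop, IsMaxOn (fun q => u (e n) q - Φ q) Q (P n)) ∧
      Tendsto (fun n => u (e n) (P n) - Φ (P n)) atTop (𝓝 0) := by
  have hpK : p ∈ K := by
    by_contra h
    have := hout p hp h
    have := (abs_le.1 (abs_limsupStar_le hE0 hM hp)).2
    linarith
  have hseq : ∀ n : ℕ, ∃ q : (ℝ × ℝ) × ℝ, q.1 ∈ Q ∧ dist q.1 p < 1 / ((n : ℝ) + 1) ∧ q.2 ∈ E ∧
      dist q.2 0 < 1 / ((n : ℝ) + 1) ∧ limsupStar E u p - 1 / ((n : ℝ) + 1) < u q.2 q.1 := by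
    intro n
    have hn : (0 : ℝ) < 1 / ((n : ℝ) + 1) := by positivity
    have h1 := frequently_lt_of_lt_limsupStar hE0 hM hp
      (show limsupStar E u p - 1 / ((n : ℝ) + 1) < _ by linarith)
    have h2 : ∀ᶠ q in 𝓝[Q] p, q ∈ Q ∧ dist q p < 1 / ((n : ℝ) + 1) :=
      Filter.Eventually.and self_mem_nhdsWithin (mem_nhdsWithin_of_mem_nhds (Metric.ball_mem_nhds p hn))
    have h3 : ∀ᶠ e in 𝓝[E] (0 : ℝ), e ∈ E ∧ dist e 0 < 1 / ((n : ℝ) + 1) :=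
      Filter.Eventually.and self_mem_nhdsWithin (mem_nhdsWithin_of_mem_nhds (Metric.ball_mem_nhds 0 hn))
    obtain ⟨q, hq1, hq2⟩ := (h1.and_eventually (h2.prod_mk h3)).exists
    exact ⟨q, hq2.1.1, hq2.1.2, hq2.2.1, hq2.2.2, hq1⟩
  choose q hq1 hq2 hq3 hq4 hq5 using hseq
  have hinv : Tendsto (fun n : ℕ => 1 / ((n : ℝ) + 1)) atTop (𝓝 0) :=
    tendsto_one_div_add_atTop_nhds_zero_nat
  have hqp : Tendsto (fun n => (q n).1) atTop (𝓝 p) := by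
    rw [tendsto_iff_dist_tendsto_zero]
    exact squeeze_zero (fun _ => dist_nonneg) (fun n => (hq2 n).le) hinv
  have he : Tendsto (fun n => (q n).2) atTop (𝓝[E] 0) := by
    refine tendsto_nhdsWithin_iff.2 ⟨?_, Eventually.of_forall hq3⟩
    rw [tendsto_iff_dist_tendsto_zero]
    exact squeeze_zero (fun _ => dist_nonneg) (fun n => (hq4 n).le) hinv
  have hmax : ∀ n, ∃ x ∈ K, IsMaxOn (fun x => u (q n).2 x - Φ x) K x := by
    intro n
    have h1 : UpperSemicontinuousOn (fun x => u (q n).2 x + -Φ x) K :=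
      ((hu _ (hq3 n)).mono hKQ).add ((hΦ.mono hKQ).neg.upperSemicontinuousOn)
    simp only [← sub_eq_add_neg] at h1
    exact h1.exists_isMaxOn ⟨p, hpK⟩ hK
  choose P hPK hPmax using hmax
  have hΦq : Tendsto (fun n => Φ (q n).1) atTop (𝓝 (Φ p)) :=
    (hΦ.continuousAt (isOpen_Q.mem_nhds hp)).tendsto.comp hqp
  have hlow : ∀ᶠ n in atTop, u (q n).2 (q n).1 - Φ (q n).1 ≤ u (q n).2 (P n) - Φ (P n) := by
    have : ∀ᶠ n in atTop, Φ (q n).1 < M + 1 := by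
      refine hΦq.eventually_lt_const ?_
      have := (abs_le.1 (abs_limsupStar_le hE0 hM hp)).2
      linarith
    filter_upwards [this] with n hn
    refine hPmax n ?_
    by_contra hcon
    have := hout _ (hq1 n) hcon
    linarith
  have hval : ∀ η > 0, ∀ᶠ n in atTop, -η < u (q n).2 (P n) - Φ (P n) := by
    intro η hη
    filter_upwards [hlow, hinv.eventually_lt_const (show 0 < η / 2 by linarith),
      hΦq.eventually_lt_const (show Φ p < Φ p + η / 2 by linarith)] with n h1 h2 h3
    have := hq5 n
    linarith
  -- Outside `K` the difference is at most `M - (M + 1) = -1`, whereas at `P n` it eventually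
  -- exceeds `-1`.
  have hglob : ∀ᶠ n in atTop, IsMaxOn (fun x => u (q n).2 x - Φ x) Q (P n) := by
    filter_upwards [hval 1 one_pos] with n hn x hx
    by_cases hxK : x ∈ K
    · exact hPmax n hxK
    · have h1 := hout x hx hxK
      have h2 := (abs_le.1 (hM _ (hq3 n) x hx)).2
      simp only [mem_ofPred_eq]
      linarith
  have hPp : Tendsto P atTop (𝓝 p) := by
    rw [tendsto_nhds]
    intro O hO hpO
    have hKO : IsCompact (K \ O) := hK.diff hO
    -- Strictness at each point gives a local gap, a third of the pointwise one: a third is lost in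
    -- `u`, another in the variation of `Φ`. Compactness of `K \ O` makes it uniform.
    have hunif : ∃ η > 0, ∀ᶠ e in 𝓝[E] (0 : ℝ), ∀ x ∈ K \ O, u e x - Φ x ≤ -η := by
      refine hKO.induction_on (p := fun S => ∃ η > 0, ∀ᶠ e in 𝓝[E] (0 : ℝ), ∀ x ∈ S,
        u e x - Φ x ≤ -η) ?_ ?_ ?_ ?_
      · exact ⟨1, one_pos, by simp⟩
      · rintro s t hst ⟨η, hη, h⟩
        exact ⟨η, hη, h.mono fun e he x hx => he x (hst hx)⟩
      · rintro s t ⟨η, hη, h⟩ ⟨η', hη', h'⟩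
        refine ⟨min η η', lt_min hη hη', ?_⟩
        filter_upwards [h, h'] with e h1 h2 x hx
        rcases hx with hx | hx
        · exact (h1 x hx).trans (neg_le_neg (min_le_left _ _))
        · exact (h2 x hx).trans (neg_le_neg (min_le_right _ _))
      · intro x hx
        have hxQ : x ∈ Q := hKQ hx.1
        have hxp : x ≠ p := fun h => hx.2 (h ▸ hpO)
        have hgap : 0 < Φ x - limsupStar E u x := sub_pos.2 (hlt x hxQ hxp)
        set g := Φ x - limsupStar E u x with hg
        have h1 := eventually_lt_of_limsupStar_lt hM
          (show limsupStar E u x < limsupStar E u x + g / 3 by linarith)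
        obtain ⟨pa, ha, pb, hb, hab⟩ := eventually_prod_iff.1 h1
        have h2 : ∀ᶠ y in 𝓝[Q] x, Φ x - g / 3 < Φ y :=
          (hΦ x hxQ).eventually_const_lt (by linarith)
        refine ⟨{y | pa y ∧ Φ x - g / 3 < Φ y}, ?_, g / 3, by linarith, ?_⟩
        · exact nhdsWithin_mono x (sdiff_subset.trans hKQ) (ha.and h2)
        · filter_upwards [hb] with e he y hy
          have h3 : u e y < limsupStar E u x + g / 3 := hab hy.1 he
          have h4 := hy.2
          linarith
    obtain ⟨η, hη, hev⟩ := hunif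
    filter_upwards [he.eventually hev, hval η hη] with n h1 h2
    by_contra hcon
    have := h1 (P n) ⟨hPK n, hcon⟩
    linarith
  have hΦP : Tendsto (fun n => Φ (P n)) atTop (𝓝 (Φ p)) :=
    (hΦ.continuousAt (isOpen_Q.mem_nhds hp)).tendsto.comp hPp
  refine ⟨fun n => (q n).2, P, hq3, he, fun n => hKQ (hPK n), hPp, hglob, ?_⟩
  rw [tendsto_order]
  refine ⟨fun b hb => by simpa using hval (-b) (by linarith), fun b hb => ?_⟩
  have h1 := eventually_lt_of_limsupStar_lt hM
    (show limsupStar E u p < limsupStar E u p + b / 2 by linarith)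
  have h2 : Tendsto (fun n => (P n, (q n).2)) atTop (𝓝[Q] p ×ˢ 𝓝[E] (0 : ℝ)) :=
    (tendsto_nhdsWithin_iff.2 ⟨hPp, Eventually.of_forall fun n => hKQ (hPK n)⟩).prodMk he
  filter_upwards [h2.eventually h1, hΦP.eventually_const_lt (show Φ p - b / 2 < Φ p by linarith)]
    with n h3 h4
  linarith

end HalfRelaxed

/-! ### Calculus of test functions -/

section Calculus

variable {φ : ℝ × ℝ → ℝ}

lemma hasDerivAt_slice_fderiv {p : ℝ × ℝ} (h : DifferentiableAt ℝ φ p) :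
    HasDerivAt (fun y => φ (p.1, y)) (fderiv ℝ φ p (0, 1)) p.2 := by
  have h1 : HasDerivAt (fun y : ℝ => (p.1, y)) ((0 : ℝ), (1 : ℝ)) p.2 :=
    (hasDerivAt_const p.2 p.1).prodMk (hasDerivAt_id p.2)
  exact HasFDerivAt.comp_hasDerivAt (f := fun y : ℝ => (p.1, y)) p.2 h.hasFDerivAt h1

lemma hasDerivAt_time_fderiv {p : ℝ × ℝ} (h : DifferentiableAt ℝ φ p) :
    HasDerivAt (fun s => φ (s, p.2)) (fderiv ℝ φ p (1, 0)) p.1 := by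
  have h1 : HasDerivAt (fun s : ℝ => (s, p.2)) ((1 : ℝ), (0 : ℝ)) p.1 :=
    (hasDerivAt_id p.1).prodMk (hasDerivAt_const p.1 p.2)
  exact HasFDerivAt.comp_hasDerivAt (f := fun s : ℝ => (s, p.2)) p.1 h.hasFDerivAt h1

lemma differentiableAt_of_contDiffOn {n : WithTop ℕ∞} (hn : n ≠ 0) (hφ : ContDiffOn ℝ n φ Q)
    {p : ℝ × ℝ} (hp : p ∈ Q) : DifferentiableAt ℝ φ p :=
  (hφ.contDiffAt (isOpen_Q.mem_nhds hp)).differentiableAt hn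

lemma hasDerivAt_slice {n : WithTop ℕ∞} (hn : n ≠ 0) (hφ : ContDiffOn ℝ n φ Q) {p : ℝ × ℝ}
    (hp : p ∈ Q) : HasDerivAt (fun y => φ (p.1, y)) (dx φ p) p.2 := by
  have h := hasDerivAt_slice_fderiv (differentiableAt_of_contDiffOn hn hφ hp)
  unfold dx
  rwa [h.deriv]

lemma hasDerivAt_time {n : WithTop ℕ∞} (hn : n ≠ 0) (hφ : ContDiffOn ℝ n φ Q) {p : ℝ × ℝ}
    (hp : p ∈ Q) : HasDerivAt (fun s => φ (s, p.2)) (dt φ p) p.1 := by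
  have h := hasDerivAt_time_fderiv (differentiableAt_of_contDiffOn hn hφ hp)
  unfold dt
  rwa [h.deriv]

lemma contDiffOn_dx {n m : WithTop ℕ∞} (hmn : m + 1 ≤ n) (hφ : ContDiffOn ℝ n φ Q) :
    ContDiffOn ℝ m (dx φ) Q := by
  have hn : n ≠ 0 := by
    rintro rfl
    simp at hmn
  have h1 : ContDiffOn ℝ m (fun p => fderiv ℝ φ p (0, 1)) Q :=
    (hφ.fderiv_of_isOpen isOpen_Q hmn).clm_apply contDiffOn_const
  exact h1.congr fun p hp =>
    (hasDerivAt_slice_fderiv (differentiableAt_of_contDiffOn hn hφ hp)).deriv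

lemma contDiffOn_dt {n m : WithTop ℕ∞} (hmn : m + 1 ≤ n) (hφ : ContDiffOn ℝ n φ Q) :
    ContDiffOn ℝ m (dt φ) Q := by
  have hn : n ≠ 0 := by
    rintro rfl
    simp at hmn
  have h1 : ContDiffOn ℝ m (fun p => fderiv ℝ φ p (1, 0)) Q :=
    (hφ.fderiv_of_isOpen isOpen_Q hmn).clm_apply contDiffOn_const
  exact h1.congr fun p hp =>
    (hasDerivAt_time_fderiv (differentiableAt_of_contDiffOn hn hφ hp)).deriv

lemma dxx_eq (φ : ℝ × ℝ → ℝ) (p : ℝ × ℝ) : dxx φ p = dx (dx φ) p := by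
  unfold dxx
  rw [iteratedDeriv_succ, iteratedDeriv_one]
  rfl

lemma continuousAt_of_mem_Q (h : ContinuousOn φ Q) {p : ℝ × ℝ} (hp : p ∈ Q) : ContinuousAt φ p :=
  h.continuousAt (isOpen_Q.mem_nhds hp)

lemma continuous_slice (h : ContinuousOn φ Q) {t : ℝ} (ht : 0 < t) :
    Continuous fun y => φ (t, y) := by
  rw [← continuousOn_univ]
  exact h.comp (by fun_prop) fun y _ => mem_Q.2 ht

lemma hasDerivAt_shift {n : WithTop ℕ∞} (hn : n ≠ 0) (hφ : ContDiffOn ℝ n φ Q) {P : ℝ × ℝ}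
    (hP : P ∈ Q) (z : ℝ) :
    HasDerivAt (fun z => φ (P.1, P.2 + z)) (dx φ (P.1, P.2 + z)) z := by
  have h := hasDerivAt_slice (p := (P.1, P.2 + z)) hn hφ (mem_Q.2 (mem_Q.1 hP))
  exact h.comp_const_add P.2 z

/-- Second order expansion in space, uniform near a point. -/
lemma exists_taylor (hφ : ContDiffOn ℝ 2 φ Q) {p : ℝ × ℝ} (hp : p ∈ Q) {ω : ℝ} (hω : 0 < ω) :
    ∃ δ > 0, ∀ P ∈ Q, dist P p < δ → ∀ z, |z| ≤ δ →
      |φ (P.1, P.2 + z) - φ P - dx φ P * z - dxx φ p / 2 * z ^ 2| ≤ ω * z ^ 2 := by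
  have hdx : ContDiffOn ℝ 1 (dx φ) Q := contDiffOn_dx (by norm_num) hφ
  have hdxx : ContDiffOn ℝ 0 (dx (dx φ)) Q := contDiffOn_dx (by norm_num) hdx
  have hc : ContinuousAt (dx (dx φ)) p := continuousAt_of_mem_Q hdxx.continuousOn hp
  obtain ⟨r, hr, hball⟩ := Metric.continuousAt_iff.1 hc ω hω
  refine ⟨r / 2, by positivity, fun P hP hPp z hz => ?_⟩
  have hnear : ∀ y, |y| ≤ |z| → |dx (dx φ) (P.1, P.2 + y) - dxx φ p| ≤ ω := by
    intro y hy
    rw [dxx_eq]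
    refine (hball ?_).le
    have h1 : dist (P.1, P.2 + y) P ≤ |y| := by
      rw [Prod.dist_eq, dist_self, Real.dist_eq, add_sub_cancel_left]
      exact max_le (abs_nonneg y) le_rfl
    calc dist (P.1, P.2 + y) p ≤ dist (P.1, P.2 + y) P + dist P p := dist_triangle _ _ _
      _ < r := by linarith
  -- The mean value inequality is used twice, first for `dx φ` and then for `φ`; the lost factor 2
  -- is harmless.
  have hk : ∀ y, |y| ≤ |z| → |dx φ (P.1, P.2 + y) - dx φ P - dxx φ p * y| ≤ ω * |y| := by
    intro y hy
    have h1 := Convex.norm_image_sub_le_of_norm_hasDerivWithin_le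
      (f := fun y => dx φ (P.1, P.2 + y) - dxx φ p * y)
      (f' := fun y => dx (dx φ) (P.1, P.2 + y) - dxx φ p) (s := Icc (-|z|) |z|) (C := ω)
      (x := 0) (y := y)
      (fun x _ => by
        have h2 := (hasDerivAt_shift one_ne_zero hdx hP x).sub
          ((hasDerivAt_id x).const_mul (dxx φ p))
        simp only [mul_one] at h2
        exact h2.hasDerivWithinAt)
      (fun x hx => by rw [Real.norm_eq_abs]; exact hnear x (abs_le.2 hx))
      (convex_Icc _ _) ⟨by simp, by simp⟩ (abs_le.1 hy)
    simp only [add_zero, mul_zero, sub_zero, Real.norm_eq_abs] at h1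
    have e : dx φ (P.1, P.2 + y) - dx φ P - dxx φ p * y
        = dx φ (P.1, P.2 + y) - dxx φ p * y - dx φ P := by ring
    rw [e]
    exact h1
  have h1 := Convex.norm_image_sub_le_of_norm_hasDerivWithin_le
    (f := fun y => φ (P.1, P.2 + y) - dx φ P * y - dxx φ p / 2 * y ^ 2)
    (f' := fun y => dx φ (P.1, P.2 + y) - dx φ P - dxx φ p * y) (s := Icc (-|z|) |z|)
    (C := ω * |z|) (x := 0) (y := z)
    (fun x _ => by
      have h2 := ((hasDerivAt_shift two_ne_zero hφ hP x).sub
        ((hasDerivAt_id x).const_mul (dx φ P))).sub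
        ((hasDerivAt_pow 2 x).const_mul (dxx φ p / 2))
      refine (h2.congr_deriv ?_).hasDerivWithinAt
      push_cast
      ring)
    (fun x hx => by
      rw [Real.norm_eq_abs]
      exact (hk x (abs_le.2 hx)).trans (mul_le_mul_of_nonneg_left (abs_le.2 hx) hω.le))
    (convex_Icc _ _) ⟨by simp, by simp⟩ (abs_le.1 le_rfl)
  simp only [add_zero, mul_zero, sub_zero, Real.norm_eq_abs, zero_pow two_ne_zero] at h1
  have e : φ (P.1, P.2 + z) - φ P - dx φ P * z - dxx φ p / 2 * z ^ 2
      = φ (P.1, P.2 + z) - dx φ P * z - dxx φ p / 2 * z ^ 2 - φ P := by ring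
  rw [e]
  refine h1.trans (le_of_eq ?_)
  rw [mul_assoc, abs_mul_abs_self, sq]

/-- Bounds on the spatial difference quotients, uniform near a point. -/
lemma exists_slope (hφ : ContDiffOn ℝ 2 φ Q) {p : ℝ × ℝ} (hp : p ∈ Q) {η : ℝ} (hη : 0 < η) :
    ∃ δ > 0, ∀ P ∈ Q, dist P p < δ → ∀ x ∈ Icc (-δ) δ, ∀ y ∈ Icc (-δ) δ, x ≤ y →
      (dx φ p - η) * (y - x) ≤ φ (P.1, P.2 + y) - φ (P.1, P.2 + x) ∧
      φ (P.1, P.2 + y) - φ (P.1, P.2 + x) ≤ (dx φ p + η) * (y - x) := by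
  have hdx : ContDiffOn ℝ 1 (dx φ) Q := contDiffOn_dx (by norm_num) hφ
  have hc : ContinuousAt (dx φ) p := continuousAt_of_mem_Q hdx.continuousOn hp
  obtain ⟨r, hr, hball⟩ := Metric.continuousAt_iff.1 hc η hη
  refine ⟨r / 2, by positivity, fun P hP hPp x hx y hy hxy => ?_⟩
  have hd := fun z => hasDerivAt_shift two_ne_zero hφ hP z
  have hnear : ∀ z ∈ Icc (-(r / 2)) (r / 2), |deriv (fun z => φ (P.1, P.2 + z)) z - dx φ p| < η := by
    intro z hz
    rw [(hd z).deriv]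
    refine hball ?_
    have h1 : dist (P.1, P.2 + z) P ≤ |z| := by
      rw [Prod.dist_eq, dist_self, Real.dist_eq, add_sub_cancel_left]
      exact max_le (abs_nonneg z) le_rfl
    have h2 : |z| ≤ r / 2 := abs_le.2 hz
    calc dist (P.1, P.2 + z) p ≤ dist (P.1, P.2 + z) P + dist P p := dist_triangle _ _ _
      _ < r := by linarith
  have hcont : ContinuousOn (fun z => φ (P.1, P.2 + z)) (Icc (-(r / 2)) (r / 2)) :=
    fun z _ => (hd z).continuousAt.continuousWithinAt
  have hdiff : DifferentiableOn ℝ (fun z => φ (P.1, P.2 + z)) (interior (Icc (-(r / 2)) (r / 2))) :=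
    fun z _ => (hd z).differentiableAt.differentiableWithinAt
  constructor
  · refine (convex_Icc (-(r / 2)) (r / 2)).mul_sub_le_image_sub_of_le_deriv hcont hdiff
      (fun z hz => ?_) x hx y hy hxy
    have := (abs_lt.1 (hnear z (interior_subset hz))).1
    linarith
  · refine (convex_Icc (-(r / 2)) (r / 2)).image_sub_le_mul_sub_of_deriv_le hcont hdiff
      (fun z hz => ?_) x hx y hy hxy
    have := (abs_lt.1 (hnear z (interior_subset hz))).2
    linarith

lemma profile_sq {σ z : ℝ} (hσ : σ = 1 ∨ σ = -1) : (σ * z) ^ 2 = z ^ 2 ∧ |σ * z| = |z| := by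
  rcases hσ with rfl | rfl <;> simp

/-- The profiles of a test function along a sequence converging to a noncritical point. -/
lemma exists_profiles (hφ : ContDiffOn ℝ 2 φ Q) {p : ℝ × ℝ} (hp : p ∈ Q) {σ : ℝ}
    (hσ : σ = 1 ∨ σ = -1) (hσp : 0 < σ * dx φ p) {P : ℕ → ℝ × ℝ} (hPQ : ∀ n, P n ∈ Q)
    (hP : Tendsto P atTop (𝓝 p)) :
    ∃ δ₀ > 0, ∀ δ, 0 < δ → δ ≤ δ₀ →
      Profiles (fun n => profile (fun y => φ ((P n).1, y)) (P n).2 σ) (fun n => σ * dx φ (P n))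
        (σ * dx φ p) (dxx φ p) δ (σ * dx φ p / 2) (2 * (σ * dx φ p)) (|dxx φ p| + 2) := by
  -- An error of half the slope leaves slopes between `1/2` and `3/2` of the limit one, within the
  -- stated range.
  obtain ⟨δ₁, hδ₁, h1⟩ := exists_slope hφ hp (show 0 < σ * dx φ p / 2 by positivity)
  obtain ⟨δ₂, hδ₂, h2⟩ := exists_taylor hφ hp one_pos
  have hdx : ContinuousAt (dx φ) p :=
    continuousAt_of_mem_Q (contDiffOn_dx (m := 1) (by norm_num) hφ).continuousOn hp
  refine ⟨min δ₁ δ₂, lt_min hδ₁ hδ₂, fun δ hδ hδle => ⟨?_, ?_, ?_, hσp⟩⟩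
  · filter_upwards [Metric.tendsto_nhds.1 hP δ₁ hδ₁, Metric.tendsto_nhds.1 hP δ₂ hδ₂]
      with n hn1 hn2
    have hs := h1 (P n) (hPQ n) hn1
    have ht := h2 (P n) (hPQ n) hn2
    have hδ1 : δ ≤ δ₁ := hδle.trans (min_le_left _ _)
    have hδ2 : δ ≤ δ₂ := hδle.trans (min_le_right _ _)
    have hcont : Continuous fun y => φ ((P n).1, y) :=
      continuous_slice hφ.continuousOn (mem_Q.1 (hPQ n))
    have hslope : ∀ x ∈ Icc (-δ) δ, ∀ y ∈ Icc (-δ) δ, x ≤ y →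
        σ * dx φ p / 2 * (y - x) ≤ profile (fun y => φ ((P n).1, y)) (P n).2 σ y
          - profile (fun y => φ ((P n).1, y)) (P n).2 σ x ∧
        profile (fun y => φ ((P n).1, y)) (P n).2 σ y
          - profile (fun y => φ ((P n).1, y)) (P n).2 σ x ≤ 2 * (σ * dx φ p) * (y - x) := by
      intro x hx y hy hxy
      have hyx := sub_nonneg.2 hxy
      unfold profile
      rcases hσ with rfl | rfl
      · have := hs x ⟨by linarith [hx.1], hx.2.trans hδ1⟩ y ⟨by linarith [hy.1], hy.2.trans hδ1⟩ hxy
        simp only [one_mul] at this ⊢ hσp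
        have := mul_nonneg hσp.le hyx
        constructor <;> nlinarith
      · have := hs (-y) ⟨by linarith [hy.2], by linarith [hy.1]⟩ (-x)
          ⟨by linarith [hx.2], by linarith [hx.1]⟩ (by linarith)
        simp only [neg_mul, one_mul] at this ⊢ hσp
        have := mul_nonneg hσp.le hyx
        constructor <;> nlinarith
    refine ⟨hδ, by positivity, ?_, by simp [profile], fun x hx y hy hxy => (hslope x hx y hy hxy).1,
      fun x hx y hy hxy => (hslope x hx y hy hxy).2, ?_⟩
    · unfold profile
      exact (hcont.comp (by fun_prop)).sub continuous_const
    · intro z hz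
      have hz1 : |σ * z| ≤ δ₂ := by
        rw [(profile_sq hσ).2, abs_of_nonneg hz.1]
        exact hz.2.trans hδ2
      have h3 := ht (σ * z) hz1
      have h4 := ht (σ * -z) (by rwa [mul_neg, abs_neg])
      rw [(profile_sq hσ).1] at h3 h4
      rw [neg_sq] at h4
      unfold profile
      -- The linear terms cancel. There remain `q z²` and two remainders of size `z²`, hence the
      -- constant `|q| + 2`.
      have e : φ ((P n).1, (P n).2 + σ * z) - φ ((P n).1, (P n).2)
          + (φ ((P n).1, (P n).2 + σ * -z) - φ ((P n).1, (P n).2))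
          = (φ ((P n).1, (P n).2 + σ * z) - φ (P n) - dx φ (P n) * (σ * z) - dxx φ p / 2 * z ^ 2)
          + (φ ((P n).1, (P n).2 + σ * -z) - φ (P n) - dx φ (P n) * (σ * -z) - dxx φ p / 2 * z ^ 2)
          + dxx φ p * z ^ 2 := by
        have : φ ((P n).1, (P n).2) = φ (P n) := rfl
        rw [this]
        ring
      rw [e]
      refine (abs_add_le _ _).trans ?_
      refine (add_le_add (abs_add_le _ _) le_rfl).trans ?_
      rw [abs_mul, abs_of_nonneg (sq_nonneg z)]
      linarith
  · intro ω hω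
    obtain ⟨δ', hδ', h3⟩ := exists_taylor hφ hp hω
    refine ⟨δ', hδ', ?_⟩
    filter_upwards [Metric.tendsto_nhds.1 hP δ' hδ'] with n hn z hz
    have := h3 (P n) (hPQ n) hn (σ * z) (by rwa [(profile_sq hσ).2])
    rw [(profile_sq hσ).1] at this
    unfold profile
    convert this using 2
    ring
  · exact (hdx.tendsto.comp hP).const_mul σ

end Calculus

/-! ### Passage to the limit at noncritical points -/

lemma measurable_slice {u : ℝ × ℝ → ℝ} (hu : UpperSemicontinuousOn u Q) {t : ℝ} (ht : 0 < t) :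
    Measurable fun y => u (t, y) := by
  have h : UpperSemicontinuousOn (fun y : ℝ => u (t, y)) univ :=
    hu.comp (g := fun y : ℝ => (t, y)) (by fun_prop) fun y _ => mem_Q.2 ht
  exact (upperSemicontinuousOn_univ_iff.1 h).measurable

/-- `Φ` touches `limsup^* u_ε` strictly from above at `p`, with room outside of a compact set. -/
structure TouchesAbove (E : Set ℝ) (u : ℝ → ℝ × ℝ → ℝ) (M : ℝ) (Φ : ℝ × ℝ → ℝ) (p : ℝ × ℝ) :
    Prop where
  mem : p ∈ Q
  smooth : ContDiffOn ℝ 2 Φ Q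
  eq : Φ p = limsupStar E u p
  lt : ∀ q ∈ Q, q ≠ p → limsupStar E u q < Φ q
  coercive : ∃ K : Set (ℝ × ℝ), IsCompact K ∧ K ⊆ Q ∧ ∀ q ∈ Q, q ∉ K → M + 1 ≤ Φ q

/-- The hypotheses on the family of subsolutions. -/
structure SubFamily (V U : ℝ → ℝ) (E : Set ℝ) (a : ℝ → ℝ) (u : ℝ → ℝ × ℝ → ℝ) (M : ℝ) : Prop where
  pos : E ⊆ Ioi 0
  zero_mem : (0 : ℝ) ∈ closure E
  apos : ∀ ε ∈ E, 0 < a ε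
  kernel : RepKernel (iteratedDeriv 2 V)
  contU : Continuous (deriv U)
  sub : ∀ ε ∈ E, ∃ ρ > 0, IsSubEps V U (a ε) ρ ε (u ε)
  bound : ∀ ε ∈ E, ∀ p ∈ Q, |u ε p| ≤ M

section Noncritical

variable {V U : ℝ → ℝ} {E : Set ℝ} {a : ℝ → ℝ} {u : ℝ → ℝ × ℝ → ℝ} {M : ℝ}

lemma SubFamily.usc (hF : SubFamily V U E a u M) : ∀ ε ∈ E, UpperSemicontinuousOn (u ε) Q := by
  intro ε hε
  obtain ⟨ρ, -, h⟩ := hF.sub ε hε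
  exact h.usc

lemma SubFamily.exists_seq (hF : SubFamily V U E a u M) {Φ : ℝ × ℝ → ℝ} {p : ℝ × ℝ}
    (hΦ : TouchesAbove E u M Φ p) :
    ∃ (e : ℕ → ℝ) (P : ℕ → ℝ × ℝ), (∀ n, e n ∈ E) ∧ Tendsto e atTop (𝓝[E] 0) ∧ (∀ n, P n ∈ Q) ∧
      Tendsto P atTop (𝓝 p) ∧ (∀ᶠ n in atTop, IsMaxOn (fun q => u (e n) q - Φ q) Q (P n)) ∧
      Tendsto (fun n => u (e n) (P n) - Φ (P n)) atTop (𝓝 0) := by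
  obtain ⟨K, hK, hKQ, hout⟩ := hΦ.coercive
  exact exists_seq_isMaxOn hF.zero_mem hF.bound hF.usc hΦ.mem hΦ.smooth.continuousOn hΦ.eq hΦ.lt
    hK hKQ hout

/-- The inequality satisfied at a maximum point, for a test function bounded in space. -/
lemma SubFamily.dt_le (hF : SubFamily V U E a u M) {ε : ℝ} (hε : ε ∈ E) {Φ : ℝ × ℝ → ℝ}
    (hΦ : ContDiffOn ℝ 2 Φ Q) {C : ℝ} (hC : ∀ q ∈ Q, |Φ q| ≤ C) {P : ℝ × ℝ} (hP : P ∈ Q)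
    (hmax : IsMaxOn (fun q => u ε q - Φ q) Q P) (hdx : dx Φ P ≠ 0) {σ δ m p L : ℝ}
    (hσ : σ = 1 ∨ σ = -1) (hT : Tame (profile (fun y => Φ (P.1, y)) P.2 σ) δ m p L) {K : ℕ}
    (hK : p * δ ≤ K * ε) :
    dt Φ P ≤ ((∑ k ∈ Finset.range K, ε * pairForce
        (fun z => a ε ^ 3 * iteratedDeriv 2 V (a ε * z)) (profile (fun y => Φ (P.1, y)) P.2 σ) δ
          ((k + 1) * ε))
      + (∫ z in {z : ℝ | δ ≤ |z|}, stair ε (profile (fun y => Φ (P.1, y)) P.2 σ z)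
          * (a ε ^ 3 * iteratedDeriv 2 V (a ε * z))) + deriv U P.2) * |dx Φ P| := by
  obtain ⟨ρ, hρ, hsub⟩ := hF.sub ε hε
  have hε0 : 0 < ε := hF.pos hε
  have hP1 := mem_Q.1 hP
  have hmem : ∀ z, (P.1, P.2 + z) ∈ Q := fun z => mem_Q.2 hP1
  refine (hsub.noncritical Φ hΦ P hP hmax hdx).trans ?_
  unfold hamUpper
  refine mul_le_mul_of_nonneg_right ?_ (abs_nonneg _)
  have hwe : rescaleD2 (a ε) V = fun z => a ε ^ 3 * iteratedDeriv 2 V (a ε * z) :=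
    funext fun z => rescaleD2_eq (a ε) V z
  have hw : RepKernel (rescaleD2 (a ε) V) := by
    rw [hwe]
    exact (hF.kernel.scale (hF.apos ε hε)).1
  have hM0 : 0 ≤ M := (abs_nonneg _).trans (hF.bound ε hε P hP)
  have hC0 : 0 ≤ C := (abs_nonneg _).trans (hC P hP)
  have h := opEps_le_sum (C := 2 * C + 2 * M) (u := fun y => u ε (P.1, y)) hε0 hρ hw hσ hT
    (continuous_slice hΦ.continuousOn hP1) (fun z => ?_) (measurable_slice (hF.usc ε hε) hP1)
    (fun z => ?_) (fun z => ?_) hK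
  · rw [hwe] at h
    linarith
  · have h1 := hC _ (hmem z)
    have h2 := hC _ hP
    refine (abs_sub _ _).trans ?_
    linarith
  · have h1 := hF.bound ε hε _ (hmem z)
    have h2 := hF.bound ε hε _ hP
    refine (abs_sub _ _).trans ?_
    linarith
  · have h1 := hmax (hmem z)
    simp only [mem_ofPred_eq] at h1
    have h2 : u ε (P.1, P.2) = u ε P := rfl
    have h3 : Φ (P.1, P.2) = Φ P := rfl
    rw [h2, h3]
    linarith

/-- The sequence is chosen before `δ`, so that `δ` can be sent to zero after `n → ∞` when `m = 1`.
-/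
lemma SubFamily.noncritical_seq (hF : SubFamily V U E a u M) {Φ : ℝ × ℝ → ℝ} {p : ℝ × ℝ}
    (hΦ : TouchesAbove E u M Φ p) {C : ℝ} (hC : ∀ q ∈ Q, |Φ q| ≤ C) (hdx : dx Φ p ≠ 0) :
    ∃ (e : ℕ → ℝ) (P : ℕ → ℝ × ℝ) (σ : ℝ), (σ = 1 ∨ σ = -1) ∧ σ * dx Φ p = |dx Φ p| ∧
      (∀ n, e n ∈ E) ∧ Tendsto e atTop (𝓝[E] 0) ∧ (∀ n, P n ∈ Q) ∧ Tendsto P atTop (𝓝 p) ∧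
      ∃ δ₀ > 0, ∀ δ, 0 < δ → δ ≤ δ₀ →
        Profiles (fun n => profile (fun y => Φ ((P n).1, y)) (P n).2 σ) (fun n => σ * dx Φ (P n))
          |dx Φ p| (dxx Φ p) δ (|dx Φ p| / 2) (2 * |dx Φ p|) (|dxx Φ p| + 2) ∧
        ∀ᶠ n in atTop, dt Φ (P n) ≤
          ((∑ k ∈ Finset.range ⌈2 * |dx Φ p| * δ / e n⌉₊, e n * pairForce
              (fun z => a (e n) ^ 3 * iteratedDeriv 2 V (a (e n) * z))
              (profile (fun y => Φ ((P n).1, y)) (P n).2 σ) δ ((k + 1) * e n))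
            + (∫ z in {z : ℝ | δ ≤ |z|},
              stair (e n) (profile (fun y => Φ ((P n).1, y)) (P n).2 σ z)
                * (a (e n) ^ 3 * iteratedDeriv 2 V (a (e n) * z)))
            + deriv U (P n).2) * |dx Φ (P n)| := by
  obtain ⟨e, P, heE, he, hPQ, hP, hmax, -⟩ := hF.exists_seq hΦ
  obtain ⟨σ, hσ, hσp⟩ : ∃ σ : ℝ, (σ = 1 ∨ σ = -1) ∧ σ * dx Φ p = |dx Φ p| := by
    rcases abs_choice (dx Φ p) with h | h
    · exact ⟨1, Or.inl rfl, by rw [one_mul, h]⟩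
    · exact ⟨-1, Or.inr rfl, by rw [neg_one_mul, h]⟩
  have hpos : 0 < |dx Φ p| := abs_pos.2 hdx
  obtain ⟨δ₀, hδ₀, hprof⟩ := exists_profiles hΦ.smooth hΦ.mem hσ (hσp ▸ hpos) hPQ hP
  rw [hσp] at hprof
  refine ⟨e, P, σ, hσ, hσp, heE, he, hPQ, hP, δ₀, hδ₀, fun δ hδ hδle => ?_⟩
  have hpr := hprof δ hδ hδle
  refine ⟨hpr, ?_⟩
  have hdxc : ContinuousAt (dx Φ) p := continuousAt_of_mem_Q
    (contDiffOn_dx (m := 1) (by norm_num) hΦ.smooth).continuousOn hΦ.mem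
  have hne : ∀ᶠ n in atTop, dx Φ (P n) ≠ 0 := (hdxc.tendsto.comp hP).eventually_ne hdx
  filter_upwards [hmax, hpr.tame, hne] with n hn hT hdxn
  refine hF.dt_le (heE n) hΦ.smooth hC (hPQ n) hn hdxn hσ hT ?_
  have h1 : 0 < e n := hF.pos (heE n)
  have h2 := Nat.le_ceil (2 * |dx Φ p| * δ / e n)
  rwa [div_le_iff₀ h1] at h2

lemma le_ceil_mul {x e : ℝ} (he : 0 < e) : x ≤ ⌈x / e⌉₊ * e := by
  have h2 := Nat.le_ceil (x / e)
  rwa [div_le_iff₀ he] at h2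

/-- The limit inequality when the scaling parameter diverges. -/
lemma SubFamily.noncritical_of_tendsto (hF : SubFamily V U E a u M) {Φ : ℝ × ℝ → ℝ} {p : ℝ × ℝ}
    (hΦ : TouchesAbove E u M Φ p) {C : ℝ} (hC : ∀ q ∈ Q, |Φ q| ≤ C) (hdx : dx Φ p ≠ 0)
    (hv2 : IntegrableOn (fun x => x ^ 2 * iteratedDeriv 2 V x) (Ioi 0))
    (ha : Tendsto a (𝓝[E] 0) atTop) {S : ℝ}
    (hS : ∀ (ψ : ℕ → ℝ → ℝ) (s : ℕ → ℝ) (δ m P L : ℝ) (e : ℕ → ℝ),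
      Profiles ψ s |dx Φ p| (dxx Φ p) δ m P L → Tendsto e atTop (𝓝[E] 0) → (∀ n, 0 < e n) →
      Tendsto (fun n => ∑ k ∈ Finset.range ⌈P * δ / e n⌉₊, e n * pairForce
        (fun z => a (e n) ^ 3 * iteratedDeriv 2 V (a (e n) * z)) (ψ n) δ ((k + 1) * e n))
        atTop (𝓝 S)) :
    dt Φ p ≤ (S + deriv U p.2) * |dx Φ p| := by
  obtain ⟨e, P, σ, hσ, hσp, heE, he, hPQ, hP, δ₀, hδ₀, hall⟩ := hF.noncritical_seq hΦ hC hdx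
  obtain ⟨hprof, hev⟩ := hall δ₀ hδ₀ le_rfl
  have hepos : ∀ n, 0 < e n := fun n => hF.pos (heE n)
  have he0 : Tendsto e atTop (𝓝 0) := he.mono_right nhdsWithin_le_nhds
  have h1 := hS _ _ _ _ _ _ e hprof he hepos
  have h2 := tendsto_far_zero hF.kernel hv2 (C := 2 * C)
    (Ψ := fun n => profile (fun y => Φ ((P n).1, y)) (P n).2 σ) hδ₀ (ha.comp he)
    (Eventually.of_forall hepos) (he0.eventually_le_const one_pos) (by
      refine Eventually.of_forall fun n z => ?_
      have h1 := hC ((P n).1, (P n).2 + σ * z) (mem_Q.2 (mem_Q.1 (hPQ n)))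
      have h2 := hC (P n) (hPQ n)
      refine (abs_sub _ _).trans ?_
      have h3 : Φ ((P n).1, (P n).2) = Φ (P n) := rfl
      simp only [h3]
      linarith)
  have hdtc : ContinuousAt (dt Φ) p := continuousAt_of_mem_Q
    (contDiffOn_dt (m := 1) (by norm_num) hΦ.smooth).continuousOn hΦ.mem
  have hdxc : ContinuousAt (dx Φ) p := continuousAt_of_mem_Q
    (contDiffOn_dx (m := 1) (by norm_num) hΦ.smooth).continuousOn hΦ.mem
  have hU : Tendsto (fun n => deriv U (P n).2) atTop (𝓝 (deriv U p.2)) :=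
    (hF.contU.tendsto p.2).comp ((continuous_snd.tendsto p).comp hP)
  have h3 := ((h1.add h2).add hU).mul (hdxc.tendsto.comp hP).abs
  rw [add_zero] at h3
  exact le_of_tendsto_of_tendsto (hdtc.tendsto.comp hP) h3 hev

/-- The limit inequality for a bounded strict test function, when `m = 2`. -/
lemma SubFamily.noncritical_two (hF : SubFamily V U E a u M) (hV : AssumptionTwo V)
    (ha : Tendsto a (𝓝[E] 0) atTop) (haε : Tendsto (fun ε => ε * a ε) (𝓝[E] 0) (𝓝 0))
    {Φ : ℝ × ℝ → ℝ} {p : ℝ × ℝ}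
    (hΦ : TouchesAbove E u M Φ p) {C : ℝ} (hC : ∀ q ∈ Q, |Φ q| ≤ C) (hdx : dx Φ p ≠ 0) :
    dt Φ p ≤ hamLocal (f2 V) U Φ p := by
  obtain ⟨W, hW⟩ := hV.exists_majorant
  have h := hF.noncritical_of_tendsto hΦ hC hdx hV.integrable_sq ha
    (S := dxx Φ p * ∫ x in Ioi (0 : ℝ), x ^ 2 * iteratedDeriv 2 V x)
    (fun ψ s δ m P L e hprof he hepos => hprof.tendsto_sum_two hF.kernel.cont hF.kernel.nonneg hW
      (ha.comp he) (Eventually.of_forall hepos) (haε.comp he)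
      (Eventually.of_forall fun n => le_ceil_mul (hepos n)))
  rw [hV.integral_sq_mul] at h
  refine h.trans (le_of_eq ?_)
  unfold hamLocal f2
  ring

lemma Psi_abs (hker : RepKernel (iteratedDeriv 2 V)) (x : ℝ) : Psi V |x| = Psi V x := by
  unfold Psi
  refine tsum_congr fun k => ?_
  rw [← hker.comp_abs (((k : ℝ) + 1) * x), abs_mul,
    abs_of_nonneg (show (0 : ℝ) ≤ (k : ℝ) + 1 by positivity)]

/-- The limit inequality for a bounded strict test function, when `m = 3`. -/
lemma SubFamily.noncritical_three (hF : SubFamily V U E a u M) (hV : AssumptionThree V) {β : ℝ}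
    (hβ : 0 < β) (haε : Tendsto (fun ε => ε * a ε) (𝓝[E] 0) (𝓝 β))
    {Φ : ℝ × ℝ → ℝ} {p : ℝ × ℝ}
    (hΦ : TouchesAbove E u M Φ p) {C : ℝ} (hC : ∀ q ∈ Q, |Φ q| ≤ C) (hdx : dx Φ p ≠ 0) :
    dt Φ p ≤ hamLocal (f3 V β) U Φ p := by
  have hε0 : Tendsto (fun ε : ℝ => ε) (𝓝[E] 0) (𝓝[>] 0) :=
    tendsto_nhdsWithin_iff.2 ⟨tendsto_id.mono_left nhdsWithin_le_nhds,
      Filter.Eventually.mono self_mem_nhdsWithin fun _ h => hF.pos h⟩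
  -- `a` is the product of `ε⁻¹ → ∞` and `ε a → β > 0`.
  have ha : Tendsto a (𝓝[E] 0) atTop := by
    have h1 : Tendsto (fun ε : ℝ => ε⁻¹ * (ε * a ε)) (𝓝[E] 0) atTop :=
      (tendsto_inv_nhdsGT_zero.comp hε0).atTop_mul_pos hβ haε
    refine h1.congr' ?_
    filter_upwards [self_mem_nhdsWithin] with ε hε
    have : (0 : ℝ) < ε := hF.pos hε
    field_simp
  have h := hF.noncritical_of_tendsto hΦ hC hdx hV.integrable_sq ha
    (S := dxx Φ p * β ^ 3 / |dx Φ p| ^ 3 *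
      ∑' k : ℕ, ((k : ℝ) + 1) ^ 2 * iteratedDeriv 2 V (((k : ℝ) + 1) * (β / |dx Φ p|)))
    (fun ψ s δ m P L e hprof he hepos => hprof.tendsto_sum_three hF.kernel.cont hF.kernel.nonneg
      (fun c hc => hV.exists_majorant hc) hβ
      (ha.comp he) (Eventually.of_forall hepos) (haε.comp he)
      (Eventually.of_forall fun n => le_ceil_mul (hepos n)))
  refine h.trans (le_of_eq ?_)
  unfold hamLocal f3
  rw [if_neg hdx]
  have hpos : 0 < |dx Φ p| := abs_pos.2 hdx
  have e1 : ∑' k : ℕ, ((k : ℝ) + 1) ^ 2 * iteratedDeriv 2 V (((k : ℝ) + 1) * (β / |dx Φ p|))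
      = Psi V (β / dx Φ p) := by
    rw [← Psi_abs hF.kernel, abs_div, abs_of_pos hβ]
    rfl
  -- The prefactor `|Φ_x|` of the Hamiltonian turns the cube in the denominator into the square
  -- occurring in `f₃`.
  rw [e1, add_mul, ← sq_abs (dx Φ p)]
  congr 1
  field_simp

end Noncritical

/-! ### The compensated integral -/

section Compensated

variable {w ψ : ℝ → ℝ} {p r C' C ρ : ℝ}

lemma RepKernel.aestronglyMeasurable (hw : RepKernel w) : AEStronglyMeasurable w volume := by
  have h2 : AEStronglyMeasurable (fun z : ℝ => (min (z ^ 2) 1)⁻¹ * (min (z ^ 2) 1 * w z))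
      volume := (Measurable.aestronglyMeasurable (by fun_prop)).mul hw.integrable_min.1
  refine h2.congr ?_
  have : ∀ᵐ x : ℝ, x ≠ 0 := by simp [ae_iff]
  filter_upwards [this] with z hz
  have : 0 < min (z ^ 2) 1 := lt_min (by positivity) one_pos
  field_simp

lemma measurableSet_near (ρ : ℝ) : MeasurableSet {z : ℝ | |z| < ρ} :=
  measurableSet_lt measurable_abs measurable_const

/-- A bounded function with a second order expansion at the origin is quadratically small after
compensation. -/
lemma abs_compensated_le (hw : RepKernel w) (hC : ∀ z, |ψ z| ≤ C)
    (hr : 0 < r) (hr1 : r ≤ 1) (hT : ∀ z, |z| ≤ r → |ψ z - p * z| ≤ C' * z ^ 2) (hρ : 0 < ρ)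
    {z : ℝ} (hz : z ≠ 0) (hzρ : |z| < ρ) :
    ‖(ψ z - p * z) * w z‖ ≤ (C' + (C + |p| * ρ) / r ^ 2) * (min (z ^ 2) 1 * w z) := by
  have hC0 : 0 ≤ C := (abs_nonneg _).trans (hC 0)
  have hC'0 : 0 ≤ C' := by
    have := (abs_nonneg _).trans (hT r (by rw [abs_of_pos hr]))
    exact nonneg_of_mul_nonneg_left this (by positivity)
  have hwz := hw.nonneg z hz
  rw [norm_mul, Real.norm_of_nonneg hwz, ← mul_assoc]
  refine mul_le_mul_of_nonneg_right ?_ hwz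
  rw [Real.norm_eq_abs, add_mul]
  have hm0 : 0 ≤ min (z ^ 2) 1 := by positivity
  rcases le_or_gt |z| r with h | h
  · have h1 : z ^ 2 ≤ 1 := by
      rw [← sq_abs]
      exact pow_le_one₀ (abs_nonneg z) (h.trans hr1)
    have h2 := hT z h
    rw [min_eq_left h1]
    have h3 : 0 ≤ (C + |p| * ρ) / r ^ 2 * z ^ 2 := by positivity
    linarith
  · have h1 : r ^ 2 ≤ min (z ^ 2) 1 := by
      refine le_min ?_ (pow_le_one₀ hr.le hr1)
      rw [← sq_abs z]
      gcongr
    have h2 : |ψ z - p * z| ≤ C + |p| * ρ := by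
      refine (abs_sub _ _).trans ?_
      rw [abs_mul]
      gcongr
      exact hC z
    have h3 : C + |p| * ρ ≤ (C + |p| * ρ) / r ^ 2 * min (z ^ 2) 1 := by
      calc C + |p| * ρ = (C + |p| * ρ) / r ^ 2 * r ^ 2 := by field_simp
        _ ≤ _ := by gcongr
    have h4 : 0 ≤ C' * min (z ^ 2) 1 := by positivity
    linarith

lemma ae_near {q : ℝ → Prop} (h : ∀ z, z ≠ 0 → |z| < ρ → q z) :
    ∀ᵐ z ∂volume.restrict {z : ℝ | |z| < ρ}, q z := by
  refine (ae_restrict_iff' (measurableSet_near ρ)).2 ?_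
  have : ∀ᵐ x : ℝ, x ≠ 0 := by simp [ae_iff]
  filter_upwards [this] with z hz hzρ using h z hz hzρ

lemma integrableOn_compensated (hw : RepKernel w) (hψ : Measurable ψ) (hC : ∀ z, |ψ z| ≤ C)
    (hr : 0 < r) (hr1 : r ≤ 1) (hT : ∀ z, |z| ≤ r → |ψ z - p * z| ≤ C' * z ^ 2) (hρ : 0 < ρ) :
    IntegrableOn (fun z => (ψ z - p * z) * w z) {z | |z| < ρ} := by
  refine Integrable.mono' ((hw.integrable_min.const_mul (C' + (C + |p| * ρ) / r ^ 2)).integrableOn)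
    ?_ (ae_near fun z hz hzρ => abs_compensated_le hw hC hr hr1 hT hρ hz hzρ)
  exact ((hψ.sub (measurable_id.const_mul p)).aestronglyMeasurable.mul
    hw.aestronglyMeasurable).restrict

/-- On the symmetric annulus `δ ≤ |z| < ρ` the odd function `p z w(z)` integrates to zero, so the
compensator can be inserted for free. The compensated integrand is absolutely integrable, and `δ →
0` is harmless. -/
lemma tendsto_compensated (hw : RepKernel w) (hψ : Measurable ψ) (hC : ∀ z, |ψ z| ≤ C)
    (hr : 0 < r) (hr1 : r ≤ 1) (hT : ∀ z, |z| ≤ r → |ψ z - p * z| ≤ C' * z ^ 2) (hρ : 0 < ρ) :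
    Tendsto (fun δ => ∫ z in {z : ℝ | δ ≤ |z|}, ψ z * w z) (𝓝[>] 0)
      (𝓝 ((∫ z in {z : ℝ | |z| < ρ}, (ψ z - p * z) * w z)
        + ∫ z in {z : ℝ | ρ ≤ |z|}, ψ z * w z)) := by
  have hint := integrableOn_compensated hw hψ hC hr hr1 hT hρ
  have hlim : Tendsto (fun δ => ∫ z in {z : ℝ | |z| < ρ},
      {z : ℝ | δ ≤ |z|}.indicator (fun z => (ψ z - p * z) * w z) z) (𝓝[>] 0)
      (𝓝 (∫ z in {z : ℝ | |z| < ρ}, (ψ z - p * z) * w z)) := by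
    refine tendsto_integral_filter_of_dominated_convergence
      (fun z => ‖(ψ z - p * z) * w z‖) ?_ ?_ hint.norm ?_
    · exact Eventually.of_forall fun δ => hint.1.indicator (RepKernel.measurableSet_far δ)
    · exact Eventually.of_forall fun δ => ae_of_all _ fun z => norm_indicator_le_norm_self _ _
    · have : ∀ᵐ x : ℝ, x ≠ 0 := by simp [ae_iff]
      filter_upwards [ae_restrict_of_ae this] with z hz
      refine tendsto_const_nhds.congr' ?_
      filter_upwards [Ioo_mem_nhdsGT (abs_pos.2 hz)] with δ hδ
      rw [indicator_of_mem (show z ∈ {z : ℝ | δ ≤ |z|} from hδ.2.le)]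
  refine (hlim.add_const _).congr' ?_
  filter_upwards [Ioo_mem_nhdsGT hρ] with δ hδ
  have hfar : ∀ d, 0 < d → IntegrableOn (fun z => ψ z * w z) {z | d ≤ |z|} := fun d hd =>
    hw.integrableOn_far_mul hd hψ hC
  have hm : MeasurableSet ({z : ℝ | |z| < ρ} ∩ {z : ℝ | δ ≤ |z|}) :=
    (measurableSet_near ρ).inter (RepKernel.measurableSet_far δ)
  have hset : {z : ℝ | δ ≤ |z|} = ({z : ℝ | |z| < ρ} ∩ {z : ℝ | δ ≤ |z|}) ∪ {z : ℝ | ρ ≤ |z|} := by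
    ext z
    simp only [mem_ofPred_eq, mem_union, mem_inter_iff]
    constructor
    · intro h
      rcases lt_or_ge |z| ρ with h' | h'
      · exact Or.inl ⟨h', h⟩
      · exact Or.inr h'
    · rintro (h | h)
      · exact h.2
      · exact hδ.2.le.trans h
  have h1 : IntegrableOn (fun z => ψ z * w z) ({z : ℝ | |z| < ρ} ∩ {z : ℝ | δ ≤ |z|}) :=
    (hfar δ hδ.1).mono_set inter_subset_right
  have h2 : IntegrableOn (fun z => p * z * w z) ({z : ℝ | |z| < ρ} ∩ {z : ℝ | δ ≤ |z|}) := by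
    have := h1.sub (hint.mono_set inter_subset_left)
    refine this.congr (ae_of_all _ fun z => ?_)
    show ψ z * w z - (ψ z - p * z) * w z = p * z * w z
    ring
  have hodd : ∫ z in {z : ℝ | |z| < ρ} ∩ {z : ℝ | δ ≤ |z|}, p * z * w z = 0 := by
    have h3 := setIntegral_comp_neg_of_symm (F := fun z => p * z * w z) hm (fun z => by simp)
    simp only [hw.even, mul_neg, neg_mul] at h3
    rw [integral_neg] at h3
    linarith
  rw [setIntegral_indicator (RepKernel.measurableSet_far δ)]
  have h4 : ∫ z in {z : ℝ | |z| < ρ} ∩ {z : ℝ | δ ≤ |z|}, (ψ z - p * z) * w z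
      = ∫ z in {z : ℝ | |z| < ρ} ∩ {z : ℝ | δ ≤ |z|}, ψ z * w z := by
    simp_rw [sub_mul]
    rw [integral_sub h1 h2, hodd, sub_zero]
  have hdisj : Disjoint ({z : ℝ | |z| < ρ} ∩ {z : ℝ | δ ≤ |z|}) {z : ℝ | ρ ≤ |z|} := by
    rw [Set.disjoint_left]
    intro z h5 h6
    exact absurd (show |z| < ρ from h5.1) (not_lt.2 (show ρ ≤ |z| from h6))
  have hsum : ∫ z in {z : ℝ | δ ≤ |z|}, ψ z * w z
      = (∫ z in {z : ℝ | |z| < ρ} ∩ {z : ℝ | δ ≤ |z|}, ψ z * w z)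
        + ∫ z in {z : ℝ | ρ ≤ |z|}, ψ z * w z := by
    rw [← setIntegral_union hdisj (RepKernel.measurableSet_far ρ) h1 (hfar ρ hρ), ← hset]
  rw [h4, hsum]

end Compensated

/-- The near field only sees scaled distances up to `B`, so its bound involves `∫_0^B x² W`, which
vanishes with `B`. -/
lemma Majorant.truncate {v W : ℝ → ℝ} {s : Set ℝ} (hW : Majorant v W s) {B : ℝ} (hB : 0 ≤ B)
    (hs : Ioc 0 B ⊆ s) :
    Majorant v ((Iic B).indicator W) (Ioc 0 B) ∧
      ∫ x in Ioi (0 : ℝ), x ^ 2 * (Iic B).indicator W x = ∫ x in (0 : ℝ)..B, x ^ 2 * W x := by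
  have e : (fun x : ℝ => x ^ 2 * (Iic B).indicator W x)
      = (Iic B).indicator (fun x => x ^ 2 * W x) := by
    ext x
    by_cases hx : x ≤ B <;> simp [indicator, hx]
  refine ⟨⟨?_, ?_, ?_, ?_⟩, ?_⟩
  · intro x hx y hy hxy
    by_cases hyB : y ≤ B
    · rw [indicator_of_mem (show y ∈ Iic B from hyB),
        indicator_of_mem (show x ∈ Iic B from hxy.trans hyB)]
      exact hW.anti hx hy hxy
    · rw [indicator_of_notMem (show y ∉ Iic B from hyB)]
      exact indicator_apply_nonneg fun _ => hW.nonneg x hx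
  · exact fun x hx => indicator_apply_nonneg fun _ => hW.nonneg x hx
  · rw [e]
    exact hW.integrable.indicator measurableSet_Iic
  · intro x hx
    rw [indicator_of_mem (show x ∈ Iic B from hx.2)]
    exact hW.le x (hs hx)
  · rw [e, setIntegral_indicator measurableSet_Iic, Ioi_inter_Iic,
      intervalIntegral.integral_of_le hB]

/-! ### The limit inequality at noncritical points when `m = 1` -/

section NoncriticalOne

variable {V U : ℝ → ℝ} {E : Set ℝ} {a : ℝ → ℝ} {u : ℝ → ℝ × ℝ → ℝ} {M : ℝ}

/-- The limit inequality for a bounded strict test function, when `m = 1`. -/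
lemma SubFamily.noncritical_one (hF : SubFamily V U E a u M) (hV : AssumptionOne V) {α : ℝ}
    (hα : 0 < α) (ha : Tendsto a (𝓝[E] 0) (𝓝 α))
    {Φ : ℝ × ℝ → ℝ} {p : ℝ × ℝ}
    (hΦ : TouchesAbove E u M Φ p) {C : ℝ} (hC : ∀ q ∈ Q, |Φ q| ≤ C) (hdx : dx Φ p ≠ 0)
    {ρ : ℝ} (hρ : 0 < ρ) :
    dt Φ p ≤ hamOne V U α ρ Φ Φ p := by
  obtain ⟨e, P, σ, hσ, hσp, heE, he, hPQ, hP, δ₀, hδ₀, hall⟩ := hF.noncritical_seq hΦ hC hdx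
  have hepos : ∀ n, 0 < e n := fun n => hF.pos (heE n)
  have he0 : Tendsto e atTop (𝓝 0) := he.mono_right nhdsWithin_le_nhds
  have hae : Tendsto (fun n => a (e n)) atTop (𝓝 α) := ha.comp he
  -- Eventually `a ≤ 2α`, so scaled distances in the near field do not exceed `2αδ₀`.
  obtain ⟨W, hW⟩ := hV.exists_majorant (2 * α * δ₀)
  have hpos : 0 < |dx Φ p| := abs_pos.2 hdx
  set v := iteratedDeriv 2 V with hv
  have hp1 := mem_Q.1 hΦ.mem
  set Ψ : ℝ → ℝ := fun z => Φ (p.1, p.2 + z) - Φ p with hΨ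
  have hΨc : Continuous Ψ := by
    have h1 := continuous_slice hΦ.smooth.continuousOn hp1
    exact (h1.comp (continuous_const.add continuous_id)).sub continuous_const
  have hΨC : ∀ z, |Ψ z| ≤ 2 * C := by
    intro z
    have h1 := hC (p.1, p.2 + z) (mem_Q.2 hp1)
    have h2 := hC p hΦ.mem
    refine (abs_sub _ _).trans ?_
    linarith
  have hwα : RepKernel fun z => α ^ 3 * v (α * z) := (hF.kernel.scale hα).1
  -- This is `3 L P³/m³` for the constants delivered by `exists_profiles`; it does not depend on
  -- `δ`.
  set A : ℝ := (|dxx Φ p| + 2) * (2 * |dx Φ p|) ^ 3 / (|dx Φ p| / 2) ^ 3 * 3 with hA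
  have hdtc : ContinuousAt (dt Φ) p := continuousAt_of_mem_Q
    (contDiffOn_dt (m := 1) (by norm_num) hΦ.smooth).continuousOn hΦ.mem
  have hdxc : ContinuousAt (dx Φ) p := continuousAt_of_mem_Q
    (contDiffOn_dx (m := 1) (by norm_num) hΦ.smooth).continuousOn hΦ.mem
  have hU : Tendsto (fun n => deriv U (P n).2) atTop (𝓝 (deriv U p.2)) :=
    (hF.contU.tendsto p.2).comp ((continuous_snd.tendsto p).comp hP)
  -- The limit `n → ∞` at fixed `δ`: the near field is only estimated, the far field converges.
  have hmain : ∀ δ, 0 < δ → δ ≤ δ₀ → dt Φ p ≤ (A * (∫ x in (0 : ℝ)..(2 * α * δ), x ^ 2 * W x)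
      + (∫ z in {z : ℝ | δ ≤ |z|}, Ψ z * (α ^ 3 * v (α * z))) + deriv U p.2) * |dx Φ p| := by
    intro δ hδ hδle
    obtain ⟨hprof, hev⟩ := hall δ hδ hδle
    have hB : 0 ≤ 2 * α * δ := by positivity
    obtain ⟨hWt, hWi⟩ := hW.truncate hB (Ioc_subset_Ioc_right (by gcongr))
    have h2 := tendsto_far hF.kernel (C := 2 * C)
      (Ψ := fun n => profile (fun y => Φ ((P n).1, y)) (P n).2 σ)
      (Ψ₀ := profile (fun y => Φ (p.1, y)) p.2 σ) hδ hα hae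
      (Eventually.of_forall hepos) he0 (by
        refine Eventually.of_forall fun n => ?_
        have h1 := continuous_slice hΦ.smooth.continuousOn (mem_Q.1 (hPQ n))
        exact ((h1.comp (continuous_const.add (continuous_const.mul continuous_id))).sub
          continuous_const).measurable) (by
        refine Eventually.of_forall fun n z => ?_
        have h1 := hC ((P n).1, (P n).2 + σ * z) (mem_Q.2 (mem_Q.1 (hPQ n)))
        have h2 := hC (P n) (hPQ n)
        refine (abs_sub _ _).trans ?_
        have h3 : Φ ((P n).1, (P n).2) = Φ (P n) := rfl
        simp only [h3]
        linarith) (by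
        intro z z₀ hz
        unfold profile
        have hP1 : Tendsto (fun n => (P n).1) atTop (𝓝 p.1) := (continuous_fst.tendsto p).comp hP
        have hP2 : Tendsto (fun n => (P n).2) atTop (𝓝 p.2) := (continuous_snd.tendsto p).comp hP
        have h3 : Tendsto (fun n => ((P n).1, (P n).2 + σ * z n)) atTop
            (𝓝 (p.1, p.2 + σ * z₀)) := hP1.prodMk_nhds (hP2.add (hz.const_mul σ))
        have h4 : (p.1, p.2 + σ * z₀) ∈ Q := mem_Q.2 hp1
        exact ((continuousAt_of_mem_Q hΦ.smooth.continuousOn h4).tendsto.comp h3).sub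
          ((continuousAt_of_mem_Q hΦ.smooth.continuousOn hΦ.mem).tendsto.comp hP))
    have hflip : ∫ z in {z : ℝ | δ ≤ |z|}, profile (fun y => Φ (p.1, y)) p.2 σ z
        * (α ^ 3 * v (α * z)) = ∫ z in {z : ℝ | δ ≤ |z|}, Ψ z * (α ^ 3 * v (α * z)) := by
      rcases hσ with rfl | rfl
      · simp [profile, hΨ]
      · rw [← setIntegral_comp_neg_of_symm (F := fun z => Ψ z * (α ^ 3 * v (α * z)))
          (RepKernel.measurableSet_far δ) (fun z => by simp)]
        simp only [profile, hΨ, neg_mul, one_mul]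
        refine setIntegral_congr_fun (RepKernel.measurableSet_far δ) fun z _ => ?_
        have := hwα.even z
        simp only [this]
    rw [hflip] at h2
    have h3 := ((((tendsto_const_nhds (x := A * ∫ x in (0 : ℝ)..(2 * α * δ), x ^ 2 * W x)).add
      h2).add hU).mul (hdxc.tendsto.comp hP).abs)
    refine le_of_tendsto_of_tendsto (hdtc.tendsto.comp hP) h3 ?_
    filter_upwards [hev, hprof.tame, hae.eventually_const_lt hα,
      hae.eventually_le_const (show α < 2 * α by linarith)] with n h4 hT han han2
    refine h4.trans (mul_le_mul_of_nonneg_right ?_ (abs_nonneg _))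
    refine add_le_add (add_le_add ?_ le_rfl) le_rfl
    have h5 := hT.abs_sum_le hF.kernel.nonneg han (hepos n) (hWt.mono fun x hx => by
      refine ⟨lt_of_lt_of_le ?_ hx.1, hx.2.trans (by gcongr)⟩
      have := hepos n
      positivity) ⌈2 * |dx Φ p| * δ / e n⌉₊
    rw [hWi, ← mul_assoc] at h5
    exact (le_abs_self _).trans h5
  have hlim1 : Tendsto (fun δ => A * ∫ x in (0 : ℝ)..(2 * α * δ), x ^ 2 * W x) (𝓝[>] 0) (𝓝 0) := by
    have hc : ContinuousWithinAt (fun b => ∫ x in (0 : ℝ)..b, x ^ 2 * W x) (Ici 0) 0 := by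
      have h1 : IntegrableOn (fun x => x ^ 2 * W x) (Icc 0 1) := by
        rw [integrableOn_Icc_iff_integrableOn_Ioc]
        exact hW.integrable.mono_set Ioc_subset_Ioi_self
      have h2 := intervalIntegral.continuousOn_primitive_interval
        (f := fun x => x ^ 2 * W x) (a := 0) (b := 1) (μ := volume) (by rwa [uIcc_of_le zero_le_one])
      rw [uIcc_of_le zero_le_one] at h2
      exact (h2 0 ⟨le_rfl, zero_le_one⟩).mono_of_mem_nhdsWithin (Icc_mem_nhdsGE one_pos)
    have h1 : Tendsto (fun δ : ℝ => 2 * α * δ) (𝓝[>] 0) (𝓝[≥] 0) := by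
      refine tendsto_nhdsWithin_iff.2 ⟨?_, ?_⟩
      · have : Tendsto (fun δ : ℝ => 2 * α * δ) (𝓝 0) (𝓝 (2 * α * 0)) := by
          exact (continuous_const.mul continuous_id).tendsto 0
        rw [mul_zero] at this
        exact this.mono_left nhdsWithin_le_nhds
      · filter_upwards [self_mem_nhdsWithin] with δ hδ
        have : (0 : ℝ) < δ := hδ
        exact mem_Ici.2 (by positivity)
    have h2 := (hc.tendsto.comp h1).const_mul A
    simpa [Function.comp_def] using h2
  obtain ⟨r, hr, hTay⟩ := exists_taylor hΦ.smooth hΦ.mem one_pos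
  have hT : ∀ z, |z| ≤ min r 1 → |Ψ z - dx Φ p * z| ≤ (|dxx Φ p| / 2 + 1) * z ^ 2 := by
    intro z hz
    have h1 := hTay p hΦ.mem (by simpa using hr) z (hz.trans (min_le_left _ _))
    have e1 : Ψ z - dx Φ p * z = (Φ (p.1, p.2 + z) - Φ p - dx Φ p * z - dxx Φ p / 2 * z ^ 2)
        + dxx Φ p / 2 * z ^ 2 := by
      simp only [hΨ]
      ring
    rw [e1]
    refine (abs_add_le _ _).trans ?_
    rw [abs_mul, abs_div, abs_two, abs_of_nonneg (sq_nonneg z)]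
    linarith
  have hlim2 := tendsto_compensated hwα hΨc.measurable hΨC (lt_min hr one_pos) (min_le_right _ _)
    hT hρ
  have hlim3 := ((hlim1.add hlim2).add_const (deriv U p.2)).mul_const |dx Φ p|
  rw [zero_add] at hlim3
  have hwe : rescaleD2 α V = fun z => α ^ 3 * v (α * z) := funext fun z => rescaleD2_eq α V z
  have hfin : hamOne V U α ρ Φ Φ p = ((∫ z in {z : ℝ | |z| < ρ}, (Ψ z - dx Φ p * z) *
      (α ^ 3 * v (α * z))) + (∫ z in {z : ℝ | ρ ≤ |z|}, Ψ z * (α ^ 3 * v (α * z))) + deriv U p.2)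
        * |dx Φ p| := by
    unfold hamOne opOne
    rw [hwe]
    rfl
  rw [hfin]
  refine ge_of_tendsto hlim3 ?_
  filter_upwards [Ioo_mem_nhdsGT hδ₀] with δ hδ using hmain δ hδ.1 hδ.2.le

end NoncriticalOne

/-! ### Localisation of test functions -/

section Cutoff

variable {χ φ S : ℝ × ℝ → ℝ} {p : ℝ × ℝ}

/-- A smooth cutoff function, equal to one on the ball of radius `r` about `p` and supported in
the compact set `K ⊆ Q`. -/
structure Cutoff (χ : ℝ × ℝ → ℝ) (p : ℝ × ℝ) (r : ℝ) (K : Set (ℝ × ℝ)) : Prop where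
  smooth : ∀ k : ℕ, ContDiff ℝ k χ
  nonneg : ∀ q, 0 ≤ χ q
  le_one : ∀ q, χ q ≤ 1
  rpos : 0 < r
  eq_one : ∀ q, dist q p ≤ r → χ q = 1
  compact : IsCompact K
  subset : K ⊆ Q
  eq_zero : ∀ q, q ∉ K → χ q = 0

lemma exists_cutoff (hp : p ∈ Q) {R : ℝ} (hR : 0 < R) :
    ∃ (χ : ℝ × ℝ → ℝ) (r : ℝ) (K : Set (ℝ × ℝ)), Cutoff χ p r K ∧ r ≤ R ∧
      K ⊆ Metric.closedBall p R := by
  obtain ⟨d, hd, hdQ⟩ := Metric.nhds_basis_closedBall.mem_iff.1 (isOpen_Q.mem_nhds hp)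
  have hm : 0 < min d R := lt_min hd hR
  let χ : ContDiffBump p := ⟨min d R / 2, min d R, by positivity, by linarith⟩
  refine ⟨χ, min d R / 2, Metric.closedBall p (min d R), ⟨fun k => χ.contDiff, fun q => χ.nonneg,
    fun q => χ.le_one, by positivity, fun q hq => χ.one_of_mem_closedBall hq,
    isCompact_closedBall p _, (Metric.closedBall_subset_closedBall (min_le_left d R)).trans hdQ, fun q hq => χ.zero_of_le_dist ?_⟩, ?_,
    Metric.closedBall_subset_closedBall (min_le_right d R)⟩
  · have : min d R < dist q p := not_le.1 hq
    exact this.le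
  · have := min_le_right d R
    linarith

/-- Interpolation between two test functions. -/
def blend (χ φ S : ℝ × ℝ → ℝ) (q : ℝ × ℝ) : ℝ := χ q * φ q + (1 - χ q) * S q

lemma Cutoff.contDiffOn_blend {r : ℝ} {K : Set (ℝ × ℝ)} (hχ : Cutoff χ p r K) {k : ℕ}
    (hφ : ContDiffOn ℝ k φ Q) (hS : ContDiffOn ℝ k S Q) : ContDiffOn ℝ k (blend χ φ S) Q :=
  ((hχ.smooth k).contDiffOn.mul hφ).add ((contDiffOn_const.sub (hχ.smooth k).contDiffOn).mul hS)

lemma Cutoff.exists_bound_blend {r : ℝ} {K : Set (ℝ × ℝ)} (hχ : Cutoff χ p r K)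
    (hφ : ContinuousOn φ Q) {C : ℝ} (hS : ∀ q ∈ Q, |S q| ≤ C) :
    ∃ C', ∀ q ∈ Q, |blend χ φ S q| ≤ C' := by
  obtain ⟨C₁, hC₁⟩ := hχ.compact.exists_bound_of_continuousOn (hφ.mono hχ.subset)
  refine ⟨max C₁ 0 + C, fun q hq => ?_⟩
  have h0 := hχ.nonneg q
  have h1 := hχ.le_one q
  have h2 := hS q hq
  unfold blend
  refine (abs_add_le _ _).trans ?_
  rw [abs_mul, abs_mul, abs_of_nonneg h0, abs_of_nonneg (sub_nonneg.2 h1)]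
  refine add_le_add ?_ ?_
  · by_cases hK : q ∈ K
    · have h3 : |φ q| ≤ max C₁ 0 := (hC₁ q hK).trans (le_max_left _ _)
      exact (mul_le_of_le_one_left (abs_nonneg _) h1).trans h3
    · rw [hχ.eq_zero q hK, zero_mul]
      exact le_max_right _ _
  · exact (mul_le_of_le_one_left (abs_nonneg _) (by linarith)).trans h2

lemma Cutoff.blend_eq {r : ℝ} {K : Set (ℝ × ℝ)} (hχ : Cutoff χ p r K) {q : ℝ × ℝ}
    (hq : dist q p ≤ r) : blend χ φ S q = φ q := by
  simp [blend, hχ.eq_one q hq]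

lemma Cutoff.blend_eventuallyEq {r : ℝ} {K : Set (ℝ × ℝ)} (hχ : Cutoff χ p r K) {q : ℝ × ℝ}
    (hq : dist q p < r) : blend χ φ S =ᶠ[𝓝 q] φ := by
  filter_upwards [Metric.isOpen_ball.mem_nhds (show q ∈ Metric.ball p r from hq)] with x hx
    using hχ.blend_eq (le_of_lt hx)

variable {φ' : ℝ × ℝ → ℝ}

lemma dt_congr (h : φ' =ᶠ[𝓝 p] φ) : dt φ' p = dt φ p := by
  have h1 : Tendsto (fun s : ℝ => (s, p.2)) (𝓝 p.1) (𝓝 p) :=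
    (show Continuous fun s : ℝ => (s, p.2) by fun_prop).tendsto p.1
  exact Filter.EventuallyEq.deriv_eq (h1.eventually h)

lemma dx_congr (h : φ' =ᶠ[𝓝 p] φ) : dx φ' p = dx φ p := by
  have h1 : Tendsto (fun y : ℝ => (p.1, y)) (𝓝 p.2) (𝓝 p) :=
    (show Continuous fun y : ℝ => (p.1, y) by fun_prop).tendsto p.2
  exact Filter.EventuallyEq.deriv_eq (h1.eventually h)

lemma dxx_congr (h : φ' =ᶠ[𝓝 p] φ) : dxx φ' p = dxx φ p := by
  have h1 : Tendsto (fun y : ℝ => (p.1, y)) (𝓝 p.2) (𝓝 p) :=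
    (show Continuous fun y : ℝ => (p.1, y) by fun_prop).tendsto p.2
  exact Filter.EventuallyEq.iteratedDeriv_eq 2 (h1.eventually h)

end Cutoff

/-! ### Passage to the limit at critical points -/

section Quartic

variable {ψ : ℝ → ℝ} {θ Y : ℝ}

/-- For `|z| ≤ Y/2` the numbers `Y + z` stay between `Y/2` and `3Y/2`, so the slopes are comparable
to `θY³` with ratio `P/m = 32`, independent of `Y`. The even part is `θ(12Y² + 2z²)z²`. -/
lemma tame_quartic (hθ : 0 < θ) (hY : 0 < Y) (hc : Continuous ψ)
    (hψ : ∀ z, |z| ≤ Y / 2 → ψ z = θ * ((Y + z) ^ 4 - Y ^ 4)) :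
    Tame ψ (Y / 2) (θ * Y ^ 3 / 2) (16 * θ * Y ^ 3) (13 * θ * Y ^ 2) := by
  have key : ∀ x ∈ Icc (-(Y / 2)) (Y / 2), ∀ y ∈ Icc (-(Y / 2)) (Y / 2), x ≤ y →
      ∃ q, ψ y - ψ x = θ * q * (y - x) ∧ Y ^ 3 / 2 ≤ q ∧ q ≤ 16 * Y ^ 3 := by
    intro x hx y hy hxy
    refine ⟨((Y + y) + (Y + x)) * ((Y + y) ^ 2 + (Y + x) ^ 2), ?_, ?_, ?_⟩
    · rw [hψ x (abs_le.2 hx), hψ y (abs_le.2 hy)]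
      ring
    · have h1 : Y ≤ (Y + y) + (Y + x) := by linarith [hx.1, hy.1]
      have h2 : (Y / 2) ^ 2 ≤ (Y + y) ^ 2 := pow_le_pow_left₀ (by positivity) (by linarith [hy.1]) 2
      have h3 : (Y / 2) ^ 2 ≤ (Y + x) ^ 2 := pow_le_pow_left₀ (by positivity) (by linarith [hx.1]) 2
      calc Y ^ 3 / 2 = Y * ((Y / 2) ^ 2 + (Y / 2) ^ 2) := by ring
        _ ≤ _ := mul_le_mul h1 (add_le_add h2 h3) (by positivity) (hY.le.trans h1)
    · have h0 : ∀ z ∈ Icc (-(Y / 2)) (Y / 2), 0 ≤ Y + z ∧ Y + z ≤ 3 * Y / 2 := fun z hz =>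
        ⟨by linarith [hz.1], by linarith [hz.2]⟩
      have h2 : (Y + y) ^ 2 ≤ (3 * Y / 2) ^ 2 := pow_le_pow_left₀ (h0 y hy).1 (h0 y hy).2 2
      have h3 : (Y + x) ^ 2 ≤ (3 * Y / 2) ^ 2 := pow_le_pow_left₀ (h0 x hx).1 (h0 x hx).2 2
      calc _ ≤ (3 * Y / 2 + 3 * Y / 2) * ((3 * Y / 2) ^ 2 + (3 * Y / 2) ^ 2) := by
            have := (h0 x hx).1
            have := (h0 y hy).1
            gcongr
            · exact (h0 y hy).2
            · exact (h0 x hx).2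
        _ = 27 / 2 * Y ^ 3 := by ring
        _ ≤ 16 * Y ^ 3 := by gcongr; norm_num
  refine ⟨by positivity, by positivity, hc, ?_, fun x hx y hy hxy => ?_, fun x hx y hy hxy => ?_,
    fun z hz => ?_⟩
  · rw [hψ 0 (by rw [abs_zero]; positivity)]
    ring
  · obtain ⟨q, h1, h2, -⟩ := key x hx y hy hxy
    rw [h1, mul_div_assoc]
    have := sub_nonneg.2 hxy
    gcongr
  · obtain ⟨q, h1, -, h2⟩ := key x hx y hy hxy
    rw [h1, show 16 * θ * Y ^ 3 = θ * (16 * Y ^ 3) by ring]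
    have := sub_nonneg.2 hxy
    gcongr
  · have hz' : |z| ≤ Y / 2 := by rw [abs_of_nonneg hz.1]; exact hz.2
    rw [hψ z hz', hψ (-z) (by rwa [abs_neg])]
    have e : θ * ((Y + z) ^ 4 - Y ^ 4) + θ * ((Y + -z) ^ 4 - Y ^ 4)
        = θ * (12 * Y ^ 2 + 2 * z ^ 2) * z ^ 2 := by ring
    rw [e, abs_of_nonneg (by positivity), show 13 * θ * Y ^ 2 = θ * (13 * Y ^ 2) by ring]
    have : z ^ 2 ≤ (Y / 2) ^ 2 := pow_le_pow_left₀ hz.1 hz.2 2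
    gcongr
    nlinarith

/-- Away from the origin at scale `Y`, the increment of a quartic is quadratically small. -/
lemma abs_quartic_le (hθ : 0 < θ) (hY : 0 ≤ Y) {z : ℝ} (hz : Y / 2 ≤ |z|) (hz1 : |z| ≤ 1) :
    |θ * ((Y + z) ^ 4 - Y ^ 4)| ≤ 65 * θ * z ^ 2 := by
  have hY2 : Y ≤ 2 * |z| := by linarith
  have hz0 := abs_nonneg z
  have e : θ * ((Y + z) ^ 4 - Y ^ 4) = θ * ((4 * Y ^ 3 + 6 * Y ^ 2 * z + 4 * Y * z ^ 2 + z ^ 3) * z) := by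
    ring
  rw [e, abs_mul, abs_of_pos hθ, abs_mul]
  -- With `Y ≤ 2|z|` the constant is `4·8 + 6·4 + 4·2 + 1 = 65`; the two surplus powers of `|z|` are
  -- dropped as `|z| ≤ 1`.
  have h1 : |4 * Y ^ 3 + 6 * Y ^ 2 * z + 4 * Y * z ^ 2 + z ^ 3| ≤ 65 * |z| ^ 3 := by
    calc |4 * Y ^ 3 + 6 * Y ^ 2 * z + 4 * Y * z ^ 2 + z ^ 3|
        ≤ |4 * Y ^ 3| + |6 * Y ^ 2 * z| + |4 * Y * z ^ 2| + |z ^ 3| := by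
          refine (abs_add_le _ _).trans (add_le_add_left ((abs_add_le _ _).trans
            (add_le_add_left (abs_add_le _ _) _)) _)
      _ = 4 * Y ^ 3 + 6 * Y ^ 2 * |z| + 4 * Y * |z| ^ 2 + |z| ^ 3 := by
          simp only [abs_mul, abs_pow, abs_of_nonneg hY]
          norm_num
      _ ≤ 4 * (2 * |z|) ^ 3 + 6 * (2 * |z|) ^ 2 * |z| + 4 * (2 * |z|) * |z| ^ 2 + |z| ^ 3 := by
          gcongr
      _ = 65 * |z| ^ 3 := by ring
  have h2 : |z| ^ 3 ≤ |z| := pow_le_of_le_one hz0 hz1 (by norm_num)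
  calc θ * (|4 * Y ^ 3 + 6 * Y ^ 2 * z + 4 * Y * z ^ 2 + z ^ 3| * |z|)
      ≤ θ * (65 * |z| * |z|) := by gcongr; exact h1.trans (by gcongr)
    _ = 65 * θ * z ^ 2 := by rw [← sq_abs z]; ring

end Quartic

section Critical

variable {V U : ℝ → ℝ} {E : Set ℝ} {a : ℝ → ℝ} {u : ℝ → ℝ × ℝ → ℝ} {M : ℝ}

/-- The estimate at a maximum point close to, but different from, the centre of a quartic. -/
lemma SubFamily.dt_le_of_quartic (hF : SubFamily V U E a u M) {ε : ℝ} (hε : ε ∈ E)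
    {Φ : ℝ × ℝ → ℝ} (hΦ : ContDiffOn ℝ 2 Φ Q) {C : ℝ} (hC : ∀ q ∈ Q, |Φ q| ≤ C) {P : ℝ × ℝ}
    (hP : P ∈ Q) (hmax : IsMaxOn (fun q => u ε q - Φ q) Q P) {x₀ r θ : ℝ} (hr : 0 < r)
    (hr1 : r ≤ 1) (hθ : 0 < θ) (hloc : ∀ z, |z| ≤ r →
      Φ (P.1, P.2 + z) - Φ P = θ * ((P.2 - x₀ + z) ^ 4 - (P.2 - x₀) ^ 4)) {Y : ℝ}
    (hYdef : Y = |P.2 - x₀|) (hY : 0 < Y) (hYr : Y ≤ r) {W : ℝ → ℝ}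
    (hW : Majorant (iteratedDeriv 2 V) W (Icc (a ε * ε / (16 * θ * Y ^ 3)) (a ε * (Y / 2))))
    {B : ℝ} (hB : ∫ z, min (z ^ 2) 1 * (a ε ^ 3 * iteratedDeriv 2 V (a ε * z)) ≤ B) :
    dt Φ P ≤ (13 * θ * Y ^ 2 * 32 ^ 3 * (3 * ∫ x in Ioi (0 : ℝ), x ^ 2 * W x)
      + (65 * θ + 2 * C / r ^ 2 + ε / (2 * (Y / 2) ^ 2)) * B + |deriv U P.2|) * (4 * θ * Y ^ 3) := by
  have hε0 : 0 < ε := hF.pos hε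
  have hC0 : 0 ≤ C := (abs_nonneg _).trans (hC P hP)
  -- Reading the profile away from the centre `x₀` makes it increasing.
  obtain ⟨σ, hσ, hσY⟩ : ∃ σ : ℝ, (σ = 1 ∨ σ = -1) ∧ P.2 - x₀ = σ * Y := by
    rcases abs_choice (P.2 - x₀) with h | h
    · exact ⟨1, Or.inl rfl, by rw [hYdef, h, one_mul]⟩
    · exact ⟨-1, Or.inr rfl, by rw [hYdef, h]; ring⟩
  have hdx : dx Φ P = 4 * θ * (P.2 - x₀) ^ 3 := by
    have h1 := hasDerivAt_shift two_ne_zero hΦ hP 0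
    have h2 : HasDerivAt (fun z : ℝ => Φ P + θ * ((P.2 - x₀ + z) ^ 4 - (P.2 - x₀) ^ 4))
        (4 * θ * (P.2 - x₀) ^ 3) 0 := by
      have h3 := (((((hasDerivAt_id (0 : ℝ)).const_add (P.2 - x₀)).pow 4).sub_const
        ((P.2 - x₀) ^ 4)).const_mul θ).const_add (Φ P)
      refine h3.congr_deriv ?_
      simp
      ring
    have h4 : (fun z => Φ (P.1, P.2 + z)) =ᶠ[𝓝 0]
        fun z : ℝ => Φ P + θ * ((P.2 - x₀ + z) ^ 4 - (P.2 - x₀) ^ 4) := by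
      have : ∀ᶠ z : ℝ in 𝓝 0, |z| < r := by
        have h6 : Tendsto (fun z : ℝ => |z|) (𝓝 0) (𝓝 |0|) := continuous_abs.tendsto 0
        rw [abs_zero] at h6
        exact h6.eventually_lt_const hr
      filter_upwards [this] with z hz
      rw [← hloc z hz.le]
      ring
    have h5 := h1.unique (h2.congr_of_eventuallyEq h4)
    simpa using h5
  have hdxabs : |dx Φ P| = 4 * θ * Y ^ 3 := by
    rw [hdx, abs_mul, abs_pow, ← hYdef, abs_of_pos (by positivity)]
  have hdx0 : dx Φ P ≠ 0 := abs_pos.1 (by rw [hdxabs]; positivity)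
  set ψ := profile (fun y => Φ (P.1, y)) P.2 σ with hψ
  have hψloc : ∀ z, |z| ≤ r → ψ z = θ * ((Y + z) ^ 4 - Y ^ 4) := by
    intro z hz
    have h1 := hloc (σ * z) (by rwa [(profile_sq hσ).2])
    have h2 : ψ z = Φ (P.1, P.2 + σ * z) - Φ P := rfl
    rw [h2, h1, hσY]
    rcases hσ with rfl | rfl <;> ring
  have hT : Tame ψ (Y / 2) (θ * Y ^ 3 / 2) (16 * θ * Y ^ 3) (13 * θ * Y ^ 2) := by
    refine tame_quartic hθ hY ?_ fun z hz => hψloc z (by linarith)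
    have h1 := continuous_slice hΦ.continuousOn (mem_Q.1 hP)
    exact (h1.comp (continuous_const.add (continuous_const.mul continuous_id))).sub
      continuous_const
  have h1 := hF.dt_le hε hΦ hC hP hmax hdx0 hσ hT (le_ceil_mul hε0)
  rw [hdxabs] at h1
  refine h1.trans (mul_le_mul_of_nonneg_right ?_ (by positivity))
  have h2 := hT.abs_sum_le hF.kernel.nonneg (hF.apos ε hε) hε0 hW
    ⌈16 * θ * Y ^ 3 * (Y / 2) / ε⌉₊
  have e2 : 13 * θ * Y ^ 2 * (16 * θ * Y ^ 3) ^ 3 / (θ * Y ^ 3 / 2) ^ 3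
      = 13 * θ * Y ^ 2 * 32 ^ 3 := by
    field_simp
    norm_num
  rw [e2] at h2
  -- Up to `r` the function is the quartic; beyond `r` only its boundedness is used.
  have hfar : ∀ z, Y / 2 ≤ |z| → |ψ z| ≤ (65 * θ + 2 * C / r ^ 2) * min (z ^ 2) 1 := by
    intro z hz
    have hm0 : 0 ≤ min (z ^ 2) 1 := by positivity
    rcases le_or_gt |z| r with h | h
    · have hz1 : |z| ≤ 1 := h.trans hr1
      have h3 := abs_quartic_le hθ hY.le hz hz1
      have h4 : z ^ 2 ≤ 1 := by
        rw [← sq_abs]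
        exact pow_le_one₀ (abs_nonneg z) hz1
      rw [hψloc z h, min_eq_left h4, add_mul]
      have : 0 ≤ 2 * C / r ^ 2 * z ^ 2 := by positivity
      linarith
    · have h3 : r ^ 2 ≤ min (z ^ 2) 1 := by
        refine le_min ?_ (pow_le_one₀ hr.le hr1)
        rw [← sq_abs z]
        gcongr
      have h4 : |ψ z| ≤ 2 * C := by
        have h5 := hC (P.1, P.2 + σ * z) (mem_Q.2 (mem_Q.1 hP))
        have h6 := hC (P.1, P.2) (mem_Q.2 (mem_Q.1 hP))
        refine (abs_sub _ _).trans ?_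
        simp only
        linarith
      have h5 : 2 * C ≤ 2 * C / r ^ 2 * min (z ^ 2) 1 := by
        calc 2 * C = 2 * C / r ^ 2 * r ^ 2 := by field_simp
          _ ≤ _ := by gcongr
      rw [add_mul]
      have : 0 ≤ 65 * θ * min (z ^ 2) 1 := by positivity
      linarith
  have h3 := abs_far_le (hF.kernel.scale (hF.apos ε hε)).1 hε0 (show 0 < Y / 2 by positivity)
    (show Y / 2 ≤ 1 by linarith) (show 0 ≤ 65 * θ + 2 * C / r ^ 2 by positivity) hfar
  have h4 : (65 * θ + 2 * C / r ^ 2 + ε / (2 * (Y / 2) ^ 2)) *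
      (∫ z, min (z ^ 2) 1 * (a ε ^ 3 * iteratedDeriv 2 V (a ε * z)))
      ≤ (65 * θ + 2 * C / r ^ 2 + ε / (2 * (Y / 2) ^ 2)) * B :=
    mul_le_mul_of_nonneg_left hB (by positivity)
  have h5 := le_abs_self (deriv U P.2)
  have h6 := (le_abs_self _).trans h2
  have h7 := (le_abs_self _).trans h3
  linarith

/-- A quartic test function, made strict and coercive. -/
lemma TouchesAbove.of_quartic (hF : SubFamily V U E a u M) {p : ℝ × ℝ} (hp : p ∈ Q) {θ : ℝ}
    {g : ℝ → ℝ} (hg : ContDiffOn ℝ 2 g (Ioi 0))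
    (hle : ∀ q ∈ Q, limsupStar E u q ≤ θ * |q.2 - p.2| ^ 4 + g q.1 - g p.1 + limsupStar E u p) :
    TouchesAbove E u M (fun q => (|θ| + 1) * (q.2 - p.2) ^ 4
      + (g q.1 - g p.1 + limsupStar E u p + (q.1 - p.1) ^ 2 / q.1)) p := by
  have hp1 := mem_Q.1 hp
  have habs : ∀ x : ℝ, |x| ^ 4 = x ^ 4 := fun x => by
    rw [← abs_pow, abs_of_nonneg (by positivity)]
  refine ⟨hp, ?_, by simp, fun q hq hqp => ?_, ?_⟩
  · have h1 : ContDiffOn ℝ 2 (fun q : ℝ × ℝ => g q.1) Q :=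
      hg.comp contDiff_fst.contDiffOn fun q hq => mem_Ioi.2 (mem_Q.1 hq)
    have h2 : ContDiffOn ℝ 2 (fun q : ℝ × ℝ => (q.1 - p.1) ^ 2 / q.1) Q :=
      ((contDiff_fst.sub contDiff_const).pow 2).contDiffOn.div contDiff_fst.contDiffOn
        fun q hq => (mem_Q.1 hq).ne'
    have h3 : ContDiff ℝ 2 (fun q : ℝ × ℝ => (|θ| + 1) * (q.2 - p.2) ^ 4) := by fun_prop
    exact h3.contDiffOn.add (((h1.sub contDiffOn_const).add contDiffOn_const).add h2)
  · have hq1 := mem_Q.1 hq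
    have h1 := hle q hq
    rw [habs] at h1
    have h2 : θ * (q.2 - p.2) ^ 4 ≤ |θ| * (q.2 - p.2) ^ 4 := by
      gcongr
      exact le_abs_self θ
    have h3 : 0 < (q.2 - p.2) ^ 4 + (q.1 - p.1) ^ 2 / q.1 := by
      by_cases hx : q.2 = p.2
      · have ht : q.1 ≠ p.1 := fun h => hqp (Prod.ext h hx)
        have : 0 < (q.1 - p.1) ^ 2 := by
          have := sub_ne_zero.2 ht
          positivity
        positivity
      · have : 0 < (q.2 - p.2) ^ 4 := by
          have := sub_ne_zero.2 hx
          positivity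
        positivity
    linarith
  · have hM : ∀ q ∈ Q, |limsupStar E u q| ≤ M := fun q hq =>
      abs_limsupStar_le hF.zero_mem hF.bound hq
    have hM0 : 0 ≤ M := (abs_nonneg _).trans (hM p hp)
    -- At abscissa `p.2` the time part without the penalty lies above the limsup, hence above `-M`.
    -- A penalty of at least `2M + 1` lifts the whole function to `M + 1`.
    set A : ℝ := 2 * M + 1 with hA
    have hA0 : 0 < A := by positivity
    -- The time penalty is `t - 2p.1 + p.1²/t`: it exceeds `A` both for large `t` and for `t` close
    -- to zero, which keeps the compact set inside `Q`.
    refine ⟨Icc (p.1 ^ 2 / (2 * p.1 + A)) (2 * p.1 + A) ×ˢ Icc (p.2 - (1 + A)) (p.2 + (1 + A)),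
      isCompact_Icc.prod isCompact_Icc, ?_, ?_⟩
    · rintro q ⟨h1, -⟩
      refine mem_Q.2 (lt_of_lt_of_le ?_ h1.1)
      positivity
    · intro q hq hqK
      have hq1 := mem_Q.1 hq
      have h1 := hle (q.1, p.2) (mem_Q.2 hq1)
      have h2 := (abs_le.1 (hM (q.1, p.2) (mem_Q.2 hq1))).1
      simp only [sub_self, abs_zero, ne_eq, OfNat.ofNat_ne_zero, not_false_eq_true, zero_pow,
        mul_zero, zero_add] at h1
      have h5 : 0 ≤ |θ| * (q.2 - p.2) ^ 4 := by positivity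
      have h3 : A ≤ (q.2 - p.2) ^ 4 + (q.1 - p.1) ^ 2 / q.1 := by
        have e : (q.1 - p.1) ^ 2 / q.1 = q.1 - 2 * p.1 + p.1 ^ 2 / q.1 := by
          field_simp
          ring
        have h6 : 0 ≤ (q.1 - p.1) ^ 2 / q.1 := by positivity
        have h7 : 0 ≤ (q.2 - p.2) ^ 4 := by positivity
        have h8 : 0 < p.1 ^ 2 / q.1 := by positivity
        by_cases ht : q.1 ∈ Icc (p.1 ^ 2 / (2 * p.1 + A)) (2 * p.1 + A)
        · have hx : ¬ |q.2 - p.2| ≤ 1 + A := by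
            intro hx
            refine hqK ⟨ht, ?_⟩
            have := abs_le.1 hx
            exact ⟨by linarith, by linarith⟩
          have h9 : 1 + A ≤ |q.2 - p.2| ^ 4 :=
            (not_le.1 hx).le.trans (le_self_pow₀ (by linarith [not_le.1 hx]) (by norm_num))
          rw [habs] at h9
          linarith
        · rw [mem_Icc, not_and_or, not_le, not_le] at ht
          rcases ht with ht | ht
          · rw [lt_div_iff₀ (by positivity), mul_comm, ← lt_div_iff₀ hq1] at ht
            linarith
          · linarith
      linarith

/-- The subsolution condition at the critical points of the limit. -/
lemma SubFamily.critical (hF : SubFamily V U E a u M)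
    (hB : ∃ B, ∀ᶠ ε in 𝓝[E] 0,
      ∫ z, min (z ^ 2) 1 * (a ε ^ 3 * iteratedDeriv 2 V (a ε * z)) ≤ B)
    (hW : ∃ (W : ℝ → ℝ) (η : ℝ), 0 < η ∧ ∀ᶠ ε in 𝓝[E] 0, ∀ P ∈ Ioc 0 η, ∀ δ ∈ Ioc 0 η,
      Majorant (iteratedDeriv 2 V) W (Icc (a ε * ε / P) (a ε * δ)))
    {φ : ℝ × ℝ → ℝ} {p : ℝ × ℝ} (hp : p ∈ Q)
    (hmax : IsMaxOn (fun q => limsupStar E u q - φ q) Q p) (hφ : IsQuarticAt p.2 φ) :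
    dt φ p ≤ 0 := by
  obtain ⟨θ₀, g, hg, hφg⟩ := hφ
  obtain ⟨B, hB⟩ := hB
  obtain ⟨W, η, hη, hW⟩ := hW
  have hp1 := mem_Q.1 hp
  have hTA := TouchesAbove.of_quartic hF hp (θ := θ₀) hg (by
    intro q hq
    have h1 := hmax hq
    simp only [mem_ofPred_eq, hφg q hq, hφg p hp] at h1
    simp only [sub_self, abs_zero, ne_eq, OfNat.ofNat_ne_zero, not_false_eq_true, zero_pow,
      mul_zero, zero_add] at h1
    linarith)
  set θ : ℝ := |θ₀| + 1 with hθdef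
  have hθ : 0 < θ := by positivity
  set G : ℝ → ℝ := fun t => g t - g p.1 + limsupStar E u p + (t - p.1) ^ 2 / t with hG
  set Φ : ℝ × ℝ → ℝ := fun q => θ * (q.2 - p.2) ^ 4 + G q.1 with hΦdef
  have hΦ : ContDiffOn ℝ 2 Φ Q := hTA.smooth
  have hGc : ContDiffOn ℝ 2 G (Ioi 0) := by
    have h2 : ContDiffOn ℝ 2 (fun t : ℝ => (t - p.1) ^ 2 / t) (Ioi 0) :=
      ((contDiff_id.sub contDiff_const).pow 2).contDiffOn.div contDiff_id.contDiffOn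
        fun q hq => (mem_Ioi.1 hq).ne'
    exact ((hg.sub contDiffOn_const).add contDiffOn_const).add h2
  have hdtp : dt Φ p = dt φ p := by
    have hgd : DifferentiableAt ℝ g p.1 :=
      (hg.contDiffAt (Ioi_mem_nhds hp1)).differentiableAt two_ne_zero
    have h1 : HasDerivAt (fun t : ℝ => (t - p.1) ^ 2 / t) 0 p.1 := by
      have := (((hasDerivAt_id p.1).sub_const p.1).pow 2).div (hasDerivAt_id p.1) hp1.ne'
      exact this.congr_deriv (by simp)
    have h2 : HasDerivAt (fun s => Φ (s, p.2)) (deriv g p.1) p.1 := by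
      have := ((((hgd.hasDerivAt.sub_const (g p.1)).add_const (limsupStar E u p)).add h1).const_add
        (θ * (p.2 - p.2) ^ 4))
      rw [add_zero] at this
      exact this
    have h3 : HasDerivAt (fun s => φ (s, p.2)) (deriv g p.1) p.1 := by
      refine hgd.hasDerivAt.congr_of_eventuallyEq ?_
      filter_upwards [Ioi_mem_nhds hp1] with s hs
      rw [hφg (s, p.2) (mem_Q.2 hs)]
      simp
    unfold dt
    rw [h2.deriv, h3.deriv]
  obtain ⟨χ, r₀, K, hχ, hr₀, -⟩ := exists_cutoff hp (R := 1) one_pos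
  -- Two test functions are needed. The maximum points are those of `Φ`, which has the exact quartic
  -- form of the critical condition but is unbounded. The truncation `Φ'` is bounded, as the far
  -- field estimate requires, and agrees with `Φ` near `p`.
  obtain ⟨e, P, heE, he, hPQ, hP, hev, hval⟩ := hF.exists_seq hTA
  set Φ' := blend χ Φ fun _ => M + 1 with hΦ'
  have hΦ's : ContDiffOn ℝ 2 Φ' Q := hχ.contDiffOn_blend (k := 2) hΦ contDiffOn_const
  obtain ⟨C, hC⟩ := hχ.exists_bound_blend (S := fun _ => M + 1) hΦ.continuousOn
    (fun q _ => le_rfl)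
  have hr : 0 < r₀ / 2 := by have := hχ.rpos; positivity
  set Y : ℕ → ℝ := fun n => |(P n).2 - p.2| with hY
  have hP2 : Tendsto (fun n => (P n).2) atTop (𝓝 p.2) := (continuous_snd.tendsto p).comp hP
  have hY0 : Tendsto Y atTop (𝓝 0) := by
    have := (hP2.sub_const p.2).abs
    simpa using this
  have he0 : Tendsto e atTop (𝓝 0) := he.mono_right nhdsWithin_le_nhds
  have hU : Tendsto (fun n => |deriv U (P n).2|) atTop (𝓝 |deriv U p.2|) :=
    ((hF.contU.tendsto p.2).comp hP2).abs
  set I := ∫ x in Ioi (0 : ℝ), x ^ 2 * W x with hI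
  -- The bound of `dt_le_of_quartic` multiplied out. The rounding error grows like `ε/Y²`, but the
  -- prefactor `4θY³` leaves `8θεBY`.
  set h : ℕ → ℝ := fun n => 13 * θ * Y n ^ 2 * 32 ^ 3 * (3 * I) * (4 * θ * Y n ^ 3)
    + (65 * θ + 2 * C / (r₀ / 2) ^ 2) * B * (4 * θ * Y n ^ 3) + e n * 8 * θ * B * Y n
    + |deriv U (P n).2| * (4 * θ * Y n ^ 3) with hh
  have hh0 : Tendsto h atTop (𝓝 0) := by
    have h2 := hY0.pow 2
    have h3 := hY0.pow 3
    have t1 := ((((h2.const_mul (13 * θ)).mul_const (32 ^ 3)).mul_const (3 * I)).mul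
      (h3.const_mul (4 * θ)))
    have t2 := (h3.const_mul (4 * θ)).const_mul ((65 * θ + 2 * C / (r₀ / 2) ^ 2) * B)
    have t3 := ((((he0.mul_const 8).mul_const θ).mul_const B).mul hY0)
    have t4 := hU.mul (h3.const_mul (4 * θ))
    have := ((t1.add t2).add t3).add t4
    simpa using this
  have hdtc : ContinuousAt (dt Φ) p := continuousAt_of_mem_Q
    (contDiffOn_dt (m := 1) (by norm_num) hΦ).continuousOn hp
  rw [← hdtp]
  refine le_of_tendsto_of_tendsto (hdtc.tendsto.comp hP) hh0 ?_
  have h16 : Tendsto (fun n => 16 * θ * Y n ^ 3) atTop (𝓝 0) := by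
    have := (hY0.pow 3).const_mul (16 * θ)
    simpa using this
  filter_upwards [hev, hval.eventually_const_lt (show -1 < (0 : ℝ) by norm_num),
    Metric.tendsto_nhds.1 hP (r₀ / 2) hr, hY0.eventually_le_const hr, he.eventually hB,
    he.eventually hW, h16.eventually_le_const hη, hY0.eventually_le_const hη]
    with n hn hvn hPn hYn hBn hWn h16n hYη
  -- If the abscissas agree, `Φ` is a quartic centred at the maximum point itself and the critical
  -- condition for `u (e n)` gives the sign at once.
  rcases eq_or_ne (P n).2 p.2 with hx | hx
  · obtain ⟨ρ, -, hsub⟩ := hF.sub (e n) (heE n)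
    have h1 := hsub.critical Φ hΦ (P n) (hPQ n) hn ⟨θ, G, hGc, fun q _ => by
      rw [hx, ← abs_pow, abs_of_nonneg (show 0 ≤ (q.2 - p.2) ^ 4 by positivity)]⟩
    have hYz : Y n = 0 := by simp [hY, hx]
    have : h n = 0 := by simp [hh, hYz]
    rw [this]
    exact h1
  · have hYpos : 0 < Y n := abs_pos.2 (sub_ne_zero.2 hx)
    have hPr : dist (P n) p < r₀ := by linarith
    have hnear : Φ' =ᶠ[𝓝 (P n)] Φ := hχ.blend_eventuallyEq hPr
    have hPeq : Φ' (P n) = Φ (P n) := hnear.self_of_nhds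
    have hmax' : IsMaxOn (fun q => u (e n) q - Φ' q) Q (P n) := by
      intro q hq
      simp only [mem_ofPred_eq, hPeq]
      have h1 := hn hq
      simp only [mem_ofPred_eq] at h1
      have h2 := (abs_le.1 (hF.bound _ (heE n) q hq)).2
      have h3 := hχ.nonneg q
      have h4 := hχ.le_one q
      -- A convex combination of two quantities, each at most the value at `P n`: the first by
      -- maximality, the second because it is at most `-1`.
      have e1 : u (e n) q - Φ' q = χ q * (u (e n) q - Φ q) + (1 - χ q) * (u (e n) q - (M + 1)) := by
        simp only [hΦ', blend]
        ring
      rw [e1]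
      have h5 : χ q * (u (e n) q - Φ q) ≤ χ q * (u (e n) (P n) - Φ (P n)) := by gcongr
      have h6 : (1 - χ q) * (u (e n) q - (M + 1)) ≤ (1 - χ q) * (u (e n) (P n) - Φ (P n)) :=
        mul_le_mul_of_nonneg_left (by linarith) (by linarith)
      linarith
    have h1 := hF.dt_le_of_quartic (heE n) hΦ's hC (hPQ n) hmax' (x₀ := p.2) hr (by linarith) hθ
      (fun z hz => by
        have h2 : dist ((P n).1, (P n).2 + z) p ≤ r₀ := by
          have h3 : dist ((P n).1, (P n).2 + z) (P n) = |z| := by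
            simp [Prod.dist_eq]
          have h4 := dist_triangle ((P n).1, (P n).2 + z) (P n) p
          linarith
        rw [hPeq, show Φ' ((P n).1, (P n).2 + z) = Φ ((P n).1, (P n).2 + z) from hχ.blend_eq h2]
        simp only [hΦdef]
        ring) rfl hYpos hYn
      (hWn _ ⟨by positivity, h16n⟩ _ ⟨half_pos hYpos, by linarith⟩) hBn
    rw [dt_congr hnear] at h1
    refine h1.trans (le_of_eq ?_)
    have hYn0 : (Y n) ≠ 0 := hYpos.ne'
    simp only [hh]
    field_simp
    ring

end Critical

/-! ### Strictification of test functions -/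

section Raise

variable {φ : ℝ × ℝ → ℝ} {p : ℝ × ℝ} {c l : ℝ}

/-- `φ` translated to the value `c` at `p`, plus a penalty vanishing only at `p`. -/
def raise (φ : ℝ × ℝ → ℝ) (p : ℝ × ℝ) (c l : ℝ) (q : ℝ × ℝ) : ℝ :=
  φ q - φ p + c + l * ((q.1 - p.1) ^ 2 + (q.2 - p.2) ^ 4)

lemma raise_self : raise φ p c l p = c := by simp [raise]

lemma contDiffOn_raise (hφ : ContDiffOn ℝ 2 φ Q) : ContDiffOn ℝ 2 (raise φ p c l) Q := by
  have h : ContDiff ℝ 2 (fun q : ℝ × ℝ => l * ((q.1 - p.1) ^ 2 + (q.2 - p.2) ^ 4)) := by fun_prop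
  exact ((hφ.sub contDiffOn_const).add contDiffOn_const).add h.contDiffOn

lemma dt_raise (hφ : ContDiffOn ℝ 2 φ Q) (hp : p ∈ Q) : dt (raise φ p c l) p = dt φ p := by
  have h1 := hasDerivAt_time two_ne_zero hφ hp
  have h2 : HasDerivAt (fun s => l * ((s - p.1) ^ 2 + (p.2 - p.2) ^ 4)) 0 p.1 := by
    have := (((((hasDerivAt_id p.1).sub_const p.1).pow 2).add_const ((p.2 - p.2) ^ 4)).const_mul l)
    exact this.congr_deriv (by simp)
  have h3 : HasDerivAt (fun s => raise φ p c l (s, p.2)) (dt φ p + 0) p.1 :=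
    ((h1.sub_const (φ p)).add_const c).add h2
  unfold dt
  rw [h3.deriv, add_zero]
  rfl

lemma dx_raise (hφ : ContDiffOn ℝ 2 φ Q) {q : ℝ × ℝ} (hq : q ∈ Q) :
    dx (raise φ p c l) q = dx φ q + l * (4 * (q.2 - p.2) ^ 3) := by
  have h1 := hasDerivAt_slice two_ne_zero hφ hq
  have h2 : HasDerivAt (fun y => l * ((q.1 - p.1) ^ 2 + (y - p.2) ^ 4))
      (l * (4 * (q.2 - p.2) ^ 3)) q.2 := by
    have := (((((hasDerivAt_id q.2).sub_const p.2).pow 4).const_add ((q.1 - p.1) ^ 2)).const_mul l)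
    exact this.congr_deriv (by simp)
  have h3 : HasDerivAt (fun y => raise φ p c l (q.1, y)) (dx φ q + l * (4 * (q.2 - p.2) ^ 3)) q.2 :=
    ((h1.sub_const (φ p)).add_const c).add h2
  exact h3.deriv

/-- The spatial penalty is quartic rather than quadratic so that the second derivative at `p` is
unchanged. -/
lemma dxx_raise (hφ : ContDiffOn ℝ 2 φ Q) (hp : p ∈ Q) : dxx (raise φ p c l) p = dxx φ p := by
  rw [dxx_eq, dxx_eq]
  have h1 : dx (raise φ p c l) =ᶠ[𝓝 p] fun q => dx φ q + l * (4 * (q.2 - p.2) ^ 3) := by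
    filter_upwards [isOpen_Q.mem_nhds hp] with q hq using dx_raise hφ hq
  rw [dx_congr h1]
  have h2 := hasDerivAt_slice one_ne_zero (contDiffOn_dx (m := 1) (by norm_num) hφ) hp
  have h3 : HasDerivAt (fun y => l * (4 * (y - p.2) ^ 3)) 0 p.2 := by
    have := ((((hasDerivAt_id p.2).sub_const p.2).pow 3).const_mul 4).const_mul l
    exact this.congr_deriv (by simp)
  have h4 : HasDerivAt (fun y => dx φ (p.1, y) + l * (4 * (y - p.2) ^ 3)) (dx (dx φ) p + 0) p.2 :=
    h2.add h3
  rw [add_zero] at h4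
  exact h4.deriv

end Raise

/-! ### Strict, bounded and coercive test functions -/

section Touching

variable {V U : ℝ → ℝ} {E : Set ℝ} {a : ℝ → ℝ} {u : ℝ → ℝ × ℝ → ℝ} {M : ℝ}

lemma lt_raise {φ : ℝ × ℝ → ℝ} {p : ℝ × ℝ} {l : ℝ} (hl : 0 < l)
    (hmax : IsMaxOn (fun q => limsupStar E u q - φ q) Q p) {q : ℝ × ℝ} (hq : q ∈ Q) (hqp : q ≠ p) :
    limsupStar E u q < raise φ p (limsupStar E u p) l q := by
  have h1 := hmax hq
  simp only [mem_ofPred_eq] at h1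
  have h2 : 0 < (q.1 - p.1) ^ 2 + (q.2 - p.2) ^ 4 := by
    by_cases hx : q.2 = p.2
    · have := sub_ne_zero.2 fun h : q.1 = p.1 => hqp (Prod.ext h hx)
      positivity
    · have := sub_ne_zero.2 hx
      positivity
  have := mul_pos hl h2
  unfold raise
  linarith

/-- Localisation of a test function by means of an outer function `S`. -/
lemma TouchesAbove.of_blend {χ φ S : ℝ × ℝ → ℝ} {p : ℝ × ℝ} {r : ℝ} {K K' : Set (ℝ × ℝ)}
    (hχ : Cutoff χ p r K) (hp : p ∈ Q) (hφ : ContDiffOn ℝ 2 φ Q) (hφp : φ p = limsupStar E u p)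
    (hlt : ∀ q ∈ Q, q ≠ p → limsupStar E u q < φ q) (hS : ContDiffOn ℝ 2 S Q)
    (hltS : ∀ q ∈ Q, limsupStar E u q < S q) (hK' : IsCompact K') (hK'Q : K' ⊆ Q)
    (hout : ∀ q ∈ Q, q ∉ K' → M + 1 ≤ S q) : TouchesAbove E u M (blend χ φ S) p := by
  refine ⟨hp, hχ.contDiffOn_blend (k := 2) hφ hS, ?_, fun q hq hqp => ?_, K ∪ K',
    hχ.compact.union hK', union_subset hχ.subset hK'Q, fun q hq hqK => ?_⟩
  · rw [hχ.blend_eq (by rw [dist_self]; exact hχ.rpos.le), hφp]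
  · have h1 := hlt q hq hqp
    have h2 := hltS q hq
    have h3 := hχ.nonneg q
    have h4 := hχ.le_one q
    unfold blend
    rcases h3.eq_or_lt with h | h
    · rw [← h]
      linarith
    · nlinarith
  · rw [mem_union, not_or] at hqK
    have := hout q hq hqK.2
    unfold blend
    rw [hχ.eq_zero q hqK.1]
    linarith

/-- Replacement of a test function by a bounded, strict and coercive one. -/
lemma SubFamily.exists_touchesAbove (hF : SubFamily V U E a u M) {φ : ℝ × ℝ → ℝ} {p : ℝ × ℝ}
    (hp : p ∈ Q) (hφ : ContDiffOn ℝ 2 φ Q)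
    (hmax : IsMaxOn (fun q => limsupStar E u q - φ q) Q p) :
    ∃ Φ, TouchesAbove E u M Φ p ∧ (∃ C, ∀ q ∈ Q, |Φ q| ≤ C) ∧ dt Φ p = dt φ p ∧
      dx Φ p = dx φ p ∧ dxx Φ p = dxx φ p := by
  obtain ⟨χ, r, K, hχ, -, -⟩ := exists_cutoff hp one_pos
  have hr := contDiffOn_raise (p := p) (c := limsupStar E u p) (l := 1) hφ
  have hev : blend χ (raise φ p (limsupStar E u p) 1) (fun _ => M + 1) =ᶠ[𝓝 p] _ :=
    hχ.blend_eventuallyEq (by rw [dist_self]; exact hχ.rpos)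
  refine ⟨blend χ (raise φ p (limsupStar E u p) 1) fun _ => M + 1, ?_,
    hχ.exists_bound_blend hr.continuousOn (C := |M + 1|) (fun q _ => le_rfl), ?_, ?_, ?_⟩
  · refine TouchesAbove.of_blend (K' := ∅) hχ hp hr raise_self
      (fun q hq hqp => lt_raise one_pos hmax hq hqp) contDiffOn_const (fun q hq => ?_)
      isCompact_empty (empty_subset _) fun q _ _ => le_rfl
    have := (abs_le.1 (abs_limsupStar_le hF.zero_mem hF.bound hq)).2
    linarith
  · rw [dt_congr hev, dt_raise hφ hp]
  · rw [dx_congr hev, dx_raise hφ hp]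
    simp
  · rw [dxx_congr hev, dxx_raise hφ hp]

end Touching

/-! ### Uniform bounds on the rescaled kernels -/

section Bounds

variable {v : ℝ → ℝ}

lemma RepKernel.integral_scale_le (hv : RepKernel v)
    (hv2 : IntegrableOn (fun x => x ^ 2 * v x) (Ioi 0)) {a : ℝ} (ha : 0 < a) :
    ∫ z, min (z ^ 2) 1 * (a ^ 3 * v (a * z)) ≤ 2 * ∫ x in Ioi (0 : ℝ), x ^ 2 * v x := by
  obtain ⟨h1, h2⟩ := hv.scale ha
  rw [h1.integral_min, h2]
  refine mul_le_mul_of_nonneg_left ?_ zero_le_two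
  refine integral_mono_of_nonneg ?_ hv2 ?_
  · refine (ae_restrict_iff' measurableSet_Ioi).2 (ae_of_all _ fun z hz => ?_)
    exact mul_nonneg (by positivity) (hv.nonneg z (ne_of_gt hz))
  · refine (ae_restrict_iff' measurableSet_Ioi).2 (ae_of_all _ fun z hz => ?_)
    exact mul_le_mul_of_nonneg_right (min_le_left _ _) (hv.nonneg z (ne_of_gt hz))

/-- Without a finite second moment at infinity the bound is only uniform for bounded `a`, from `min
(z²) (a²) ≤ (1 + A²) min (z²) 1`; this suffices when `m = 1`. -/
lemma RepKernel.integral_scale_le_of_le (hv : RepKernel v) {a A : ℝ} (ha : 0 < a) (haA : a ≤ A) :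
    ∫ z, min (z ^ 2) 1 * (a ^ 3 * v (a * z))
      ≤ 2 * ((1 + A ^ 2) * ∫ z in Ioi (0 : ℝ), min (z ^ 2) 1 * v z) := by
  obtain ⟨h1, h2⟩ := hv.scale ha
  rw [h1.integral_min, h2, ← integral_const_mul (1 + A ^ 2)]
  refine mul_le_mul_of_nonneg_left ?_ zero_le_two
  refine integral_mono_of_nonneg ?_ (hv.integrable.const_mul _) ?_
  · refine (ae_restrict_iff' measurableSet_Ioi).2 (ae_of_all _ fun z hz => ?_)
    exact mul_nonneg (by positivity) (hv.nonneg z (ne_of_gt hz))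
  · refine (ae_restrict_iff' measurableSet_Ioi).2 (ae_of_all _ fun z hz => ?_)
    simp only
    rw [← mul_assoc]
    refine mul_le_mul_of_nonneg_right ?_ (hv.nonneg z (ne_of_gt hz))
    have h3 : a ^ 2 ≤ A ^ 2 := pow_le_pow_left₀ ha.le haA 2
    rcases le_total (z ^ 2) 1 with h | h
    · rw [min_eq_left h]
      have := min_le_left (z ^ 2) (a ^ 2)
      nlinarith [sq_nonneg A, sq_nonneg z]
    · rw [min_eq_right h]
      have := min_le_right (z ^ 2) (a ^ 2)
      linarith

end Bounds

/-! ### The local regimes -/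

section Local

variable {V U : ℝ → ℝ} {E : Set ℝ} {a : ℝ → ℝ} {u : ℝ → ℝ × ℝ → ℝ} {M α β : ℝ}

lemma SubFamily.eventually_pos (hF : SubFamily V U E a u M) :
    ∀ᶠ ε in 𝓝[E] (0 : ℝ), 0 < a ε ∧ 0 < ε := by
  filter_upwards [self_mem_nhdsWithin] with ε hε using ⟨hF.apos ε hε, hF.pos hε⟩

lemma SubFamily.critical_one (hF : SubFamily V U E a u M) (hV : AssumptionOne V) (hα : 0 < α)
    (ha : Tendsto a (𝓝[E] 0) (𝓝 α)) {φ : ℝ × ℝ → ℝ} {p : ℝ × ℝ} (hp : p ∈ Q)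
    (hmax : IsMaxOn (fun q => limsupStar E u q - φ q) Q p) (hφ : IsQuarticAt p.2 φ) :
    dt φ p ≤ 0 := by
  have h2 : ∀ᶠ ε in 𝓝[E] 0, a ε ≤ 2 * α := ha.eventually_le_const (by linarith)
  refine hF.critical ⟨2 * ((1 + (2 * α) ^ 2) * ∫ z in Ioi (0 : ℝ), min (z ^ 2) 1 *
    iteratedDeriv 2 V z), ?_⟩ ?_ hp hmax hφ
  · filter_upwards [hF.eventually_pos, h2] with ε h3 h4
    exact hF.kernel.integral_scale_le_of_le h3.1 h4
  · obtain ⟨W, hW⟩ := hV.exists_majorant (2 * α)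
    refine ⟨W, 1, one_pos, ?_⟩
    filter_upwards [hF.eventually_pos, h2] with ε h3 h4 P hP δ hδ
    obtain ⟨h5, h6⟩ := h3
    refine hW.mono fun x hx => ⟨lt_of_lt_of_le ?_ hx.1, hx.2.trans ?_⟩
    · have := hP.1
      positivity
    · exact (mul_le_of_le_one_right h5.le hδ.2).trans h4

lemma SubFamily.critical_two (hF : SubFamily V U E a u M) (hV : AssumptionTwo V)
    {φ : ℝ × ℝ → ℝ} {p : ℝ × ℝ} (hp : p ∈ Q)
    (hmax : IsMaxOn (fun q => limsupStar E u q - φ q) Q p) (hφ : IsQuarticAt p.2 φ) :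
    dt φ p ≤ 0 := by
  refine hF.critical ⟨_, hF.eventually_pos.mono fun ε h =>
    hF.kernel.integral_scale_le hV.integrable_sq h.1⟩ ?_ hp hmax hφ
  obtain ⟨W, hW⟩ := hV.exists_majorant
  refine ⟨W, 1, one_pos, ?_⟩
  filter_upwards [hF.eventually_pos] with ε h3 P hP δ hδ
  obtain ⟨h5, h6⟩ := h3
  refine hW.mono fun x hx => mem_Ioi.2 (lt_of_lt_of_le ?_ hx.1)
  have := hP.1
  positivity

lemma SubFamily.critical_three (hF : SubFamily V U E a u M) (hV : AssumptionThree V) (hβ : 0 < β)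
    (haε : Tendsto (fun ε => ε * a ε) (𝓝[E] 0) (𝓝 β)) {φ : ℝ × ℝ → ℝ} {p : ℝ × ℝ} (hp : p ∈ Q)
    (hmax : IsMaxOn (fun q => limsupStar E u q - φ q) Q p) (hφ : IsQuarticAt p.2 φ) :
    dt φ p ≤ 0 := by
  refine hF.critical ⟨_, hF.eventually_pos.mono fun ε h =>
    hF.kernel.integral_scale_le hV.integrable_sq h.1⟩ ?_ hp hmax hφ
  obtain ⟨W, hW⟩ := hV.exists_majorant one_pos
  -- With `P ≤ β/2` and eventually `εa ≥ β/2`, scaled distances are at least 1, where `W` is a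
  -- majorant.
  refine ⟨W, β / 2, by positivity, ?_⟩
  filter_upwards [haε.eventually_const_le (show β / 2 < β by linarith)] with ε h3 P hP δ hδ
  refine hW.mono fun x hx => mem_Ici.2 (le_trans ?_ hx.1)
  rw [le_div_iff₀ hP.1, one_mul, mul_comm]
  exact hP.2.trans h3

theorem SubFamily.isViscSub_two (hF : SubFamily V U E a u M) (hV : AssumptionTwo V)
    (ha : Tendsto a (𝓝[E] 0) atTop) (haε : Tendsto (fun ε => ε * a ε) (𝓝[E] 0) (𝓝 0)) :
    IsViscSub 2 (hamLocal (f2 V) U) (limsupStar E u) := by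
  refine ⟨upperSemicontinuousOn_limsupStar hF.zero_mem hF.bound,
    ⟨M, fun p hp => abs_limsupStar_le hF.zero_mem hF.bound hp⟩, fun φ hφ p hp hmax hdx => ?_,
    fun φ _ p hp hmax hq => hF.critical_two hV hp hmax hq⟩
  obtain ⟨Φ, hΦ, ⟨C, hC⟩, h1, h2, h3⟩ := hF.exists_touchesAbove hp hφ hmax
  have h4 := hF.noncritical_two hV ha haε hΦ hC (by rwa [h2])
  unfold hamLocal at h4 ⊢
  rwa [h1, h2, h3] at h4

theorem SubFamily.isViscSub_three (hF : SubFamily V U E a u M) (hV : AssumptionThree V)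
    (hβ : 0 < β) (haε : Tendsto (fun ε => ε * a ε) (𝓝[E] 0) (𝓝 β)) :
    IsViscSub 3 (hamLocal (f3 V β) U) (limsupStar E u) := by
  refine ⟨upperSemicontinuousOn_limsupStar hF.zero_mem hF.bound,
    ⟨M, fun p hp => abs_limsupStar_le hF.zero_mem hF.bound hp⟩, fun φ hφ p hp hmax hdx => ?_,
    fun φ _ p hp hmax hq => hF.critical_three hV hβ haε hp hmax hq⟩
  obtain ⟨Φ, hΦ, ⟨C, hC⟩, h1, h2, h3⟩ := hF.exists_touchesAbove hp
    (hφ.of_le (by norm_num)) hmax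
  have h4 := hF.noncritical_three hV hβ haε hΦ hC (by rwa [h2])
  unfold hamLocal at h4 ⊢
  rwa [h1, h2, h3] at h4

end Local

/-! ### Smooth approximation of upper semicontinuous functions from above -/

section SupConv

variable {u : ℝ × ℝ → ℝ} {M : ℝ}

/-- The sup-convolution of `u` on `Q`, at slope `n`. -/
noncomputable def supConv (u : ℝ × ℝ → ℝ) (n : ℕ) (q : ℝ × ℝ) : ℝ :=
  ⨆ x : Q, (u x - n * dist q x)

lemma bddAbove_supConv (hM : ∀ q ∈ Q, |u q| ≤ M) (n : ℕ) (q : ℝ × ℝ) :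
    BddAbove (range fun x : Q => u x - n * dist q x) := by
  refine ⟨M, ?_⟩
  rintro _ ⟨x, rfl⟩
  have h1 := (abs_le.1 (hM x x.2)).2
  have h2 : 0 ≤ (n : ℝ) * dist q x := by positivity
  simp only
  linarith

lemma nonempty_Q : Nonempty Q := ⟨⟨(1, 0), mem_Q.2 one_pos⟩⟩

lemma le_supConv (hM : ∀ q ∈ Q, |u q| ≤ M) (n : ℕ) {q : ℝ × ℝ} (hq : q ∈ Q) :
    u q ≤ supConv u n q := by
  have : u q - n * dist q q ≤ supConv u n q := le_ciSup (bddAbove_supConv hM n q) ⟨q, hq⟩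
  simpa using this

lemma supConv_le (hM : ∀ q ∈ Q, |u q| ≤ M) (n : ℕ) (q : ℝ × ℝ) : supConv u n q ≤ M := by
  have := nonempty_Q
  refine ciSup_le fun x => ?_
  have h1 := (abs_le.1 (hM x x.2)).2
  have h2 : 0 ≤ (n : ℝ) * dist q x := by positivity
  linarith

lemma uniformContinuous_supConv (hM : ∀ q ∈ Q, |u q| ≤ M) (n : ℕ) :
    UniformContinuous (supConv u n) := by
  have := nonempty_Q
  refine (LipschitzWith.of_le_add_mul (n : NNReal) fun x y => ?_).uniformContinuous
  refine ciSup_le fun z => ?_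
  have h1 := le_ciSup (bddAbove_supConv hM n y) z
  have h2 : (n : ℝ) * dist y z ≤ n * (dist y x + dist x z) := by
    gcongr
    exact dist_triangle _ _ _
  rw [dist_comm y x] at h2
  simp only [NNReal.coe_natCast]
  unfold supConv
  linarith

/-- Points at distance at least `δ` lose `nδ`, eventually more than `M - c'`; closer points are
below `c'` by upper semicontinuity. -/
lemma tendsto_supConv (hu : UpperSemicontinuousOn u Q) (hM : ∀ q ∈ Q, |u q| ≤ M) {q : ℝ × ℝ}
    (hq : q ∈ Q) : Tendsto (fun n => supConv u n q) atTop (𝓝 (u q)) := by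
  have := nonempty_Q
  rw [tendsto_order]
  refine ⟨fun c hc => Eventually.of_forall fun n => hc.trans_le (le_supConv hM n hq),
    fun c hc => ?_⟩
  obtain ⟨c', h1, h2⟩ := exists_between hc
  obtain ⟨δ, hδ, hball⟩ := Metric.mem_nhdsWithin_iff.1 (hu q hq c' h1)
  have h3 : Tendsto (fun n : ℕ => (n : ℝ) * δ) atTop atTop :=
    tendsto_natCast_atTop_atTop.atTop_mul_const hδ
  filter_upwards [h3.eventually_ge_atTop (M - c')] with n hn
  refine lt_of_le_of_lt (ciSup_le fun x => ?_) h2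
  have h0 : 0 ≤ (n : ℝ) * dist q x := by positivity
  rcases lt_or_ge (dist (x : ℝ × ℝ) q) δ with h | h
  · have h4 : u x < c' := hball ⟨h, x.2⟩
    linarith
  · have h4 := (abs_le.1 (hM x x.2)).2
    rw [dist_comm] at h
    have h5 : (n : ℝ) * δ ≤ n * dist q x := by gcongr
    linarith

/-- Nonlocality is purely spatial, so the cutoffs need only exhaust the time slice of `p`, while
their support remains in a fixed time interval away from zero. -/
lemma exists_wide_cutoff {p : ℝ × ℝ} (hp : p ∈ Q) (n : ℕ) :
    ∃ (χ : ℝ × ℝ → ℝ) (r : ℝ) (K : Set (ℝ × ℝ)), Cutoff χ p r K ∧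
      ∀ y, |y - p.2| ≤ n → χ (p.1, y) = 1 := by
  have hp1 := mem_Q.1 hp
  let b : ContDiffBump p.1 := ⟨p.1 / 3, p.1 / 2, by positivity, by linarith⟩
  let c : ContDiffBump p.2 := ⟨n + 1, n + 2, by positivity, by linarith⟩
  refine ⟨fun q => b q.1 * c q.2, min (p.1 / 3) (n + 1),
    Metric.closedBall p.1 (p.1 / 2) ×ˢ Metric.closedBall p.2 (n + 2),
    ⟨fun k => (b.contDiff.comp contDiff_fst).mul (c.contDiff.comp contDiff_snd),
      fun q => mul_nonneg b.nonneg c.nonneg, fun q => mul_le_one₀ b.le_one c.nonneg c.le_one,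
      by positivity, fun q hq => ?_, (isCompact_closedBall _ _).prod (isCompact_closedBall _ _),
      fun q hq => ?_, fun q hq => ?_⟩, fun y hy => ?_⟩
  · rw [Prod.dist_eq, max_le_iff, le_min_iff, le_min_iff] at hq
    rw [b.one_of_mem_closedBall hq.1.1, c.one_of_mem_closedBall hq.2.2, one_mul]
  · have h1 : dist q.1 p.1 ≤ p.1 / 2 := hq.1
    rw [Real.dist_eq] at h1
    have := (abs_le.1 h1).1
    exact mem_Q.2 (by linarith)
  · rw [mem_prod, not_and_or] at hq
    rcases hq with hq | hq
    · rw [b.zero_of_le_dist (not_le.1 hq).le, zero_mul]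
    · rw [c.zero_of_le_dist (not_le.1 hq).le, mul_zero]
  · have h1 : c y = 1 := c.one_of_mem_closedBall (by
      rw [Metric.mem_closedBall, Real.dist_eq]
      exact hy.trans (show (n : ℝ) ≤ n + 1 by linarith))
    have h2 : b p.1 = 1 := b.one_of_mem_closedBall (Metric.mem_closedBall_self (by positivity))
    simp only [h1, h2, one_mul]

/-- Smooth functions above `u`, equal to a large constant outside of a compact set, which converge
to `u` on a given time slice. -/
lemma exists_outer (hu : UpperSemicontinuousOn u Q) (hM : ∀ q ∈ Q, |u q| ≤ M) {p : ℝ × ℝ}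
    (hp : p ∈ Q) : ∃ S : ℕ → ℝ × ℝ → ℝ, (∀ n, ContDiffOn ℝ 2 (S n) Q ∧ (∀ q ∈ Q, u q < S n q) ∧
      (∀ q ∈ Q, |S n q| ≤ M + 2) ∧
      ∃ K, IsCompact K ∧ K ⊆ Q ∧ ∀ q ∈ Q, q ∉ K → M + 1 ≤ S n q) ∧
      ∀ y, Tendsto (fun n => S n (p.1, y)) atTop (𝓝 (u (p.1, y))) := by
  have hM0 : 0 ≤ M := (abs_nonneg _).trans (hM p hp)
  have hη : ∀ n : ℕ, (0 : ℝ) < 1 / ((n : ℝ) + 1) := fun n => by positivity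
  have hη1 : ∀ n : ℕ, 1 / ((n : ℝ) + 1) ≤ (1 : ℝ) := fun n => by
    rw [div_le_one (by positivity)]
    linarith [Nat.cast_nonneg (α := ℝ) n]
  -- Sup-convolutions are uniformly continuous, hence uniformly close to smooth functions; adding
  -- the error `1/(n+1)` restores strict order above `u`.
  choose g hg hgd using fun n => (uniformContinuous_supConv hM n).exists_contDiff_dist_le (hη n)
  choose χ r K hχ hχ1 using fun n => exists_wide_cutoff hp n
  set s : ℕ → ℝ × ℝ → ℝ := fun n q => g n q + 1 / ((n : ℝ) + 1) with hs
  have hgd' : ∀ n q, |g n q - supConv u n q| < 1 / ((n : ℝ) + 1) := fun n q => by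
    rw [← Real.dist_eq]
    exact hgd n q
  have hs1 : ∀ n, ∀ q ∈ Q, u q < s n q := fun n q hq => by
    have h1 := (abs_lt.1 (hgd' n q)).1
    have h2 := le_supConv hM n hq
    simp only [hs]
    linarith
  have hs2 : ∀ n q, s n q ≤ M + 2 := fun n q => by
    have h1 := (abs_lt.1 (hgd' n q)).2
    have h2 := supConv_le hM n q
    have := hη1 n
    simp only [hs]
    linarith
  have hsc : ∀ n, ContDiffOn ℝ 2 (s n) Q := fun n =>
    ((contDiff_infty.1 (hg n) 2).add contDiff_const).contDiffOn
  refine ⟨fun n => blend (χ n) (s n) fun _ => M + 1, fun n => ⟨?_, fun q hq => ?_, fun q hq => ?_,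
    K n, (hχ n).compact, (hχ n).subset, fun q _ hqK => ?_⟩, fun y => ?_⟩
  · exact (hχ n).contDiffOn_blend (k := 2) (hsc n) contDiffOn_const
  · have h1 := hs1 n q hq
    have h2 := (abs_le.1 (hM q hq)).2
    have h3 := (hχ n).nonneg q
    have h4 := (hχ n).le_one q
    simp only [blend]
    rcases h4.eq_or_lt with h | h
    · rw [h]
      linarith
    · nlinarith
  · have h1 := hs1 n q hq
    have h2 := (abs_le.1 (hM q hq)).1
    have h3 := (hχ n).nonneg q
    have h4 := (hχ n).le_one q
    have h5 := hs2 n q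
    simp only [blend]
    rw [abs_le]
    constructor
    · nlinarith
    · nlinarith
  · simp only [blend]
    rw [(hχ n).eq_zero q hqK]
    linarith
  · have hinv : Tendsto (fun n : ℕ => 1 / ((n : ℝ) + 1)) atTop (𝓝 0) :=
      tendsto_one_div_add_atTop_nhds_zero_nat
    have h1 := tendsto_supConv hu hM (show (p.1, y) ∈ Q from mem_Q.2 (mem_Q.1 hp))
    have h2 : Tendsto (fun n => g n (p.1, y) - supConv u n (p.1, y)) atTop (𝓝 0) :=
      squeeze_zero_norm (fun n => (hgd' n _).le) hinv
    have h3 := (h2.add h1).add hinv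
    simp only [sub_add_cancel, zero_add, add_zero] at h3
    refine h3.congr' ?_
    filter_upwards [tendsto_natCast_atTop_atTop.eventually_ge_atTop |y - p.2|] with n hn
    simp [blend, hχ1 n y hn, hs]

end SupConv

/-! ### The nonlocal regime -/

section Nonlocal

variable {V U : ℝ → ℝ} {E : Set ℝ} {a : ℝ → ℝ} {u : ℝ → ℝ × ℝ → ℝ} {M α : ℝ}

/-- The inequality for bounded test functions is applied to `Φ n`, equal to the raised `φ` near `p`
and decreasing the gap to `w` elsewhere. In the limit the increments become a `χ`-blend of those of
`φ` and `w`: equal to those of `w` for `|z| ≥ ρ`, as `χ` is supported in the ball of radius `ρ/2`,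
and at most those of `φ` inside, by maximality. -/
lemma SubFamily.noncritical_one_of_isMaxOn (hF : SubFamily V U E a u M) (hV : AssumptionOne V)
    (hα : 0 < α) (ha : Tendsto a (𝓝[E] 0) (𝓝 α)) {φ : ℝ × ℝ → ℝ} {p : ℝ × ℝ} (hp : p ∈ Q)
    (hφ : ContDiffOn ℝ 2 φ Q) (hmax : IsMaxOn (fun q => limsupStar E u q - φ q) Q p)
    (hdx : dx φ p ≠ 0) {ρ : ℝ} (hρ : 0 < ρ) : dt φ p ≤ hamOne V U α ρ (limsupStar E u) φ p := by
  have hp1 := mem_Q.1 hp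
  set w := limsupStar E u with hw
  have husc : UpperSemicontinuousOn w Q := upperSemicontinuousOn_limsupStar hF.zero_mem hF.bound
  have hM : ∀ q ∈ Q, |w q| ≤ M := fun q hq => abs_limsupStar_le hF.zero_mem hF.bound hq
  obtain ⟨S, hS, hSlim⟩ := exists_outer husc hM hp
  obtain ⟨χ, r, K, hχ, -, hKρ⟩ := exists_cutoff hp (half_pos hρ)
  set l : ℕ → ℝ := fun n => 1 / ((n : ℝ) + 1) with hl
  have hlpos : ∀ n, 0 < l n := fun n => by simp only [hl]; positivity
  have hl1 : ∀ n, l n ≤ 1 := fun n => by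
    simp only [hl]
    rw [div_le_one (by positivity)]
    linarith [Nat.cast_nonneg (α := ℝ) n]
  have hllim : Tendsto l atTop (𝓝 0) := tendsto_one_div_add_atTop_nhds_zero_nat
  set Φ : ℕ → ℝ × ℝ → ℝ := fun n => blend χ (raise φ p (w p) (l n)) (S n) with hΦ
  have hrc : ∀ n, ContDiffOn ℝ 2 (raise φ p (w p) (l n)) Q := fun n => contDiffOn_raise hφ
  have hev : ∀ n, Φ n =ᶠ[𝓝 p] raise φ p (w p) (l n) := fun n =>
    hχ.blend_eventuallyEq (by rw [dist_self]; exact hχ.rpos)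
  have hdxΦ : ∀ n, dx (Φ n) p = dx φ p := fun n => by
    rw [dx_congr (hev n), dx_raise hφ hp]
    simp
  have hdtΦ : ∀ n, dt (Φ n) p = dt φ p := fun n => by
    rw [dt_congr (hev n), dt_raise hφ hp]
  have hΦp : ∀ n, Φ n p = w p := fun n => by rw [(hev n).self_of_nhds, raise_self]
  have hΦc : ∀ n, ContDiffOn ℝ 2 (Φ n) Q := fun n => hχ.contDiffOn_blend (k := 2) (hrc n) (hS n).1
  have hmain : ∀ n, dt φ p ≤ hamOne V U α ρ (Φ n) (Φ n) p := by
    intro n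
    obtain ⟨h1, h2, h3, K', hK', hK'Q, hout⟩ := hS n
    obtain ⟨C, hC⟩ := hχ.exists_bound_blend (hrc n).continuousOn h3
    rw [← hdtΦ n]
    exact hF.noncritical_one hV hα ha (TouchesAbove.of_blend hχ hp (hrc n) raise_self
      (fun q hq hqp => lt_raise (hlpos n) hmax hq hqp) h1 h2 hK' hK'Q hout) hC
      (by rw [hdxΦ n]; exact hdx) hρ
  -- The bound must not depend on `n`, as it enters the dominating functions; on `K` the penalty is
  -- compared with its value for coefficient 1.
  obtain ⟨C, hC⟩ : ∃ C, ∀ n, ∀ q ∈ Q, |Φ n q| ≤ C := by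
    have hcont : ContinuousOn (fun q : ℝ × ℝ => |raise φ p (w p) 0 q|
        + ((q.1 - p.1) ^ 2 + (q.2 - p.2) ^ 4)) K :=
      ((contDiffOn_raise hφ).continuousOn.mono hχ.subset).abs.add (by fun_prop)
    obtain ⟨C₁, hC₁⟩ := hχ.compact.exists_bound_of_continuousOn hcont
    refine ⟨max C₁ 0 + (M + 2), fun n q hq => ?_⟩
    have h0 := hχ.nonneg q
    have h1 := hχ.le_one q
    refine (abs_add_le _ _).trans ?_
    rw [abs_mul, abs_mul, abs_of_nonneg h0, abs_of_nonneg (sub_nonneg.2 h1)]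
    refine add_le_add ?_ ((mul_le_of_le_one_left (abs_nonneg _) (by linarith)).trans
      ((hS n).2.2.1 q hq))
    by_cases hK : q ∈ K
    · refine (mul_le_of_le_one_left (abs_nonneg _) h1).trans (le_trans ?_ (le_max_left _ _))
      refine le_trans ?_ ((le_abs_self _).trans (hC₁ q hK))
      have e : raise φ p (w p) (l n) q = raise φ p (w p) 0 q
          + l n * ((q.1 - p.1) ^ 2 + (q.2 - p.2) ^ 4) := by
        unfold raise
        ring
      rw [e]
      refine (abs_add_le _ _).trans (add_le_add le_rfl ?_)
      rw [abs_of_nonneg (mul_nonneg (hlpos n).le (by positivity))]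
      exact mul_le_of_le_one_left (by positivity) (hl1 n)
    · rw [hχ.eq_zero q hK, zero_mul]
      exact le_max_right _ _
  have hmem : ∀ z, (p.1, p.2 + z) ∈ Q := fun z => mem_Q.2 hp1
  set k := rescaleD2 α V with hk
  have hker : RepKernel k := by
    have : k = fun z => α ^ 3 * iteratedDeriv 2 V (α * z) := funext fun z => rescaleD2_eq α V z
    rw [this]
    exact (hF.kernel.scale hα).1
  set D := dx φ p with hD
  set Ψ : ℕ → ℝ → ℝ := fun n z => Φ n (p.1, p.2 + z) - w p with hΨ
  set Ψ₀ : ℝ → ℝ := fun z => χ (p.1, p.2 + z) * (φ (p.1, p.2 + z) - φ p)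
    + (1 - χ (p.1, p.2 + z)) * (w (p.1, p.2 + z) - w p) with hΨ₀
  have hham : ∀ n, hamOne V U α ρ (Φ n) (Φ n) p = ((∫ z in {z : ℝ | |z| < ρ}, (Ψ n z - D * z) * k z)
      + (∫ z in {z : ℝ | ρ ≤ |z|}, Ψ n z * k z) + deriv U p.2) * |D| := by
    intro n
    rw [← hdxΦ n, hΨ, ← hΦp n]
    rfl
  have hlim : ∀ z, Tendsto (fun n => Ψ n z) atTop (𝓝 (Ψ₀ z)) := by
    intro z
    have h1 : Tendsto (fun n => raise φ p (w p) (l n) (p.1, p.2 + z)) atTop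
        (𝓝 (φ (p.1, p.2 + z) - φ p + w p)) := by
      have := (hllim.mul_const ((p.1 - p.1) ^ 2 + (p.2 + z - p.2) ^ 4)).const_add
        (φ (p.1, p.2 + z) - φ p + w p)
      rw [zero_mul, add_zero] at this
      exact this
    have h2 := ((h1.const_mul (χ (p.1, p.2 + z))).add
      ((hSlim (p.2 + z)).const_mul (1 - χ (p.1, p.2 + z)))).sub_const (w p)
    have e : Ψ₀ z = χ (p.1, p.2 + z) * (φ (p.1, p.2 + z) - φ p + w p)
        + (1 - χ (p.1, p.2 + z)) * w (p.1, p.2 + z) - w p := by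
      simp only [hΨ₀]
      ring
    rw [e]
    exact h2
  have hΨm : ∀ n, Measurable (Ψ n) := fun n =>
    (((continuous_slice (hΦc n).continuousOn hp1).comp
      (continuous_const.add continuous_id)).sub continuous_const).measurable
  have hΨ₀m : Measurable Ψ₀ := measurable_of_tendsto_metrizable hΨm (tendsto_pi_nhds.2 hlim)
  have hΨC : ∀ n z, |Ψ n z| ≤ C + M := fun n z =>
    (abs_sub _ _).trans (add_le_add (hC n _ (hmem z)) (hM p hp))
  have hΨ₀C : ∀ z, |Ψ₀ z| ≤ C + M := fun z =>
    le_of_tendsto (hlim z).abs (Eventually.of_forall fun n => hΨC n z)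
  obtain ⟨δ, hδ, hTay⟩ := exists_taylor hφ hp one_pos
  set r' := min (min r δ) 1 with hr'
  have hr'0 : 0 < r' := lt_min (lt_min hχ.rpos hδ) one_pos
  have hTφ : ∀ z, |z| ≤ r' → |φ (p.1, p.2 + z) - φ p - D * z| ≤ (|dxx φ p| / 2 + 1) * z ^ 2 := by
    intro z hz
    have h1 := hTay p hp (by simpa using hδ) z
      (hz.trans ((min_le_left _ _).trans (min_le_right _ _)))
    have e1 : φ (p.1, p.2 + z) - φ p - D * z = (φ (p.1, p.2 + z) - φ p - dx φ p * z
        - dxx φ p / 2 * z ^ 2) + dxx φ p / 2 * z ^ 2 := by ring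
    rw [e1]
    refine (abs_add_le _ _).trans ?_
    rw [abs_mul, abs_div, abs_two, abs_of_nonneg (sq_nonneg z)]
    linarith
  have hTn : ∀ n z, |z| ≤ r' → |Ψ n z - D * z| ≤ (|dxx φ p| / 2 + 2) * z ^ 2 := by
    intro n z hz
    have h1 : dist (p.1, p.2 + z) p ≤ r := by
      have : dist (p.1, p.2 + z) p = |z| := by simp [Prod.dist_eq]
      rw [this]
      exact hz.trans ((min_le_left _ _).trans (min_le_left _ _))
    have e1 : Ψ n z - D * z = (φ (p.1, p.2 + z) - φ p - D * z) + l n * z ^ 4 := by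
      have e2 : Φ n (p.1, p.2 + z) = raise φ p (w p) (l n) (p.1, p.2 + z) := hχ.blend_eq h1
      simp only [hΨ]
      rw [e2]
      unfold raise
      ring
    rw [e1]
    refine (abs_add_le _ _).trans ?_
    have h2 := hTφ z hz
    have h3 : |l n * z ^ 4| ≤ z ^ 2 := by
      rw [abs_of_nonneg (mul_nonneg (hlpos n).le (by positivity))]
      have h4 : z ^ 2 ≤ 1 := by
        rw [← sq_abs]
        exact pow_le_one₀ (abs_nonneg z) (hz.trans (min_le_right _ _))
      calc l n * z ^ 4 ≤ 1 * z ^ 4 := by gcongr; exact hl1 n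
        _ = z ^ 2 * z ^ 2 := by ring
        _ ≤ z ^ 2 * 1 := by gcongr
        _ = z ^ 2 := mul_one _
    linarith
  have hT₀ : ∀ z, |z| ≤ r' → |Ψ₀ z - D * z| ≤ (|dxx φ p| / 2 + 2) * z ^ 2 := fun z hz =>
    le_of_tendsto ((hlim z).sub_const _).abs (Eventually.of_forall fun n => hTn n z hz)
  have hL1 : Tendsto (fun n => ∫ z in {z : ℝ | |z| < ρ}, (Ψ n z - D * z) * k z) atTop
      (𝓝 (∫ z in {z : ℝ | |z| < ρ}, (Ψ₀ z - D * z) * k z)) := by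
    refine tendsto_integral_filter_of_dominated_convergence _
      (Eventually.of_forall fun n => (integrableOn_compensated hker (hΨm n) (hΨC n) hr'0
        (min_le_right _ _) (hTn n) hρ).1) (Eventually.of_forall fun n => ae_near fun z hz hzρ =>
        abs_compensated_le hker (hΨC n) hr'0 (min_le_right _ _) (hTn n) hρ hz hzρ)
      ((hker.integrable_min.const_mul _).integrableOn) (ae_of_all _ fun z => ?_)
    exact ((hlim z).sub_const _).mul_const _
  have hL2 : Tendsto (fun n => ∫ z in {z : ℝ | ρ ≤ |z|}, Ψ n z * k z) atTop
      (𝓝 (∫ z in {z : ℝ | ρ ≤ |z|}, Ψ₀ z * k z)) := by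
    refine tendsto_integral_filter_of_dominated_convergence (fun z => (C + M) * ‖k z‖)
      (Eventually.of_forall fun n => (hker.integrableOn_far_mul hρ (hΨm n) (hΨC n)).1)
      (Eventually.of_forall fun n => ae_of_all _ fun z => ?_)
      ((hker.integrableOn_far hρ).norm.const_mul _) (ae_of_all _ fun z => (hlim z).mul_const _)
    rw [norm_mul]
    exact mul_le_mul_of_nonneg_right (hΨC n z) (norm_nonneg _)
  have hfin := ge_of_tendsto (((hL1.add hL2).add_const (deriv U p.2)).mul_const |D|)
    (Eventually.of_forall fun n => (hmain n).trans_eq (hham n))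
  refine hfin.trans ?_
  unfold hamOne opOne
  refine mul_le_mul_of_nonneg_right (add_le_add (add_le_add ?_ (le_of_eq ?_)) le_rfl)
    (abs_nonneg _)
  · refine integral_mono_ae (integrableOn_compensated hker hΨ₀m hΨ₀C hr'0 (min_le_right _ _) hT₀ hρ)
      ?_ (ae_near fun z hz hzρ => ?_)
    · obtain ⟨B, hB⟩ := (isCompact_Icc (a := -ρ) (b := ρ)).exists_bound_of_continuousOn
        (((continuous_slice hφ.continuousOn hp1).comp
          (continuous_const.add continuous_id)).sub (continuous_const (y := φ p))).continuousOn
      -- The increment of `φ` may be unbounded on the line; cutting it off at `ρ` does not affect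
      -- the integral.
      set F : ℝ → ℝ := {z : ℝ | |z| < ρ}.indicator fun z => φ (p.1, p.2 + z) - φ p with hFdef
      have hFm : Measurable F := Measurable.indicator
        (((continuous_slice hφ.continuousOn hp1).comp
          (continuous_const.add continuous_id)).sub continuous_const).measurable
        (measurableSet_near ρ)
      have hFC : ∀ z, |F z| ≤ max B 0 := by
        intro z
        by_cases hz : z ∈ {z : ℝ | |z| < ρ}
        · rw [hFdef, indicator_of_mem hz]
          have hz' : |z| < ρ := hz
          exact (hB z (abs_le.1 hz'.le)).trans (le_max_left _ _)
        · rw [hFdef, indicator_of_notMem hz, abs_zero]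
          exact le_max_right _ _
      have h1 := integrableOn_compensated (ρ := ρ) hker hFm hFC
        (lt_min hr'0 (half_pos hρ)) ((min_le_left _ _).trans (min_le_right _ _)) (p := D)
        (C' := |dxx φ p| / 2 + 1) (fun z hz => by
          have hzρ : |z| < ρ := by
            have := hz.trans (min_le_right _ _)
            linarith
          rw [hFdef, indicator_of_mem (show z ∈ {z : ℝ | |z| < ρ} from hzρ)]
          exact hTφ z (hz.trans (min_le_left _ _))) hρ
      refine h1.congr_fun (fun z hz => ?_) (measurableSet_near ρ)
      simp only [hFdef, indicator_of_mem hz]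
      rfl
    · refine mul_le_mul_of_nonneg_right (sub_le_sub_right ?_ _) (hker.nonneg z hz)
      have h1 := hmax (hmem z)
      simp only [mem_ofPred_eq] at h1
      have h2 := hχ.le_one (p.1, p.2 + z)
      have h3 : Ψ₀ z ≤ φ (p.1, p.2 + z) - φ p := by
        simp only [hΨ₀]
        nlinarith
      exact h3
  · refine setIntegral_congr_fun (RepKernel.measurableSet_far ρ) fun z hz => ?_
    have hz' : ρ ≤ |z| := hz
    have h1 : (p.1, p.2 + z) ∉ K := fun h => by
      have h2 : dist (p.1, p.2 + z) p ≤ ρ / 2 := hKρ h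
      have h3 : dist (p.1, p.2 + z) p = |z| := by simp [Prod.dist_eq]
      linarith
    simp only [hΨ₀, hχ.eq_zero _ h1]
    ring

theorem SubFamily.isViscSub_one (hF : SubFamily V U E a u M) (hV : AssumptionOne V)
    (hα : 0 < α) (ha : Tendsto a (𝓝[E] 0) (𝓝 α)) {ρ : ℝ} (hρ : 0 < ρ) :
    IsViscSub 2 (hamOne V U α ρ (limsupStar E u)) (limsupStar E u) :=
  ⟨upperSemicontinuousOn_limsupStar hF.zero_mem hF.bound,
    ⟨M, fun _ hp => abs_limsupStar_le hF.zero_mem hF.bound hp⟩,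
    fun _ hφ _ hp hmax hdx => hF.noncritical_one_of_isMaxOn hV hα ha hp hφ hmax hdx hρ,
    fun _ _ _ hp hmax hq => hF.critical_one hV hα ha hp hmax hq⟩

end Nonlocal

/-! ### Duality between sub- and supersolutions -/

section Duality

variable {V U : ℝ → ℝ} {E : Set ℝ} {a : ℝ → ℝ} {φ : ℝ × ℝ → ℝ} {p : ℝ × ℝ}

lemma dt_neg : dt (-φ) p = -dt φ p := deriv.fun_neg

lemma dx_neg : dx (-φ) p = -dx φ p := deriv.fun_neg

lemma dxx_neg : dxx (-φ) p = -dxx φ p := by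
  have h : dx (-φ) = -dx φ := funext fun q => dx_neg
  rw [dxx_eq, dxx_eq, h, dx_neg]

lemma deriv_neg_apply (x : ℝ) : deriv (-U) x = -deriv U x := deriv.neg

lemma IsQuarticAt.neg {x₀ : ℝ} (h : IsQuarticAt x₀ φ) : IsQuarticAt x₀ (-φ) := by
  obtain ⟨θ, g, hg, hφ⟩ := h
  refine ⟨-θ, -g, hg.neg, fun q hq => ?_⟩
  simp only [Pi.neg_apply, hφ q hq]
  ring

/-- The truncated integrals in the principal value are eventually constant at a noncritical
point. -/
lemma exists_eventually_const_pv {w ψ : ℝ → ℝ} {ε ρ x d : ℝ} (hw : RepKernel w) (hε : 0 < ε)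
    (hψ : Continuous ψ) (hd : HasDerivAt ψ d x) (hd0 : d ≠ 0) :
    ∃ I, ∀ᶠ r in 𝓝[>] (0 : ℝ),
      ∫ z in {z : ℝ | r < |z| ∧ |z| < ρ}, stair ε (ψ (x + z) - ψ x) * w z = I := by
  set f : ℝ → ℝ := fun z => stair ε (ψ (x + z) - ψ x) * w z with hf
  -- The even part of `f` has the same integral over symmetric annuli, and it vanishes near the
  -- origin.
  set h : ℝ → ℝ := fun z => 1 / 2 * (f z + f (-z)) with hh
  have hinc : Continuous fun z => ψ (x + z) - ψ x :=
    (hψ.comp (continuous_const.add continuous_id)).sub continuous_const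
  have hint : ∀ r, 0 < r → IntegrableOn f {z : ℝ | r < |z| ∧ |z| < ρ} := by
    intro r hr
    obtain ⟨B, hB⟩ := (isCompact_Icc (a := -ρ) (b := ρ)).exists_bound_of_continuousOn
      hinc.continuousOn
    set F : ℝ → ℝ := {z : ℝ | |z| < ρ}.indicator fun z => stair ε (ψ (x + z) - ψ x) with hF
    have hFm : Measurable F := Measurable.indicator
      ((measurable_stair hε).comp hinc.measurable) (measurableSet_near ρ)
    have hFC : ∀ z, |F z| ≤ max B 0 + ε / 2 := by
      intro z
      by_cases hz : z ∈ {z : ℝ | |z| < ρ}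
      · rw [hF, indicator_of_mem hz]
        have hz' : |z| < ρ := hz
        have h1 : |ψ (x + z) - ψ x| ≤ B := hB z (abs_le.1 hz'.le)
        have h2 := abs_stair_le hε (ψ (x + z) - ψ x)
        have h3 := le_max_left B 0
        linarith
      · rw [hF, indicator_of_notMem hz, abs_zero]
        positivity
    have h1 := (hw.integrableOn_far_mul hr hFm hFC).mono_set
      (fun z (hz : r < |z| ∧ |z| < ρ) => show r ≤ |z| from hz.1.le)
    refine h1.congr_fun (fun z hz => ?_) (measurableSet_annulus r ρ)
    rw [hF]
    simp only
    rw [indicator_of_mem (show z ∈ {z : ℝ | |z| < ρ} from hz.2)]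
  have heven : ∀ r, 0 < r → ∫ z in {z : ℝ | r < |z| ∧ |z| < ρ}, f z
      = ∫ z in {z : ℝ | r < |z| ∧ |z| < ρ}, h z := by
    intro r hr
    have hm := measurableSet_annulus r ρ
    have h1 := setIntegral_comp_neg_of_symm (F := f) hm (fun z => by simp)
    have h2 : IntegrableOn (fun z => f (-z)) {z : ℝ | r < |z| ∧ |z| < ρ} := by
      have := (Measure.measurePreserving_neg (volume : Measure ℝ)).integrableOn_comp_preimage
        (Homeomorph.neg ℝ).measurableEmbedding (f := f) (s := {z : ℝ | r < |z| ∧ |z| < ρ})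
      have h3 := this.2 (hint r hr)
      have e : (fun z : ℝ => -z) ⁻¹' {z : ℝ | r < |z| ∧ |z| < ρ} = {z : ℝ | r < |z| ∧ |z| < ρ} := by
        ext z
        simp
      rwa [e] at h3
    simp only [hh]
    rw [integral_const_mul, integral_add (hint r hr) h2, h1]
    ring
  -- Near a noncritical point the increments at `z` and `-z` have opposite signs and modulus below
  -- `ε`, so the staircase takes the values `±ε/2`, which cancel.
  obtain ⟨δ, hδ, hzero⟩ : ∃ δ > 0, ∀ z, z ≠ 0 → |z| < δ → h z = 0 := by
    have hstair : ∀ {γ γ'}, 0 < γ → γ < ε → γ' < 0 → -ε < γ' → stair ε γ + stair ε γ' = 0 := by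
      intro γ γ' h1 h2 h3 h4
      have e1 : ⌊γ / ε⌋ = 0 :=
        Int.floor_eq_zero_iff.2 ⟨by positivity, (div_lt_one hε).2 h2⟩
      have e2 : ⌊γ' / ε⌋ = -1 := by
        rw [Int.floor_eq_iff]
        push_cast
        refine ⟨(le_div_iff₀ hε).2 (by linarith), ?_⟩
        rw [neg_add_cancel]
        exact div_neg_of_neg_of_pos h3 hε
      unfold stair
      rw [e1, e2]
      push_cast
      ring
    have h1 : ∀ᶠ z in 𝓝[≠] (0 : ℝ), 0 < d * (z⁻¹ * (ψ (x + z) - ψ x)) := by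
      have h2 := (hasDerivAt_iff_tendsto_slope_zero.1 hd).const_mul d
      simp only [smul_eq_mul] at h2
      exact h2.eventually_const_lt (mul_self_pos.2 hd0)
    have h2 : ∀ᶠ z in 𝓝 (0 : ℝ), |ψ (x + z) - ψ x| < ε := by
      have h3 := hinc.abs.tendsto 0
      simp only [add_zero, sub_self, abs_zero] at h3
      exact h3.eventually_lt_const hε
    rw [eventually_nhdsWithin_iff] at h1
    obtain ⟨δ, hδ, hball⟩ := Metric.eventually_nhds_iff.1 (h1.and h2)
    refine ⟨δ, hδ, fun z hz hzδ => ?_⟩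
    obtain ⟨h3, h4⟩ := hball (y := z) (by simpa using hzδ)
    obtain ⟨h5, h6⟩ := hball (y := -z) (by simpa using hzδ)
    have h7 := h3 hz
    have h8 := h5 (neg_ne_zero.2 hz)
    have h9 := abs_lt.1 h4
    have h10 := abs_lt.1 h6
    have hsum : stair ε (ψ (x + z) - ψ x) + stair ε (ψ (x + -z) - ψ x) = 0 := by
      have e1 : d * (z⁻¹ * (ψ (x + z) - ψ x)) = (d * z⁻¹) * (ψ (x + z) - ψ x) := by ring
      have e2 : d * ((-z)⁻¹ * (ψ (x + -z) - ψ x)) = (d * z⁻¹) * -(ψ (x + -z) - ψ x) := by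
        rw [inv_neg]
        ring
      rw [e1] at h7
      rw [e2] at h8
      have hc : d * z⁻¹ ≠ 0 := mul_ne_zero hd0 (inv_ne_zero hz)
      rcases hc.lt_or_gt with hc | hc
      · have h11 := neg_of_mul_pos_right h7 hc.le
        have h12 := neg_of_mul_pos_right h8 hc.le
        rw [add_comm]
        exact hstair (by linarith) h10.2 h11 h9.1
      · have h11 := pos_of_mul_pos_right h7 hc.le
        have h12 := pos_of_mul_pos_right h8 hc.le
        exact hstair h11 h9.2 (by linarith) h10.1
    simp only [hh, hf, hw.even]
    rw [← add_mul, hsum, zero_mul, mul_zero]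
  refine ⟨∫ z in {z : ℝ | δ / 2 < |z| ∧ |z| < ρ}, h z, ?_⟩
  filter_upwards [Ioo_mem_nhdsGT (half_pos hδ)] with r hr
  rw [heven r hr.1]
  refine setIntegral_eq_of_subset_of_forall_sdiff_eq_zero
    (measurableSet_annulus r ρ) (fun z hz => ⟨hr.2.trans hz.1, hz.2⟩) fun z hz => ?_
  have h1 : r < |z| := hz.1.1
  refine hzero z (abs_pos.1 (hr.1.trans h1)) ?_
  by_contra h2
  exact hz.2 ⟨by linarith, hz.1.2⟩

/-- `limUnder` has an arbitrary value when there is no limit, so negation passes through only once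
convergence is known. -/
lemma pvBall_neg {ρ : ℝ} {f : ℝ → ℝ}
    (h : ∃ I, ∀ᶠ r in 𝓝[>] (0 : ℝ), ∫ z in {z : ℝ | r < |z| ∧ |z| < ρ}, f z = I) :
    pvBall ρ (fun z => -f z) = -pvBall ρ f := by
  obtain ⟨I, hI⟩ := h
  have h1 : Tendsto (fun r => ∫ z in {z : ℝ | r < |z| ∧ |z| < ρ}, f z) (𝓝[>] (0 : ℝ)) (𝓝 I) :=
    tendsto_const_nhds.congr' (hI.mono fun _ h => h.symm)
  have h2 : Tendsto (fun r => ∫ z in {z : ℝ | r < |z| ∧ |z| < ρ}, -f z) (𝓝[>] (0 : ℝ))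
      (𝓝 (-I)) := by
    simp_rw [integral_neg]
    exact h1.neg
  unfold pvBall
  rw [h1.limUnder_eq, h2.limUnder_eq]

lemma hamLower_neg {A ρ ε : ℝ} {u : ℝ × ℝ → ℝ} (hε : 0 < ε)
    (hw : RepKernel (rescaleD2 A V)) (hφ : ContDiffOn ℝ 2 φ Q) (hp : p ∈ Q) (hdx : dx φ p ≠ 0) :
    hamLower V U A ρ ε (-u) (-φ) p = -hamUpper V (-U) A ρ ε u φ p := by
  have hodd : ∀ x y c, stairLower ε (-x - -y) * c = -(stairUpper ε (x - y) * c) := by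
    intro x y c
    rw [stairLower_eq hε, stairUpper_eq hε, show -(-x - -y) = x - y by ring, neg_mul]
  have hpv := pvBall_neg (exists_eventually_const_pv (ρ := ρ) hw hε
    (continuous_slice hφ.continuousOn (mem_Q.1 hp)) (hasDerivAt_slice two_ne_zero hφ hp) hdx)
  simp only [← stairUpper_eq hε] at hpv
  have e1 : opEps (stairLower ε) V A ρ (fun y => (-φ) (p.1, y)) (fun y => (-u) (p.1, y)) p.2
      = -opEps (stairUpper ε) V A ρ (fun y => φ (p.1, y)) (fun y => u (p.1, y)) p.2 := by
    simp only [opEps, Pi.neg_apply, hodd, integral_neg, hpv]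
    ring
  unfold hamLower hamUpper
  rw [e1, deriv_neg_apply, dx_neg, abs_neg]
  ring

/-- The nonlocal term changes sign with `v`, but `U'|φ_x|` is even in `φ`; hence `U` has to change
sign as well. -/
lemma IsSuperEps.neg {A ρ ε : ℝ} {v : ℝ × ℝ → ℝ} (hε : 0 < ε)
    (hw : RepKernel (rescaleD2 A V)) (hv : IsSuperEps V U A ρ ε v) :
    IsSubEps V (-U) A ρ ε (-v) := by
  have hmin : ∀ {φ : ℝ × ℝ → ℝ} {p : ℝ × ℝ}, IsMaxOn (fun q => (-v) q - φ q) Q p →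
      IsMinOn (fun q => v q - (-φ) q) Q p := by
    intro φ p hmax q hq
    have := hmax hq
    simp only [mem_ofPred_eq, Pi.neg_apply] at this ⊢
    linarith
  refine ⟨?_, ?_, fun φ hφ p hp hmax hdx => ?_, fun φ hφ p hp hmax hq => ?_⟩
  · intro q hq c hc
    have h1 : -c < v q := by
      simp only [Pi.neg_apply] at hc
      linarith
    filter_upwards [hv.lsc q hq (-c) h1] with x hx
    simp only [Pi.neg_apply]
    linarith
  · obtain ⟨M, hM⟩ := hv.bdd
    exact ⟨M, fun q hq => by simpa using hM q hq⟩
  · have h1 := hv.noncritical (-φ) hφ.neg p hp (hmin hmax) (by rwa [dx_neg, neg_ne_zero])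
    have h2 := hamLower_neg (U := U) (ρ := ρ) (u := -v) hε hw hφ hp hdx
    rw [neg_neg] at h2
    rw [h2, dt_neg] at h1
    linarith
  · have h1 := hv.critical (-φ) hφ.neg p hp (hmin hmax) hq.neg
    rw [dt_neg] at h1
    linarith

lemma IsViscSub.neg {k : ℕ} {H H' : (ℝ × ℝ → ℝ) → ℝ × ℝ → ℝ} {u : ℝ × ℝ → ℝ}
    (hu : IsViscSub k H u) (hH : ∀ ψ p, H (-ψ) p = -H' ψ p) : IsViscSuper k H' (-u) := by
  have hmax : ∀ {ψ : ℝ × ℝ → ℝ} {p : ℝ × ℝ}, IsMinOn (fun q => (-u) q - ψ q) Q p →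
      IsMaxOn (fun q => u q - (-ψ) q) Q p := by
    intro φ p hmin q hq
    have := hmin hq
    simp only [mem_ofPred_eq, Pi.neg_apply] at this ⊢
    linarith
  refine ⟨?_, ?_, fun ψ hψ p hp hmin hdx => ?_, fun ψ hψ p hp hmin hq => ?_⟩
  · intro q hq c hc
    have h1 : u q < -c := by
      simp only [Pi.neg_apply] at hc
      linarith
    filter_upwards [hu.usc q hq (-c) h1] with x hx
    simp only [Pi.neg_apply]
    linarith
  · obtain ⟨M, hM⟩ := hu.bdd
    exact ⟨M, fun q hq => by simpa using hM q hq⟩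
  · have h1 := hu.noncritical (-ψ) hψ.neg p hp (hmax hmin) (by rwa [dx_neg, neg_ne_zero])
    rw [hH, dt_neg] at h1
    linarith
  · have h1 := hu.critical (-ψ) hψ.neg p hp (hmax hmin) hq.neg
    rw [dt_neg] at h1
    linarith

/-- No boundedness is required: over the reals `sSup (-S) = -sInf S` holds for every set, default
values included. -/
lemma liminfStar_eq (v : ℝ → ℝ × ℝ → ℝ) :
    liminfStar E v = -limsupStar E fun ε => -v ε := by
  ext p
  simp only [liminfStar, limsupStar, Pi.neg_apply, liminf_eq, limsup_eq]
  rw [← Real.sSup_neg]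
  congr 1
  ext c
  simp only [mem_ofPred_eq, Set.mem_neg, neg_le_neg_iff]

lemma hamOne_neg {α ρ : ℝ} {u : ℝ × ℝ → ℝ} :
    hamOne V (-U) α ρ u (-φ) p = -hamOne V U α ρ (-u) φ p := by
  have hd : deriv (fun y => (-φ) (p.1, y)) p.2 = -deriv (fun y => φ (p.1, y)) p.2 := dx_neg
  have e1 : opOne V α ρ (fun y => (-φ) (p.1, y)) (fun y => u (p.1, y)) p.2
      = -opOne V α ρ (fun y => φ (p.1, y)) (fun y => (-u) (p.1, y)) p.2 := by
    unfold opOne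
    rw [neg_add, ← integral_neg, ← integral_neg, hd]
    congr 2
    · ext z
      simp only [Pi.neg_apply]
      ring
    · ext z
      simp only [Pi.neg_apply]
      ring
  unfold hamOne
  rw [e1, deriv_neg_apply, dx_neg, abs_neg]
  ring

lemma hamLocal_neg {f : ℝ → ℝ} (hf : ∀ y, f (-y) = f y) :
    hamLocal f (-U) (-φ) p = -hamLocal f U φ p := by
  unfold hamLocal
  rw [deriv_neg_apply, dx_neg, dxx_neg, abs_neg, hf]
  ring

lemma f2_neg (y : ℝ) : f2 V (-y) = f2 V y := by simp [f2]

lemma f3_neg (hker : RepKernel (iteratedDeriv 2 V)) (β y : ℝ) : f3 V β (-y) = f3 V β y := by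
  unfold f3
  simp only [neg_eq_zero, neg_sq]
  rw [← Psi_abs hker, div_neg, abs_neg, Psi_abs hker]

end Duality

/-! ### The convergence theorem -/

section Main

variable {V U : ℝ → ℝ} {E : Set ℝ} {a : ℝ → ℝ} {u : ℝ → ℝ × ℝ → ℝ} {M α β : ℝ} {m : Regime}

lemma AssumptionV.repKernel (hV : AssumptionV m V) : RepKernel (iteratedDeriv 2 V) := by
  cases m
  · exact AssumptionOne.repKernel hV
  · exact AssumptionTwo.repKernel hV
  · exact AssumptionThree.repKernel hV

lemma BasicU.neg (hU : BasicU U) : BasicU (-U) := by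
  obtain ⟨K, hK⟩ := hU.lipschitz
  refine ⟨hU.contDiff.neg, K, ?_⟩
  have : deriv (-U) = -deriv U := funext fun x => deriv_neg_apply x
  rw [this]
  exact hK.neg

theorem SubFamily.isSub (hF : SubFamily V U E a u M) (hV : AssumptionV m V) (hα : 0 < α)
    (hβ : 0 < β) (hscale : Scaling m E a α β) : IsSub m V U α β (limsupStar E u) := by
  cases m
  · exact fun ρ hρ => hF.isViscSub_one hV hα hscale hρ
  · exact hF.isViscSub_two hV hscale.1 hscale.2
  · exact hF.isViscSub_three hV hβ hscale

lemma IsSub.neg {w : ℝ × ℝ → ℝ} (hV : AssumptionV m V) (h : IsSub m V (-U) α β w) :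
    IsSuper m V U α β (-w) := by
  cases m
  · exact fun ρ hρ => (h ρ hρ).neg fun ψ p => hamOne_neg
  · exact IsViscSub.neg h fun ψ p => hamLocal_neg f2_neg
  · exact IsViscSub.neg h fun ψ p => hamLocal_neg (f3_neg (AssumptionV.repKernel hV) β)

end Main

end ParticleHJ

theorem theorem4p5 (m : ParticleHJ.Regime) (V U : ℝ → ℝ)
    (hU : ParticleHJ.BasicU U) (hV : ParticleHJ.AssumptionV m V)
    (E : Set ℝ) (hE : E ⊆ Set.Ioi 0) (hE0 : (0 : ℝ) ∈ closure E)
    (a : ℝ → ℝ) (ha : ∀ ε ∈ E, 0 < a ε)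
    (α β : ℝ) (hα : 0 < α) (hβ : 0 < β) (hscale : ParticleHJ.Scaling m E a α β) :
    (∀ u : ℝ → ℝ × ℝ → ℝ,
      (∀ ε ∈ E, ∃ ρ > 0, ParticleHJ.IsSubEps V U (a ε) ρ ε (u ε)) →
      (∃ M : ℝ, ∀ ε ∈ E, ∀ p ∈ ParticleHJ.Q, |u ε p| ≤ M) →
      ParticleHJ.IsSub m V U α β (ParticleHJ.limsupStar E u)) ∧
    (∀ v : ℝ → ℝ × ℝ → ℝ,
      (∀ ε ∈ E, ∃ ρ > 0, ParticleHJ.IsSuperEps V U (a ε) ρ ε (v ε)) →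
      (∃ M : ℝ, ∀ ε ∈ E, ∀ p ∈ ParticleHJ.Q, |v ε p| ≤ M) →
      ParticleHJ.IsSuper m V U α β (ParticleHJ.liminfStar E v)) := by
  have hker := ParticleHJ.AssumptionV.repKernel hV
  refine ⟨fun u hu ⟨M, hM⟩ => ?_, fun v hv ⟨M, hM⟩ => ?_⟩
  · have hF : ParticleHJ.SubFamily V U E a u M :=
      ⟨hE, hE0, ha, hker, hU.contDiff.continuous_deriv_one, hu, hM⟩
    exact hF.isSub hV hα hβ hscale
  -- The negated family consists of subsolutions for the potential `-U`; the conclusion is reflected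
  -- back at the end.
  · have hF : ParticleHJ.SubFamily V (-U) E a (fun ε => -v ε) M := by
      refine ⟨hE, hE0, ha, hker, hU.neg.contDiff.continuous_deriv_one, fun ε hε => ?_,
        fun ε hε p hp => by simpa using hM ε hε p hp⟩
      obtain ⟨ρ, hρ, h⟩ := hv ε hε
      have hw : ParticleHJ.RepKernel (ParticleHJ.rescaleD2 (a ε) V) := by
        have : ParticleHJ.rescaleD2 (a ε) V = fun z => a ε ^ 3 * iteratedDeriv 2 V (a ε * z) :=
          funext fun z => ParticleHJ.rescaleD2_eq (a ε) V z
        rw [this]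
        exact (hker.scale (ha ε hε)).1
      exact ⟨ρ, hρ, h.neg (hE hε) hw⟩
    rw [ParticleHJ.liminfStar_eq]
    exact (hF.isSub hV hα hβ hscale).neg hV
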